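/- **Setting.** Let $M=(\mathcal S,\mathcal A,P,r,H)$ be a tabular episodic MDP with $S=|\mathcal S|\ge 1$ states, $A=|\mathcal A|\ge1$ actions, time-homogeneous transition probabilities $P(\cdot\mid s,a)$, mean rewards $r(s,a)\in\mathbb R$ and horizon $H\ge 1$. In episode $k=1,2,\dots$ the environment chooses an initial state $s_1^k$ (possibly adaptively), and the agent executes a deterministic policy $\pi^k=(\pi^k_h)_{h\in[H]}$, $\pi_h^k:\mathcal S\to\mathcal A$, that is a function of the observations of the previous episodes: for $h=1,\dots,H$ it plays $a_h^k=\pi_h^k(s_h^k)$ and receives a real reward $R_h^k$, and the state moves to $s_{h+1}^k$. Let $\mathcal F_h^k=\sigma(s_1^1,a_1^1,R_1^1,\dots,s_h^k,a_h^k)$. Conditionally on $\mathcal F_h^k$, $R_h^k$ has mean $r(s_h^k,a_h^k)$ and $s_{h+1}^k$ has law $P(\cdot\mid s_h^k,a_h^k)$. For a deterministic policy $\pi$ let $V_h^\pi(s)=\mathbb E_\pi[\sum_{j=h}^H r(s_j,a_j)\mid s_h=s]$, $Q_h^\pi(s,a)=r(s,a)+\sum_{s'}P(s'\mid s,a)V_{h+1}^\pi(s')$,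 and $V_h^*=\max_\pi V_h^\pi$, $Q_h^*=\max_\pi Q_h^\pi$ (with $V_{H+1}^*=0$). The regret is $\mathrm{Reg}(K)=\sum_{k=1}^K\big(V_1^*(s_1^k)-V_1^{\pi^k}(s_1^k)\big)$, and for $\delta\in(0,1]$ the distributional regret is $\mathrm{Reg}(K,\delta)=\inf\{x\in\mathbb R:\mathbb P(\mathrm{Reg}(K)>x)\le\delta\}$. **Assumptions.** (1) There is a known $V_{\max}\ge0$ with $0\le V_h^\pi(s)\le V_{\max}$ for all $h\in[H]$, $s$ and $\pi$. (2) There are $\sigma_{\exp}:[H]\times\mathcal S\times\mathcal A\to[0,\infty)$ and $V_\alpha\ge0$ such that for all $k\ge1$ and all $h,j\in[H]$ the variable $X=R_h^k+V_{j+1}^*(s_{h+1}^k)-Q_j^*(s_h^k,a_h^k)$ is $\mathcal F_h^k$-conditionally $(\sigma_{\exp}(j,s_h^k,a_h^k),V_\alpha)$-sub-exponential, that is, $\mathbb E[e^{tX}\mid\mathcal F_h^k]\le \exp(\sigma_{\exp}(j,s_h^k,a_h^k)^2t^2/2)$ almost surely for every real $t$ with $|t|V_\alpha\le1$. **Algorithm.**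 Let $(c_{1,k})_{k\ge1}$ in $(0,\infty)$ and $(c_{2,k})_{k\ge1}$ in $(0,\infty]$ be non-decreasing. The agent follows EQO+: let $N^k(s,a)$ be the number of visits of $(s,a)$ in episodes $1,\dots,k-1$, let $\hat r^k(s,a)$ and $\hat P^k(\cdot\mid s,a)$ be the empirical mean reward and the empirical transition frequencies over these visits, and $b^k(s,a)=\frac{c_{1,k}}{N^k(s,a)}\wedge\frac{c_{2,k}}{\sqrt{N^k(s,a)}}$. Put $V_{H+1}^k=0$ and, for $h=H,\dots,1$, $Q_h^k(s,a)=\big(\big(\hat r^k(s,a)+\sum_{s'}\hat P^k(s'\mid s,a)V_{h+1}^k(s')\big)_++b^k(s,a)\big)\wedge V_{\max}$ if $N^k(s,a)>0$ and $Q_h^k(s,a)=V_{\max}$ otherwise, $V_h^k(s)=\max_aQ_h^k(s,a)$, and $\pi_h^k(s)\in\arg\max_aQ_h^k(s,a)$, ties being broken arbitrarily. **Quantities.** Let $W_h^\pi(s)=\mathbb E_\pi[\sum_{j=h}^H\tfrac12\sigma_{\exp}^2(j,s_j,a_j)\mid s_h=s]$, $\mathbb W^*=\max_{h,s,\pi}W_h^\pi(s)$,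 $\mathbb W^*_{\mathrm{diff}}=\max_{h,s,\pi}\big(W_h^\pi(s)-\min_{s'}W_h^\pi(s')\big)$ and $\sigma_{\max}=\max_{h,s,a}2\sigma_{\exp}(h,s,a)\vee\sqrt{2V_\alpha V_{\max}}$ (with $h\in[H]$), and $$\ell_1(i,\delta)=\log\frac{32HSAi^2}{\delta},\qquad \ell_2(k,\delta)=\log\frac{32HSA(\log(e^2kH))^2}{\delta},\qquad \theta=\big(2\sqrt{13\mathbb W^*_{\mathrm{diff}}}\vee2V_\alpha\big)\ell_1(1,\delta).$$ Call real $(\lambda_i)_{i\ge1}$ and integer $(\iota_k)_{k\ge1}$, $\iota_k\ge1$, *auxiliary sequences* for $\delta$ if $\lambda_i>0$ and $\lambda_iV_\alpha\le1$ for all $i$, if $$\frac{\ell_1(\iota_k,\delta)}{\lambda_{\iota_k}}+13\lambda_{\iota_k}\mathbb W^*_{\mathrm{diff}}\,\ell_1(1,\delta)\le c_{1,k}\le\frac{4\ell_1(\iota_k,\delta)}{\lambda_{\iota_k}}$$ for all $k$ with $c_{1,k}\ge\theta$, and if $\iota_k=1$ for all $k$ with $c_{1,k}<\theta$. Given such sequences,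 let $\kappa(\delta)\in\{0,1,2,\dots\}\cup\{\infty\}$ be the largest $k\ge1$ with $c_{1,k}<\theta$ or $c_{2,k}<\big(\sigma_{\max}+\frac{6\mathbb W^*_{\mathrm{diff}}\ell_1(\iota_k,\delta)}{c_{1,k}}\big)\sqrt{\ell_2(k,\delta)}$ ($0$ if there is no such $k$, $\infty$ if there are arbitrarily large ones). **Theorem.** For every $K\ge1$ and $\delta\in(0,1]$, auxiliary sequences exist and can be chosen with $\iota_k\le k\wedge\big(3+\log_2(c_{1,k}/c_{1,1})\big)$ for all $k\ge1$; and for every choice of auxiliary sequences $$\mathrm{Reg}(K,\delta)\le V_{\max}(\kappa(\delta)\wedge K)+\big(16c_{1,K}SA\log(KH)\big)\wedge\big(16\sqrt2\,c_{2,K}\sqrt{HSAK}\big)+\sum_{\kappa(\delta)<k\le K}\frac{18\,\mathbb W^*\ell_1(\iota_k,\delta)}{c_{1,k}}+72V_{\max}S^2A\,\ell_2(K,\delta)\log(2KH).$$ -/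

import Mathlib

open MeasureTheory
open scoped ENNReal

noncomputable section

namespace EQO

/-! ### Tabular episodic MDPs, policies and value functions -/

/-- A tabular episodic MDP with (finite) state space `S` and action space `A`:
time-homogeneous transition probabilities `P s a s'`, mean rewards `r s a`, horizon `H ≥ 1`. -/
structure MDP (S A : Type*) [Fintype S] where
  P : S → A → S → ℝ
  P_nonneg : ∀ s a s', 0 ≤ P s a s'
  P_sum : ∀ s a, ∑ s', P s a s' = 1
  r : S → A → ℝ
  H : ℕ
  one_le_H : 1 ≤ H

/-- A deterministic, step-dependent policy `π = (π_h)`. Steps are numbered `1, …, H`; only these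
components ever matter. -/
abbrev Policy (S A : Type*) := ℕ → S → A

namespace MDP

variable {S A : Type*} [Fintype S] [DecidableEq S]

/-- `M.stateLaw π h n s s'` is the probability of `s_{h+n} = s'` given `s_h = s` when `π` is
followed. -/
def stateLaw (M : MDP S A) (π : Policy S A) : ℕ → ℕ → S → S → ℝ
  | _, 0, s, s' => if s = s' then 1 else 0
  | h, n + 1, s, s' => ∑ s'', M.P s (π h s) s'' * stateLaw M π (h + 1) n s'' s'

/-- `M.expSum π f h s` is the expectation of `∑_{j=h}^H f_j(s_j, a_j)` over the trajectory that
starts from `s_h = s` and follows `a_j = π_j(s_j)`. -/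
def expSum (M : MDP S A) (π : Policy S A) (f : ℕ → S → A → ℝ) (h : ℕ) (s : S) : ℝ :=
  ∑ j ∈ Finset.Icc h M.H, ∑ s', M.stateLaw π h (j - h) s s' * f j s' (π j s')

/-- The value function `V_h^π(s)`; it vanishes at `h = H + 1`. -/
def V (M : MDP S A) (π : Policy S A) (h : ℕ) (s : S) : ℝ :=
  M.expSum π (fun _ s a => M.r s a) h s

/-- The action value function `Q_h^π(s, a)`. -/
def Q (M : MDP S A) (π : Policy S A) (h : ℕ) (s : S) (a : A) : ℝ :=
  M.r s a + ∑ s', M.P s a s' * M.V π (h + 1) s'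

/-- The optimal value function `V_h^*(s) = max_π V_h^π(s)`. -/
def Vstar (M : MDP S A) (h : ℕ) (s : S) : ℝ := ⨆ π : Policy S A, M.V π h s

/-- The optimal action value function `Q_h^*(s, a) = max_π Q_h^π(s, a)`. -/
def Qstar (M : MDP S A) (h : ℕ) (s : S) (a : A) : ℝ := ⨆ π : Policy S A, M.Q π h s a

/-- Boundedness of all value functions: `0 ≤ V_h^π(s) ≤ V_max`. -/
def ValueBounded (M : MDP S A) (Vmax : ℝ) : Prop :=
  ∀ h ∈ Finset.Icc 1 M.H, ∀ (s : S) (π : Policy S A), 0 ≤ M.V π h s ∧ M.V π h s ≤ Vmax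

/-- The total variance proxy function `W_h^π(s)`, the expectation of
`∑_{j=h}^H σ_exp(j, s_j, a_j)² / 2`. -/
def W (M : MDP S A) (σ : ℕ → S → A → ℝ) (π : Policy S A) (h : ℕ) (s : S) : ℝ :=
  M.expSum π (fun j s a => σ j s a ^ 2 / 2) h s

/-- The maximum of `W_h^π(s)` over `h ∈ [H]`, `s` and `π`. -/
def Wstar (M : MDP S A) (σ : ℕ → S → A → ℝ) : ℝ :=
  sSup {w | ∃ h ∈ Finset.Icc 1 M.H, ∃ (s : S) (π : Policy S A), w = M.W σ π h s}

/-- The maximum of `W_h^π(s) - min_{s'} W_h^π(s')` over `h ∈ [H]`, `s` and `π`. -/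
def WdiffStar (M : MDP S A) (σ : ℕ → S → A → ℝ) : ℝ :=
  sSup {w | ∃ h ∈ Finset.Icc 1 M.H, ∃ (s : S) (π : Policy S A),
    w = M.W σ π h s - ⨅ s', M.W σ π h s'}

/-- `σ_max`, the maximum of all `2 σ_exp(h, s, a)` and of `√(2 V_α V_max)`. -/
def sigmaMax (M : MDP S A) (σ : ℕ → S → A → ℝ) (Vα Vmax : ℝ) : ℝ :=
  max (sSup {w | ∃ h ∈ Finset.Icc 1 M.H, ∃ (s : S) (a : A), w = 2 * σ h s a})
    (Real.sqrt (2 * Vα * Vmax))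

end MDP

/-! ### The interaction between an agent and an MDP -/

/-- The random variables of a run: `s k h` and `R k h` are the state and the reward at step `h` of
episode `k` (both numbered from `1`; the states include `s k (H + 1)`), and `π k` is the policy
that the agent executes in episode `k`. -/
structure Run (S A Ω : Type*) where
  s : ℕ → ℕ → Ω → S
  R : ℕ → ℕ → Ω → ℝ
  π : ℕ → Ω → Policy S A

namespace Run

variable {S A Ω : Type*}

/-- The action `a_h^k = π_h^k(s_h^k)`. -/
def a (D : Run S A Ω) (k h : ℕ) (ω : Ω) : A := D.π k ω h (D.s k h ω)

/-- The σ-algebra generated by all observations of the episodes before episode `k`,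
including the rewards and the final states `s_{H+1}`. -/
@[reducible] def past (D : Run S A Ω) (H k : ℕ) : MeasurableSpace Ω :=
  ⨆ i ∈ Finset.Ico 1 k,
    (⨆ h ∈ Finset.Icc 1 H, (MeasurableSpace.comap (D.s i h) ⊤ ⊔ MeasurableSpace.comap (D.a i h) ⊤ ⊔
      MeasurableSpace.comap (D.R i h) (borel ℝ))) ⊔ MeasurableSpace.comap (D.s i (H + 1)) ⊤

/-- The σ-algebra `F_h^k` generated by `s_1^1, a_1^1, R_1^1, …, s_h^k, a_h^k`
(everything up to the action, but not the reward, of step `h` of episode `k`). -/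
@[reducible] def hist (D : Run S A Ω) (H k h : ℕ) : MeasurableSpace Ω :=
  D.past H k ⊔
    (⨆ j ∈ Finset.Icc 1 h, (MeasurableSpace.comap (D.s k j) ⊤ ⊔ MeasurableSpace.comap (D.a k j) ⊤)) ⊔
    ⨆ j ∈ Finset.Ico 1 h, MeasurableSpace.comap (D.R k j) (borel ℝ)

variable [Fintype S] [DecidableEq S] [MeasurableSpace Ω]

/-- `D` is a run of an agent in the MDP `M`: the policy of an episode is a function of the
observations of the previous episodes; given `F_h^k`, the reward has mean `r(s_h^k, a_h^k)` and the
next state has law `P(s_h^k, a_h^k)`. The initial states are arbitrary random variables,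
so the environment may choose them adaptively. -/
structure IsRunOf (D : Run S A Ω) (M : MDP S A) (μ : Measure Ω) : Prop where
  measurable_s : ∀ k ≥ 1, ∀ h ∈ Finset.Icc 1 (M.H + 1), Measurable[‹MeasurableSpace Ω›, ⊤] (D.s k h)
  measurable_R : ∀ k ≥ 1, ∀ h ∈ Finset.Icc 1 M.H, Measurable (D.R k h)
  measurable_π : ∀ k ≥ 1, ∀ h ∈ Finset.Icc 1 M.H, ∀ s : S,
    Measurable[D.past M.H k, ⊤] (fun ω => D.π k ω h s)
  integrable_R : ∀ k ≥ 1, ∀ h ∈ Finset.Icc 1 M.H, Integrable (D.R k h) μ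
  reward_mean : ∀ k ≥ 1, ∀ h ∈ Finset.Icc 1 M.H,
    μ[D.R k h | D.hist M.H k h] =ᵐ[μ] fun ω => M.r (D.s k h ω) (D.a k h ω)
  transition : ∀ k ≥ 1, ∀ h ∈ Finset.Icc 1 M.H, ∀ s' : S,
    μ[fun ω => if D.s k (h + 1) ω = s' then (1 : ℝ) else 0 | D.hist M.H k h]
      =ᵐ[μ] fun ω => M.P (D.s k h ω) (D.a k h ω) s'

/-- The cumulative regret `∑_{k=1}^K (V_1^*(s_1^k) - V_1^{π^k}(s_1^k))`. -/
def regret (D : Run S A Ω) (M : MDP S A) (K : ℕ) (ω : Ω) : ℝ :=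
  ∑ k ∈ Finset.Icc 1 K, (M.Vstar 1 (D.s k 1 ω) - M.V (D.π k ω) 1 (D.s k 1 ω))

/-- The distributional regret `inf {x ∈ ℝ | ℙ(Reg(K) > x) ≤ δ}`, as an extended real
(for `δ = 1` the infimum is over all of `ℝ`). -/
def distRegret (D : Run S A Ω) (M : MDP S A) (μ : Measure Ω) (K : ℕ) (δ : ℝ) : EReal :=
  sInf ((fun x : ℝ => (x : EReal)) ''
    {x : ℝ | μ {ω | x < D.regret M K ω} ≤ ENNReal.ofReal δ})

end Run

/-- `X` is `m`-conditionally `(σ, α)`-sub-exponential: `𝔼[exp(t X) | m] ≤ exp(σ² t² / 2)` almost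
surely whenever `|t| ≤ 1/α` (all real `t` if `α = 0`). -/
def CondSubExponential {Ω : Type*} (m : MeasurableSpace Ω) {_m₀ : MeasurableSpace Ω}
    (μ : Measure Ω) (X σ : Ω → ℝ) (α : ℝ) : Prop :=
  ∀ t : ℝ, |t| * α ≤ 1 →
    Integrable (fun ω => Real.exp (t * X ω)) μ ∧
      μ[fun ω => Real.exp (t * X ω) | m] ≤ᵐ[μ] fun ω => Real.exp (σ ω ^ 2 * t ^ 2 / 2)

/-- Conditional sub-exponentiality of the one-step returns. Since an observed pair
`(R_h^k, s_{h+1}^k)` enters the estimates for every planning step `j`, the variance proxy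
`σ_exp(j, s, a)` is a proxy for `R + V_{j+1}^*(s') - Q_j^*(s, a)` at every visit of `(s, a)`,
whatever the step `h` of the visit. -/
def SubExponentialReturns {S A Ω : Type*} [Fintype S] [DecidableEq S] [MeasurableSpace Ω]
    (D : Run S A Ω) (M : MDP S A) (μ : Measure Ω) (σ : ℕ → S → A → ℝ) (Vα : ℝ) : Prop :=
  ∀ k ≥ 1, ∀ h ∈ Finset.Icc 1 M.H, ∀ j ∈ Finset.Icc 1 M.H,
    CondSubExponential (D.hist M.H k h) μ
      (fun ω => D.R k h ω + M.Vstar (j + 1) (D.s k (h + 1) ω)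
        - M.Qstar j (D.s k h ω) (D.a k h ω))
      (fun ω => σ j (D.s k h ω) (D.a k h ω)) Vα

/-! ### The algorithm -/

/-- `x ∧ (c · y)` for reals `x`, `y > 0` and `c ∈ (0, ∞]`; it equals `x` when `c = ∞`. -/
def minMul (x : ℝ) (c : ℝ≥0∞) (y : ℝ) : ℝ :=
  if c = ⊤ then x else min x (c.toReal * y)

namespace Run

variable {S A Ω : Type*} [DecidableEq S] [DecidableEq A]

/-- The visit count `N^k(s, a)` over the episodes before `k`. -/
def N (D : Run S A Ω) (H k : ℕ) (ω : Ω) (s : S) (a : A) : ℕ :=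
  ∑ i ∈ Finset.Ico 1 k, ∑ h ∈ Finset.Icc 1 H, if D.s i h ω = s ∧ D.a i h ω = a then 1 else 0

/-- The empirical mean reward. -/
def rHat (D : Run S A Ω) (H k : ℕ) (ω : Ω) (s : S) (a : A) : ℝ :=
  1 / (D.N H k ω s a : ℝ) * ∑ i ∈ Finset.Ico 1 k, ∑ h ∈ Finset.Icc 1 H,
    if D.s i h ω = s ∧ D.a i h ω = a then D.R i h ω else 0

/-- The empirical transition probabilities. -/
def PHat (D : Run S A Ω) (H k : ℕ) (ω : Ω) (s : S) (a : A) (s' : S) : ℝ :=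
  1 / (D.N H k ω s a : ℝ) * ∑ i ∈ Finset.Ico 1 k, ∑ h ∈ Finset.Icc 1 H,
    if D.s i h ω = s ∧ D.a i h ω = a ∧ D.s i (h + 1) ω = s' then 1 else 0

/-- The bonus `b^k(s, a) = (c_{1,k} / N^k(s, a)) ∧ (c_{2,k} / √(N^k(s, a)))`. -/
def bonus (D : Run S A Ω) (c₁ : ℕ → ℝ) (c₂ : ℕ → ℝ≥0∞) (H k : ℕ) (ω : Ω) (s : S) (a : A) : ℝ :=
  minMul (c₁ k / (D.N H k ω s a : ℝ)) (c₂ k) (1 / Real.sqrt (D.N H k ω s a : ℝ))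

variable [Fintype S]

/-- One step of the planning recursion: `Q_h^k(s, a)` as a function of `V_{h+1}^k`. -/
def planQ (D : Run S A Ω) (c₁ : ℕ → ℝ) (c₂ : ℕ → ℝ≥0∞) (Vmax : ℝ) (H k : ℕ) (ω : Ω)
    (v : S → ℝ) (s : S) (a : A) : ℝ :=
  if D.N H k ω s a = 0 then Vmax
  else min (max (D.rHat H k ω s a + ∑ s', D.PHat H k ω s a s' * v s') 0
    + D.bonus c₁ c₂ H k ω s a) Vmax

/-- The planned value with `n` steps to go: `V_h^k` is the value at `n = H + 1 - h`. -/
def planV (D : Run S A Ω) (c₁ : ℕ → ℝ) (c₂ : ℕ → ℝ≥0∞) (Vmax : ℝ) (H k : ℕ) (ω : Ω) :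
    ℕ → S → ℝ
  | 0 => fun _ => 0
  | n + 1 => fun s => ⨆ a : A, planQ D c₁ c₂ Vmax H k ω (planV D c₁ c₂ Vmax H k ω n) s a

/-- The estimate `Q_h^k(s, a)` for `h ∈ [H]`, computed from `V_{h+1}^k`. -/
def Qest (D : Run S A Ω) (c₁ : ℕ → ℝ) (c₂ : ℕ → ℝ≥0∞) (Vmax : ℝ) (H k : ℕ) (ω : Ω)
    (h : ℕ) (s : S) (a : A) : ℝ :=
  D.planQ c₁ c₂ Vmax H k ω (D.planV c₁ c₂ Vmax H k ω (H - h)) s a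

/-- The agent follows `EQO+` with parameters `c₁`, `c₂`: each `π_h^k(s)` maximizes
`Q_h^k(s, ·)`, ties being broken arbitrarily. -/
def FollowsEQOPlus (D : Run S A Ω) (H : ℕ) (c₁ : ℕ → ℝ) (c₂ : ℕ → ℝ≥0∞) (Vmax : ℝ) : Prop :=
  ∀ k ≥ 1, ∀ h ∈ Finset.Icc 1 H, ∀ (ω : Ω) (s : S) (a : A),
    D.Qest c₁ c₂ Vmax H k ω h s a ≤ D.Qest c₁ c₂ Vmax H k ω h s (D.π k ω h s)

end Run

/-! ### Logarithmic factors, auxiliary sequences and the bound -/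

section Bound

variable {S A : Type*} [Fintype S] [Fintype A] [DecidableEq S]

/-- `ℓ₁(i, δ) = log (32 H S A i² / δ)`. -/
def ell₁ (M : MDP S A) (i : ℕ) (δ : ℝ) : ℝ :=
  Real.log (32 * M.H * Fintype.card S * Fintype.card A * (i : ℝ) ^ 2 / δ)

/-- `ℓ₂(k, δ) = log (32 H S A (log (e² k H))² / δ)`. -/
def ell₂ (M : MDP S A) (k : ℕ) (δ : ℝ) : ℝ :=
  Real.log (32 * M.H * Fintype.card S * Fintype.card A
    * Real.log (Real.exp 2 * k * M.H) ^ 2 / δ)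

/-- The threshold `(2 √(13 W_diff^*) ∨ 2 V_α) ℓ₁(1, δ)` for `c_{1,k}`. -/
def threshold₁ (M : MDP S A) (σ : ℕ → S → A → ℝ) (Vα δ : ℝ) : ℝ :=
  max (2 * Real.sqrt (13 * M.WdiffStar σ)) (2 * Vα) * ell₁ M 1 δ

/-- The auxiliary sequences `(λ_i)` and `(ι_k)` that index the logarithmic factors:
`0 < λ_i ≤ 1/V_α`; for `c_{1,k}` above the threshold,
`ℓ₁(ι_k, δ)/λ_{ι_k} + 13 λ_{ι_k} W_diff^* ℓ₁(1, δ) ≤ c_{1,k} ≤ 4 ℓ₁(ι_k, δ)/λ_{ι_k}`;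
and `ι_k = 1` for `c_{1,k}` below it. -/
structure IsAuxiliary (M : MDP S A) (σ : ℕ → S → A → ℝ) (Vα δ : ℝ) (c₁ : ℕ → ℝ)
    (lam : ℕ → ℝ) (ι : ℕ → ℕ) : Prop where
  lam_pos : ∀ i ≥ 1, 0 < lam i
  lam_le : ∀ i ≥ 1, lam i * Vα ≤ 1
  one_le : ∀ k ≥ 1, 1 ≤ ι k
  lower : ∀ k ≥ 1, threshold₁ M σ Vα δ ≤ c₁ k →
    ell₁ M (ι k) δ / lam (ι k) + 13 * lam (ι k) * M.WdiffStar σ * ell₁ M 1 δ ≤ c₁ k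
  upper : ∀ k ≥ 1, threshold₁ M σ Vα δ ≤ c₁ k → c₁ k ≤ 4 * ell₁ M (ι k) δ / lam (ι k)
  eq_one : ∀ k ≥ 1, c₁ k < threshold₁ M σ Vα δ → ι k = 1

/-- `κ(δ) ∈ ℕ ∪ {∞}`: the largest `k ≥ 1` for which `c_{1,k}` or `c_{2,k}` is below its threshold
(`0` if there is none, `∞` if there are arbitrarily large ones). -/
def kappa (M : MDP S A) (σ : ℕ → S → A → ℝ) (Vα Vmax δ : ℝ) (c₁ : ℕ → ℝ) (c₂ : ℕ → ℝ≥0∞)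
    (ι : ℕ → ℕ) : ℕ∞ :=
  sSup ((fun k : ℕ => (k : ℕ∞)) '' {k : ℕ | 1 ≤ k ∧ (c₁ k < threshold₁ M σ Vα δ ∨
    c₂ k < ENNReal.ofReal ((M.sigmaMax σ Vα Vmax + 6 * M.WdiffStar σ * ell₁ M (ι k) δ / c₁ k)
      * Real.sqrt (ell₂ M k δ)))})

/-- The number `κ(δ) ∧ K`. -/
def kappaMin (M : MDP S A) (σ : ℕ → S → A → ℝ) (Vα Vmax δ : ℝ) (c₁ : ℕ → ℝ) (c₂ : ℕ → ℝ≥0∞)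
    (ι : ℕ → ℕ) (K : ℕ) : ℕ :=
  (min (kappa M σ Vα Vmax δ c₁ c₂ ι) (K : ℕ∞)).toNat

/-- The gap-independent regret bound. The sum runs over the `k` with `κ(δ) < k ≤ K`. -/
def regretBound (M : MDP S A) (σ : ℕ → S → A → ℝ) (Vα Vmax δ : ℝ) (c₁ : ℕ → ℝ) (c₂ : ℕ → ℝ≥0∞)
    (ι : ℕ → ℕ) (K : ℕ) : ℝ :=
  Vmax * (kappaMin M σ Vα Vmax δ c₁ c₂ ι K : ℝ)
    + minMul (16 * c₁ K * Fintype.card S * Fintype.card A * Real.log (K * M.H))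
        (c₂ K) (16 * Real.sqrt 2 * Real.sqrt (M.H * Fintype.card S * Fintype.card A * K))
    + ∑ k ∈ Finset.Icc (kappaMin M σ Vα Vmax δ c₁ c₂ ι K + 1) K,
        18 * M.Wstar σ * ell₁ M (ι k) δ / c₁ k
    + 72 * Vmax * (Fintype.card S : ℝ) ^ 2 * Fintype.card A * ell₂ M K δ * Real.log (2 * K * M.H)

end Bound

end EQO

end

/-! Optimism is bought only up to a slack. A bonus of order `c₁/N` cannot dominate the deviation of
an empirical one-step return, but for a fixed `λ` the sub-exponential bound splits that deviation
into at most `ℓ/(λN) + λσ²/2`. The first part fits into the bonus. The second does not shrink with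
`N`, but along a trajectory it adds up to at most `λW*` in expectation, so it can be paid by a
function `φ` of step and state whose average drop under every action is at least `λσ²/2`; `λ` times
the maximal total variance proxy `W` is of this kind. Now the error `(P̂ - P)φ` has to be paid as
well. Bernstein bounds it by a multiple of `λ W_diff ℓ/N`, which again fits into the bonus, plus a
multiple of the variance of the centred proxy `w`. Replacing `W` by `9/8 W - w²/(16 W_diff)` creates
a drop that covers this variance too (`slackShape_superharmonic`). Where the bonus is `c₂/√N`,
square-root deviation bounds obtained by peeling take over; the thresholds that define `κ` make both
cases fit (`isSlack_slackShape`). The outcome is quasi-optimism, `V* ≤ V^k + φ` (`IsPlan.Vstar_le`).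

For the regret put `U = V^k - V* + φ ≥ 0`. The function `U` depends on the data, so `(P̂ - P)U`
needs a bound that is uniform over all functions: coordinatewise Bernstein gives `Var(U)/(5Vmax)`
plus a term of order `S Vmax ℓ₂/N` (`failsLE_devP_all`). A quadratic term in `U` inside `potential`
absorbs the variance, and along the executed policy the potential drops on average by at most four
bonuses and twice the transition error (`potential_drift`). So an episode after `κ` costs at most
`4φ`, which yields the terms `18 W* ℓ₁/c₁`, plus an expected sum of costs that may be truncated
because the potential never exceeds `2Vmax`.

Expected costs become realised costs through a nonnegative supermartingale and Ville's inequality,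
with a factor `2` and an additive logarithm (`failsLE_sum_potential`). The counts are frozen during
an episode, so the accounting of an episode stops at the first step whose pair has been visited
within the episode at least as often as before it. Until then the frozen count is comparable with
the running one and the sums of `1/N` and `1/√N` telescope; each stop doubles a count, so stops are
logarithmically few per pair.

All deviation bounds hold for all episodes at once by Ville, so unions are needed only over steps,
pairs, next states and grids of exponential parameters. The events fail with probability at most
four times `δ/8` plus twice `δ/32`. Auxiliary sequences come from the dyadic levels of `c₁`: one `λ`
per level suffices, and `ι` counts the levels met so far. -/

open MeasureTheory
open scoped ENNReal

noncomputable section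

namespace EQO

/-! ### Averages and variances under the transition kernel -/

namespace MDP

variable {S A : Type*} [Fintype S]

/-- The expectation of `g` under `P(· | s, a)`. -/
def avg (M : MDP S A) (s : S) (a : A) (g : S → ℝ) : ℝ := ∑ t, M.P s a t * g t

/-- The variance of `g` under `P(· | s, a)`. -/
def var (M : MDP S A) (s : S) (a : A) (g : S → ℝ) : ℝ :=
  M.avg s a fun s' => (g s' - M.avg s a g) ^ 2

theorem avg_mono (M : MDP S A) (s : S) (a : A) {f g : S → ℝ} (h : ∀ s', f s' ≤ g s') :
    M.avg s a f ≤ M.avg s a g :=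
  Finset.sum_le_sum fun s' _ => mul_le_mul_of_nonneg_left (h s') (M.P_nonneg s a s')

theorem avg_const (M : MDP S A) (s : S) (a : A) (c : ℝ) : M.avg s a (fun _ => c) = c := by
  simp [avg, ← Finset.sum_mul, M.P_sum]

theorem avg_add (M : MDP S A) (s : S) (a : A) (f g : S → ℝ) :
    M.avg s a (fun s' => f s' + g s') = M.avg s a f + M.avg s a g := by
  simp [avg, mul_add, Finset.sum_add_distrib]

theorem avg_sub (M : MDP S A) (s : S) (a : A) (f g : S → ℝ) :
    M.avg s a (fun s' => f s' - g s') = M.avg s a f - M.avg s a g := by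
  simp [avg, mul_sub, Finset.sum_sub_distrib]

theorem avg_const_mul (M : MDP S A) (s : S) (a : A) (c : ℝ) (f : S → ℝ) :
    M.avg s a (fun s' => c * f s') = c * M.avg s a f := by
  simp only [avg, Finset.mul_sum]
  exact Finset.sum_congr rfl fun _ _ => by ring

theorem avg_nonneg (M : MDP S A) (s : S) (a : A) {f : S → ℝ} (h : ∀ s', 0 ≤ f s') :
    0 ≤ M.avg s a f :=
  Finset.sum_nonneg fun s' _ => mul_nonneg (M.P_nonneg s a s') (h s')

theorem avg_le (M : MDP S A) (s : S) (a : A) {f : S → ℝ} {c : ℝ} (h : ∀ s', f s' ≤ c) :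
    M.avg s a f ≤ c := by
  simpa [avg_const] using M.avg_mono s a h

theorem le_avg (M : MDP S A) (s : S) (a : A) {f : S → ℝ} {c : ℝ} (h : ∀ s', c ≤ f s') :
    c ≤ M.avg s a f := by
  simpa [avg_const] using M.avg_mono s a h

theorem var_eq (M : MDP S A) (s : S) (a : A) (g : S → ℝ) :
    M.var s a g = M.avg s a (fun s' => g s' ^ 2) - M.avg s a g ^ 2 := by
  have h : (fun s' => (g s' - M.avg s a g) ^ 2)
      = fun s' => (g s' ^ 2 - (2 * M.avg s a g) * g s') + M.avg s a g ^ 2 := by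
    funext s'; ring
  rw [var, h, avg_add, avg_sub, avg_const_mul, avg_const]
  ring

theorem var_nonneg (M : MDP S A) (s : S) (a : A) (g : S → ℝ) : 0 ≤ M.var s a g :=
  M.avg_nonneg s a fun _ => sq_nonneg _

/-- The variance as a double expectation of squared differences. -/
theorem two_mul_var (M : MDP S A) (s : S) (a : A) (g : S → ℝ) :
    2 * M.var s a g = M.avg s a fun x => M.avg s a fun y => (g x - g y) ^ 2 := by
  have h : ∀ x, (M.avg s a fun y => (g x - g y) ^ 2)
      = (g x ^ 2 - (2 * M.avg s a g) * g x) + M.avg s a (fun y => g y ^ 2) := by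
    intro x
    have : (fun y => (g x - g y) ^ 2) = fun y => (g x ^ 2 - (2 * g x) * g y) + g y ^ 2 := by
      funext y; ring
    rw [this, avg_add, avg_sub, avg_const_mul, avg_const]
    ring
  simp only [h]
  rw [avg_add, avg_sub, avg_const_mul, avg_const, var_eq]
  ring

/-- In the form of `two_mul_var` the variance only sees differences of values, so a Lipschitz bound
passes through termwise. It serves to replace the variance of `slackShape` by that of the centred
proxy. -/
theorem var_le_of_lipschitz (M : MDP S A) (s : S) (a : A) {f g : S → ℝ} {c : ℝ}
    (h : ∀ x y, |f x - f y| ≤ c * |g x - g y|) : M.var s a f ≤ c ^ 2 * M.var s a g := by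
  have : 2 * M.var s a f ≤ c ^ 2 * (2 * M.var s a g) := by
    rw [two_mul_var, two_mul_var, ← avg_const_mul]
    refine M.avg_mono s a fun x => ?_
    rw [← avg_const_mul]
    refine M.avg_mono s a fun y => ?_
    rw [← sq_abs (f x - f y), ← sq_abs (g x - g y), ← mul_pow]
    exact pow_le_pow_left₀ (abs_nonneg _) (h x y) 2
  linarith

theorem two_mul_le_sigmaMax [Fintype A] (M : MDP S A) (σ : ℕ → S → A → ℝ) (Vα Vmax : ℝ) {h : ℕ}
    (h1 : 1 ≤ h) (h2 : h ≤ M.H) (s : S) (a : A) : 2 * σ h s a ≤ M.sigmaMax σ Vα Vmax := by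
  have hmem : 2 * σ h s a ∈ {w | ∃ h ∈ Finset.Icc 1 M.H, ∃ (s : S) (a : A), w = 2 * σ h s a} :=
    ⟨h, Finset.mem_Icc.2 ⟨h1, h2⟩, s, a, rfl⟩
  refine le_trans (le_csSup ?_ hmem) (le_max_left _ _)
  have hfin : (⋃ h ∈ Finset.Icc 1 M.H, Set.range fun p : S × A => 2 * σ h p.1 p.2).Finite :=
    (Finset.Icc 1 M.H).finite_toSet.biUnion fun h _ => Set.finite_range _
  refine hfin.bddAbove.mono ?_
  rintro _ ⟨h, hh, s, a, rfl⟩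
  exact Set.mem_biUnion hh ⟨(s, a), rfl⟩

/-! ### Dynamic programming -/

/-- Backward induction over the steps `h ≤ H + 1`. -/
theorem step_induction (M : MDP S A) {p : ℕ → Prop} (h0 : p (M.H + 1))
    (hs : ∀ h, 1 ≤ h → h ≤ M.H → p (h + 1) → p h) : ∀ h, 1 ≤ h → h ≤ M.H + 1 → p h := by
  intro h h1 h2
  induction h2 using Nat.decreasingInduction with
  | self => exact h0
  | of_succ k hk ih => exact hs k h1 (by omega) (ih (by omega))

variable [DecidableEq S]

theorem expSum_of_lt (M : MDP S A) (π : Policy S A) (f : ℕ → S → A → ℝ) {h : ℕ} (hh : M.H < h)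
    (s : S) : M.expSum π f h s = 0 := by
  simp [expSum, Finset.Icc_eq_empty_of_lt hh]

/-- Bellman's equation for an arbitrary step-dependent reward: the term `j = h` is deterministic,
and in all later terms the recursion of `stateLaw` splits off the first transition. -/
theorem expSum_eq (M : MDP S A) (π : Policy S A) (f : ℕ → S → A → ℝ) {h : ℕ} (hh : h ≤ M.H)
    (s : S) :
    M.expSum π f h s = f h s (π h s) + M.avg s (π h s) (M.expSum π f (h + 1)) := by
  have hins : Finset.Icc h M.H = insert h (Finset.Icc (h + 1) M.H) := by
    ext j; simp only [Finset.mem_Icc, Finset.mem_insert]; omega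
  have h0 : ∑ s', M.stateLaw π h (h - h) s s' * f h s' (π h s') = f h s (π h s) := by
    simp [stateLaw]
  have h1 : ∀ j ∈ Finset.Icc (h + 1) M.H,
      ∑ s', M.stateLaw π h (j - h) s s' * f j s' (π j s')
      = ∑ s'', M.P s (π h s) s'' *
          ∑ s', M.stateLaw π (h + 1) (j - (h + 1)) s'' s' * f j s' (π j s') := by
    intro j hj
    have : j - h = (j - (h + 1)) + 1 := by have := (Finset.mem_Icc.1 hj).1; omega
    rw [this]
    simp only [stateLaw, Finset.sum_mul, Finset.mul_sum]
    rw [Finset.sum_comm]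
    exact Finset.sum_congr rfl fun _ _ => Finset.sum_congr rfl fun _ _ => by ring
  have hlhs : M.expSum π f h s = ∑ j ∈ Finset.Icc h M.H,
      ∑ s', M.stateLaw π h (j - h) s s' * f j s' (π j s') := rfl
  rw [hlhs, hins, Finset.sum_insert (by simp), h0, Finset.sum_congr rfl h1, Finset.sum_comm]
  simp only [avg, expSum, Finset.mul_sum]

/-- The optimal value with `n` steps to go, for the rewards `f`. -/
def optAux [Fintype A] [Nonempty A] (M : MDP S A) (f : ℕ → S → A → ℝ) : ℕ → S → ℝ
  | 0 => fun _ => 0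
  | n + 1 => fun s => Finset.univ.sup' Finset.univ_nonempty
      fun a => f (M.H - n) s a + M.avg s a (optAux M f n)

/-- A single policy attains the optimum of `expSum` from every step and state. -/
theorem exists_optimal [Fintype A] [Nonempty A] (M : MDP S A) (f : ℕ → S → A → ℝ) :
    ∃ π : Policy S A, ∀ h, 1 ≤ h → h ≤ M.H → ∀ s a,
      f h s a + M.avg s a (M.expSum π f (h + 1)) ≤ M.expSum π f h s := by
  have hex : ∀ n s, ∃ a, M.optAux f (n + 1) s = f (M.H - n) s a + M.avg s a (M.optAux f n) := by
    intro n s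
    obtain ⟨a, -, ha⟩ := Finset.exists_mem_eq_sup' (s := (Finset.univ : Finset A))
      Finset.univ_nonempty fun a => f (M.H - n) s a + M.avg s a (M.optAux f n)
    exact ⟨a, ha⟩
  choose act hact using hex
  -- `optAux` is indexed by the number of steps to go, and `n = H - h` steps remain after step `h`.
  -- The same greedy choice serves all starting points.
  let π : Policy S A := fun h s => act (M.H - h) s
  have key : ∀ h, 1 ≤ h → h ≤ M.H + 1 → M.expSum π f h = M.optAux f (M.H + 1 - h) := by
    refine M.step_induction ?_ ?_
    · funext s; simp [expSum_of_lt, optAux]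
    · intro h h1 h2 ih
      funext s
      have e1 : M.H + 1 - h = (M.H - h) + 1 := by omega
      have e2 : M.H + 1 - (h + 1) = M.H - h := by omega
      have e3 : M.H - (M.H - h) = h := by omega
      rw [expSum_eq M π f h2, ih, e1, e2, hact, e3]
  refine ⟨π, fun h h1 h2 s a => ?_⟩
  have e1 : M.H + 1 - h = (M.H - h) + 1 := by omega
  have e2 : M.H + 1 - (h + 1) = M.H - h := by omega
  have e3 : M.H - (M.H - h) = h := by omega
  rw [key h h1 (by omega), key (h + 1) (by omega) (by omega), e1, e2]
  have := Finset.le_sup' (s := (Finset.univ : Finset A))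
    (fun a => f (M.H - (M.H - h)) s a + M.avg s a (M.optAux f (M.H - h))) (Finset.mem_univ a)
  rw [e3] at this
  simpa only [optAux, e3] using this

/-- Verification principle: averaging preserves order, so a supersolution of the Bellman equation
dominates the value of every policy by backward induction. -/
theorem expSum_le_of_superharmonic (M : MDP S A) (f : ℕ → S → A → ℝ) (v : ℕ → S → ℝ)
    (h0 : ∀ s, 0 ≤ v (M.H + 1) s)
    (hv : ∀ h, 1 ≤ h → h ≤ M.H → ∀ s a, f h s a + M.avg s a (v (h + 1)) ≤ v h s)
    (π : Policy S A) : ∀ h, 1 ≤ h → h ≤ M.H + 1 → ∀ s, M.expSum π f h s ≤ v h s := by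
  refine M.step_induction ?_ ?_
  · intro s; rw [expSum_of_lt _ _ _ (by omega)]; exact h0 s
  · intro h h1 h2 ih s
    rw [expSum_eq M π f h2]
    exact le_trans (by have := M.avg_mono s (π h s) ih; linarith) (hv h h1 h2 s (π h s))

theorem expSum_nonneg (M : MDP S A) (π : Policy S A) (f : ℕ → S → A → ℝ)
    (hf : ∀ h s a, 0 ≤ f h s a) : ∀ h, 1 ≤ h → h ≤ M.H + 1 → ∀ s, 0 ≤ M.expSum π f h s := by
  refine M.step_induction ?_ ?_
  · intro s; rw [expSum_of_lt _ _ _ (by omega)]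
  · intro h h1 h2 ih s
    rw [expSum_eq M π f h2]
    exact add_nonneg (hf _ _ _) (M.avg_nonneg s _ ih)

theorem expSum_le_of_optimal (M : MDP S A) (f : ℕ → S → A → ℝ) {π : Policy S A}
    (hπ : ∀ h, 1 ≤ h → h ≤ M.H → ∀ s a,
      f h s a + M.avg s a (M.expSum π f (h + 1)) ≤ M.expSum π f h s) (ρ : Policy S A) :
    ∀ h, 1 ≤ h → h ≤ M.H + 1 → ∀ s, M.expSum ρ f h s ≤ M.expSum π f h s :=
  M.expSum_le_of_superharmonic f (M.expSum π f)
    (fun s => by rw [expSum_of_lt _ _ _ (by omega)]) hπ ρ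

/-! ### Optimal values -/

theorem V_eq (M : MDP S A) (π : Policy S A) {h : ℕ} (hh : h ≤ M.H) (s : S) :
    M.V π h s = M.r s (π h s) + M.avg s (π h s) (M.V π (h + 1)) :=
  M.expSum_eq π _ hh s

theorem V_succ_H (M : MDP S A) (π : Policy S A) (s : S) : M.V π (M.H + 1) s = 0 :=
  M.expSum_of_lt π _ (by omega) s

/-- The facts about the optimal values that the analysis uses. -/
theorem exists_optimal_policy [Fintype A] [Nonempty A] (M : MDP S A) :
    ∃ π : Policy S A, (∀ h, 1 ≤ h → h ≤ M.H + 1 → ∀ s, M.Vstar h s = M.V π h s) ∧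
      (∀ h, 1 ≤ h → h ≤ M.H → ∀ s a,
        M.Qstar h s a = M.r s a + M.avg s a (M.Vstar (h + 1))) ∧
      ∀ h, 1 ≤ h → h ≤ M.H → ∀ s a, M.Qstar h s a ≤ M.Vstar h s := by
  obtain ⟨π, hπ⟩ := M.exists_optimal fun _ s a => M.r s a
  have hle := M.expSum_le_of_optimal _ hπ
  have hbdd : ∀ h, 1 ≤ h → h ≤ M.H + 1 → ∀ s,
      BddAbove (Set.range fun π : Policy S A => M.V π h s) := by
    rintro h h1 h2 s
    exact ⟨M.V π h s, by rintro _ ⟨π', rfl⟩; exact hle π' h h1 h2 s⟩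
  have : Nonempty (Policy S A) := ⟨π⟩
  have hV : ∀ h, 1 ≤ h → h ≤ M.H + 1 → ∀ s, M.Vstar h s = M.V π h s := by
    intro h h1 h2 s
    exact le_antisymm (ciSup_le fun π' => hle π' h h1 h2 s) (le_ciSup (hbdd h h1 h2 s) π)
  have hQ : ∀ h, 1 ≤ h → h ≤ M.H → ∀ s a,
      M.Qstar h s a = M.r s a + M.avg s a (M.Vstar (h + 1)) := by
    intro h h1 h2 s a
    have hub : ∀ π', M.Q π' h s a ≤ M.r s a + M.avg s a (M.Vstar (h + 1)) := fun π' =>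
      add_le_add le_rfl
        (M.avg_mono s a fun s' => le_ciSup (hbdd (h + 1) (by omega) (by omega) s') π')
    refine le_antisymm (ciSup_le hub) ?_
    have : M.r s a + M.avg s a (M.Vstar (h + 1)) = M.Q π h s a := by
      have : M.Vstar (h + 1) = M.V π (h + 1) := funext fun s' => hV _ (by omega) (by omega) s'
      rw [this]; rfl
    rw [this]
    exact le_ciSup ⟨_, by rintro _ ⟨π', rfl⟩; exact hub π'⟩ π
  refine ⟨π, hV, hQ, fun h h1 h2 s a => ?_⟩
  have : M.Vstar (h + 1) = M.V π (h + 1) := funext fun s' => hV _ (by omega) (by omega) s'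
  rw [hQ h h1 h2, hV h h1 (by omega), this]
  exact hπ h h1 h2 s a

theorem V_mem (M : MDP S A) {Vmax : ℝ} (hVmax : 0 ≤ Vmax) (hV : M.ValueBounded Vmax)
    (π : Policy S A) {h : ℕ} (h1 : 1 ≤ h) (h2 : h ≤ M.H + 1) (s : S) :
    0 ≤ M.V π h s ∧ M.V π h s ≤ Vmax := by
  rcases Nat.lt_or_ge M.H h with h3 | h3
  · obtain rfl : h = M.H + 1 := by omega
    rw [V_succ_H]; exact ⟨le_rfl, hVmax⟩
  · exact hV h (Finset.mem_Icc.2 ⟨h1, h3⟩) s π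

section Values

variable [Fintype A] [Nonempty A]

theorem Qstar_eq (M : MDP S A) {h : ℕ} (h1 : 1 ≤ h) (h2 : h ≤ M.H) (s : S) (a : A) :
    M.Qstar h s a = M.r s a + M.avg s a (M.Vstar (h + 1)) := by
  obtain ⟨_, _, h, _⟩ := M.exists_optimal_policy
  exact h _ h1 h2 s a

theorem Qstar_le_Vstar (M : MDP S A) {h : ℕ} (h1 : 1 ≤ h) (h2 : h ≤ M.H) (s : S) (a : A) :
    M.Qstar h s a ≤ M.Vstar h s := by
  obtain ⟨_, _, _, h⟩ := M.exists_optimal_policy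
  exact h _ h1 h2 s a

theorem Vstar_succ_H (M : MDP S A) (s : S) : M.Vstar (M.H + 1) s = 0 := by
  obtain ⟨π, h, _, _⟩ := M.exists_optimal_policy
  rw [h _ (by omega) le_rfl, V_succ_H]

theorem exists_Vstar_eq_Qstar (M : MDP S A) {h : ℕ} (h1 : 1 ≤ h) (h2 : h ≤ M.H) (s : S) :
    ∃ a, M.Vstar h s = M.Qstar h s a := by
  obtain ⟨π, hπ, _, _⟩ := M.exists_optimal_policy
  refine ⟨π h s, ?_⟩
  have : M.Vstar (h + 1) = M.V π (h + 1) := funext fun s' => hπ _ (by omega) (by omega) s'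
  rw [hπ _ h1 (by omega), V_eq M π h2, Qstar_eq M h1 h2, this]

theorem Vstar_mem (M : MDP S A) {Vmax : ℝ} (hVmax : 0 ≤ Vmax) (hV : M.ValueBounded Vmax) {h : ℕ}
    (h1 : 1 ≤ h) (h2 : h ≤ M.H + 1) (s : S) : 0 ≤ M.Vstar h s ∧ M.Vstar h s ≤ Vmax := by
  obtain ⟨π, hπ, -, -⟩ := M.exists_optimal_policy
  rw [hπ h h1 h2]
  exact M.V_mem hVmax hV π h1 h2 s

end Values

/-! ### The maximal total variance proxy -/

/-- The properties of `W`, the pointwise maximum over all policies of the total variance proxy,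
and of its centred version `w`. -/
structure IsMaxProxy (M : MDP S A) (σ : ℕ → S → A → ℝ) (W w : ℕ → S → ℝ) : Prop where
  nonneg : ∀ h, 1 ≤ h → h ≤ M.H + 1 → ∀ s, 0 ≤ W h s
  le_Wstar : ∀ h, 1 ≤ h → h ≤ M.H + 1 → ∀ s, W h s ≤ M.Wstar σ
  succ_H : ∀ s, W (M.H + 1) s = 0
  superharmonic : ∀ h, 1 ≤ h → h ≤ M.H → ∀ s a, σ h s a ^ 2 / 2 + M.avg s a (W (h + 1)) ≤ W h s
  centred : ∃ m : ℕ → ℝ, (∀ h s, w h s = W h s - m h) ∧ (∀ h, 1 ≤ h → h ≤ M.H + 1 → 0 ≤ m h) ∧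
    ∀ h, 1 ≤ h → h ≤ M.H → m (h + 1) ≤ m h
  centred_nonneg : ∀ h, 1 ≤ h → h ≤ M.H + 1 → ∀ s, 0 ≤ w h s
  centred_le : ∀ h, 1 ≤ h → h ≤ M.H + 1 → ∀ s, w h s ≤ M.WdiffStar σ

/-- Take `W` to be the proxy of one policy that is optimal for the reward `σ²/2`: optimality makes
it superharmonic under every action, and being the proxy of an actual policy it is bounded by the
suprema `Wstar` and `WdiffStar`. Centring subtracts the minimum over states. These minima do not
increase with the step, because each value at step `h` is at least an average of values at step `h +
1`. -/
theorem exists_maxProxy [Fintype A] [Nonempty A] [Nonempty S] (M : MDP S A) (σ : ℕ → S → A → ℝ) :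
    ∃ W w, M.IsMaxProxy σ W w := by
  obtain ⟨π, hπ⟩ := M.exists_optimal fun j s a => σ j s a ^ 2 / 2
  have hle := M.expSum_le_of_optimal _ hπ
  have hnn : ∀ (π' : Policy S A) h, 1 ≤ h → h ≤ M.H + 1 → ∀ s, 0 ≤ M.W σ π' h s := fun π' =>
    M.expSum_nonneg π' _ fun h s a => by positivity
  -- The suprema range over infinitely many policies, so their boundedness has to be shown; the
  -- optimal policy reduces it to finitely many values.
  have hfin : BddAbove (⋃ h ∈ Finset.Icc 1 M.H, Set.range (M.W σ π h)) :=
    ((Finset.Icc 1 M.H).finite_toSet.biUnion fun h _ => Set.finite_range _).bddAbove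
  obtain ⟨C, hC⟩ := hfin
  have hC' : ∀ h, h ∈ Finset.Icc 1 M.H → ∀ s (π' : Policy S A), M.W σ π' h s ≤ C := by
    intro h hh s π'
    have h12 := Finset.mem_Icc.1 hh
    exact (hle π' h h12.1 (by omega) s).trans (hC (Set.mem_biUnion hh ⟨s, rfl⟩))
  have hinf : ∀ (π' : Policy S A) h s, ⨅ s', M.W σ π' h s' ≤ M.W σ π' h s := fun π' h s =>
    ciInf_le (Set.finite_range _).bddBelow s
  have hinf0 : ∀ (π' : Policy S A) h, 1 ≤ h → h ≤ M.H + 1 → 0 ≤ ⨅ s', M.W σ π' h s' :=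
    fun π' h h1 h2 => le_ciInf fun s => hnn π' h h1 h2 s
  have hend : ∀ s, M.W σ π (M.H + 1) s = 0 := fun s => M.expSum_of_lt π _ (by omega) s
  have hb1 : BddAbove {w | ∃ h ∈ Finset.Icc 1 M.H, ∃ (s : S) (π : Policy S A),
      w = M.W σ π h s} := by
    refine ⟨C, ?_⟩
    rintro _ ⟨h, hh, s, π', rfl⟩
    exact hC' h hh s π'
  have hb2 : BddAbove {w | ∃ h ∈ Finset.Icc 1 M.H, ∃ (s : S) (π : Policy S A),
      w = M.W σ π h s - ⨅ s', M.W σ π h s'} := by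
    refine ⟨C, ?_⟩
    rintro _ ⟨h, hh, s, π', rfl⟩
    have h12 := Finset.mem_Icc.1 hh
    have := hinf0 π' h h12.1 (by omega)
    have := hC' h hh s π'
    linarith
  have hW0 : ∀ h, 1 ≤ h → h ≤ M.H → ∀ s, M.W σ π h s ≤ M.Wstar σ := fun h h1 h2 s =>
    le_csSup hb1 ⟨h, Finset.mem_Icc.2 ⟨h1, h2⟩, s, π, rfl⟩
  have hD0 : ∀ h, 1 ≤ h → h ≤ M.H → ∀ s,
      M.W σ π h s - ⨅ s', M.W σ π h s' ≤ M.WdiffStar σ := fun h h1 h2 s =>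
    le_csSup hb2 ⟨h, Finset.mem_Icc.2 ⟨h1, h2⟩, s, π, rfl⟩
  have hH := M.one_le_H
  obtain ⟨s₀⟩ := ‹Nonempty S›
  refine ⟨M.W σ π, fun h s => M.W σ π h s - ⨅ s', M.W σ π h s', hnn π, ?_, hend, hπ,
    ⟨fun h => ⨅ s', M.W σ π h s', fun _ _ => rfl, hinf0 π, ?_⟩,
    fun h h1 h2 s => sub_nonneg.2 (hinf π h s), ?_⟩
  · intro h h1 h2 s
    rcases Nat.lt_or_ge M.H h with h3 | h3
    · obtain rfl : h = M.H + 1 := by omega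
      rw [hend]
      exact (hnn π 1 le_rfl (by omega) s₀).trans (hW0 1 le_rfl hH s₀)
    · exact hW0 h h1 h3 s
  · intro h h1 h2
    have : Nonempty S := ⟨s₀⟩
    refine le_ciInf fun s => ?_
    have h3 := hπ h h1 h2 s (π h s)
    have h4 := M.le_avg s (π h s) (hinf π (h + 1))
    have h5 : 0 ≤ σ h s (π h s) ^ 2 / 2 := by positivity
    change _ ≤ M.expSum π _ h s
    have h6 : M.avg s (π h s) (M.W σ π (h + 1)) = M.avg s (π h s)
      (M.expSum π (fun j s a => σ j s a ^ 2 / 2) (h + 1)) := rfl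
    linarith
  · intro h h1 h2 s
    rcases Nat.lt_or_ge M.H h with h3 | h3
    · obtain rfl : h = M.H + 1 := by omega
      have : ⨅ s', M.W σ π (M.H + 1) s' = 0 := by
        have : Nonempty S := ⟨s₀⟩
        simp [hend]
      rw [hend, this]
      have := hD0 1 le_rfl hH s₀
      have := hinf π 1 s₀
      linarith
    · exact hD0 h h1 h3 s

end MDP

end EQO

namespace EQO

/-! ### Nonnegative supermartingales in product form -/

section CondLeOne

variable {Ω : Type*}

/-- The conditional expectation of `ξ ≥ 0` given `m` is at most `1`. -/
def CondLeOne (m : MeasurableSpace Ω) {m₀ : MeasurableSpace Ω} (μ : Measure Ω)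
    (ξ : Ω → ℝ≥0∞) : Prop :=
  ∀ B, MeasurableSet[m] B → ∫⁻ ω in B, ξ ω ∂μ ≤ μ B

/-- The hypothesis says that the measures with densities `ξ` and `η` are ordered after restriction
to `m`, hence so are their integrals of `m`-measurable functions. -/
theorem lintegral_mul_le_of_setLIntegral_le {m m₀ : MeasurableSpace Ω} {μ : Measure Ω}
    (hm : m ≤ m₀) {ξ η : Ω → ℝ≥0∞} (hξ : Measurable ξ) (hη : Measurable η)
    (h : ∀ B, MeasurableSet[m] B → ∫⁻ ω in B, ξ ω ∂μ ≤ ∫⁻ ω in B, η ω ∂μ)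
    {g : Ω → ℝ≥0∞} (hg : Measurable[m] g) :
    ∫⁻ ω, g ω * ξ ω ∂μ ≤ ∫⁻ ω, g ω * η ω ∂μ := by
  have hle : (μ.withDensity ξ).trim hm ≤ (μ.withDensity η).trim hm := by
    refine @Measure.le_iff _ m _ _ |>.2 fun B hB => ?_
    rw [trim_measurableSet_eq hm hB, trim_measurableSet_eq hm hB, withDensity_apply _ (hm B hB),
      withDensity_apply _ (hm B hB)]
    exact h B hB
  have hg' : Measurable g := hg.mono hm le_rfl
  have e : ∀ ζ : Ω → ℝ≥0∞, Measurable ζ →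
      ∫⁻ ω, g ω * ζ ω ∂μ = ∫⁻ ω, g ω ∂((μ.withDensity ζ).trim hm) := by
    intro ζ hζ
    rw [lintegral_trim hm hg, lintegral_withDensity_eq_lintegral_mul _ hζ hg']
    simp [mul_comm]
  rw [e ξ hξ, e η hη]
  exact lintegral_mono' hle le_rfl

theorem CondLeOne.lintegral_mul_le {m m₀ : MeasurableSpace Ω} {μ : Measure Ω} (hm : m ≤ m₀)
    {ξ : Ω → ℝ≥0∞} (hξ : Measurable ξ) (h : CondLeOne m μ ξ) {g : Ω → ℝ≥0∞}
    (hg : Measurable[m] g) : ∫⁻ ω, g ω * ξ ω ∂μ ≤ ∫⁻ ω, g ω ∂μ := by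
  simpa using lintegral_mul_le_of_setLIntegral_le hm hξ (η := fun _ => 1) measurable_const
    (fun B hB => by simpa using h B hB) hg

/-- Tower property: the first factor, cut down to the event, is `m₂`-measurable, so the second
factor can be integrated out first. -/
theorem CondLeOne.mul {m₁ m₂ m₀ : MeasurableSpace Ω} {μ : Measure Ω} (h12 : m₁ ≤ m₂) (h2 : m₂ ≤ m₀)
    {ξ η : Ω → ℝ≥0∞} (hξm : Measurable[m₂] ξ) (hηm : Measurable η) (hξ : CondLeOne m₁ μ ξ)
    (hη : CondLeOne m₂ μ η) : CondLeOne m₁ μ fun ω => ξ ω * η ω := by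
  intro B hB
  have hB2 := h12 B hB
  calc ∫⁻ ω in B, ξ ω * η ω ∂μ = ∫⁻ ω, B.indicator ξ ω * η ω ∂μ := by
        rw [← lintegral_indicator (h2 B hB2)]
        congr 1; funext ω; by_cases hω : ω ∈ B <;> simp [hω]
    _ ≤ ∫⁻ ω, B.indicator ξ ω ∂μ := hη.lintegral_mul_le h2 hηm (hξm.indicator hB2)
    _ = ∫⁻ ω in B, ξ ω ∂μ := lintegral_indicator (h2 B hB2) _
    _ ≤ μ B := hξ B hB

/-- **Ville's inequality** for a nonnegative supermartingale `∏ i < n, ξ i`. -/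
theorem measure_exists_le_prod_le {m₀ : MeasurableSpace Ω} {μ : Measure Ω} [IsProbabilityMeasure μ]
    {F : ℕ → MeasurableSpace Ω} (hF : ∀ n, F n ≤ m₀) (hmono : Monotone F) {ξ : ℕ → Ω → ℝ≥0∞}
    (hmeas : ∀ n, Measurable[F (n + 1)] (ξ n)) (hcond : ∀ n, CondLeOne (F n) μ (ξ n))
    (a : ℝ≥0∞) (T : ℕ) :
    a * μ {ω | ∃ n ≤ T, a ≤ ∏ i ∈ Finset.range n, ξ i ω} ≤ 1 := by
  set X : ℕ → Ω → ℝ≥0∞ := fun n ω => ∏ i ∈ Finset.range n, ξ i ω with hX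
  have hXm : ∀ n, Measurable[F n] (X n) := by
    intro n
    refine Finset.measurable_prod _ fun i hi => ?_
    exact (hmeas i).mono (hmono (by have := Finset.mem_range.1 hi; omega)) le_rfl
  set E : ℕ → Set Ω := fun n => {ω | ∃ j ≤ n, a ≤ X j ω} with hE
  have hEm : ∀ n, MeasurableSet[F n] (E n) := by
    intro n
    have : E n = ⋃ j ∈ Finset.range (n + 1), {ω | a ≤ X j ω} := by
      ext ω; simp [hE]
    rw [this]
    refine Finset.measurableSet_biUnion _ fun j hj => ?_
    have hj' := hmono (show j ≤ n by have := Finset.mem_range.1 hj; omega)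
    exact hj' _ (hXm j measurableSet_Ici)
  -- The process is frozen at the level `a` when it first reaches it. The frozen expectation starts
  -- at most at `1` and cannot increase.
  have key : ∀ n, a * μ (E n) + ∫⁻ ω, (E n)ᶜ.indicator (X n) ω ∂μ ≤ 1 := by
    intro n
    induction n with
    | zero =>
      by_cases ha : a ≤ 1
      · have : E 0 = Set.univ := by ext ω; simp [hE, hX, ha]
        simp [this, ha]
      · have : E 0 = ∅ := by ext ω; simp [hE, hX, ha]
        simp [this, hX]
    | succ n ih =>
      refine le_trans ?_ ih
      have hsub : E n ⊆ E (n + 1) := fun ω ⟨j, hj, h⟩ => ⟨j, by omega, h⟩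
      have hE0 := fun n => hF n _ (hEm n)
      have e1 : a * μ (E (n + 1)) + ∫⁻ ω, (E (n + 1))ᶜ.indicator (X (n + 1)) ω ∂μ
          ≤ ∫⁻ ω, (E n).indicator (fun _ => a) ω + (E n)ᶜ.indicator (X n) ω * ξ n ω ∂μ := by
        have e0 : a * μ (E (n + 1)) = ∫⁻ ω, (E (n + 1)).indicator (fun _ => a) ω ∂μ := by
          rw [lintegral_indicator_const (hE0 _)]
        rw [e0, ← lintegral_add_left (measurable_const.indicator (hE0 _))]
        refine lintegral_mono fun ω => ?_
        by_cases h1 : ω ∈ E n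
        · have h2 := hsub h1
          simp [h1, h2]
        · have hs : X (n + 1) ω = X n ω * ξ n ω := Finset.prod_range_succ _ _
          by_cases h2 : ω ∈ E (n + 1)
          · obtain ⟨j, hj, hj2⟩ := h2
            have h2 : ω ∈ E (n + 1) := ⟨j, hj, hj2⟩
            have hjn : j = n + 1 := by
              by_contra hne
              exact h1 ⟨j, by omega, hj2⟩
            subst hjn
            simp [h1, h2, ← hs, hj2]
          · simp [h1, h2, hs]
      refine e1.trans ?_
      rw [lintegral_add_left (measurable_const.indicator (hE0 _)),
        lintegral_indicator_const (hE0 _)]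
      refine add_le_add le_rfl ?_
      exact (hcond n).lintegral_mul_le (hF n) ((hmeas n).mono (hF _) le_rfl)
        ((hXm n).indicator (hEm n).compl)
  calc a * μ {ω | ∃ n ≤ T, a ≤ ∏ i ∈ Finset.range n, ξ i ω} ≤ a * μ (E T) + _ := le_self_add
    _ ≤ 1 := key T

theorem measurable_apply_countable {ι β : Type*} [Countable ι] {m : MeasurableSpace Ω}
    {mβ : MeasurableSpace β} {g : Ω → ι → β} {i : Ω → ι} (hi : Measurable[m, ⊤] i)
    (hg : ∀ j, Measurable[m] fun ω => g ω j) : Measurable[m] fun ω => g ω (i ω) := by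
  intro t ht
  have : (fun ω => g ω (i ω)) ⁻¹' t = ⋃ j, (i ⁻¹' {j} ∩ (fun ω => g ω j) ⁻¹' t) := by
    ext ω; simp
  rw [this]
  exact MeasurableSet.iUnion fun j => (hi trivial).inter (hg j ht)

theorem measurable_comp_of_top {ι β : Type*} {m : MeasurableSpace Ω} {mβ : MeasurableSpace β}
    {i : Ω → ι} (hi : Measurable[m, ⊤] i) (f : ι → β) : Measurable[m] fun ω => f (i ω) :=
  fun t _ => hi (t := f ⁻¹' t) trivial

theorem measurableSet_eq_of_top {ι : Type*} {m : MeasurableSpace Ω} {i : Ω → ι}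
    (hi : Measurable[m, ⊤] i) (j : ι) : MeasurableSet[m] {ω | i ω = j} :=
  hi (t := {j}) trivial

end CondLeOne

/-! ### The filtration of a run -/

namespace Run

variable {S A Ω : Type*}

/-- The observations up to and including the transition of step `h` of episode `k`. -/
@[reducible] def next (D : Run S A Ω) (H k h : ℕ) : MeasurableSpace Ω :=
  D.hist H k h ⊔ MeasurableSpace.comap (D.R k h) (borel ℝ)
    ⊔ MeasurableSpace.comap (D.s k (h + 1)) ⊤

section Filtration

variable (D : Run S A Ω) (H : ℕ)

theorem past_mono : Monotone (D.past H) := fun _ _ hk =>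
  biSup_mono fun i hi => by rw [Finset.mem_Ico] at hi ⊢; omega

theorem past_le_hist (k h : ℕ) : D.past H k ≤ D.hist H k h := le_sup_left.trans le_sup_left

theorem hist_le_next (k h : ℕ) : D.hist H k h ≤ D.next H k h := le_sup_left.trans le_sup_left

variable {H}

theorem measurable_s_hist {k h j : ℕ} (hj : j ∈ Finset.Icc 1 h) :
    Measurable[D.hist H k h, ⊤] (D.s k j) := by
  refine measurable_iff_comap_le.2 (le_trans ?_ (le_sup_right.trans le_sup_left))
  exact le_sup_left.trans (le_iSup₂_of_le j hj le_rfl)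

theorem measurable_a_hist {k h j : ℕ} (hj : j ∈ Finset.Icc 1 h) :
    Measurable[D.hist H k h, ⊤] (D.a k j) := by
  refine measurable_iff_comap_le.2 (le_trans ?_ (le_sup_right.trans le_sup_left))
  exact le_sup_right.trans (le_iSup₂_of_le j hj le_rfl)

theorem measurable_s_next (H k h : ℕ) : Measurable[D.next H k h, ⊤] (D.s k (h + 1)) :=
  measurable_iff_comap_le.2 le_sup_right

theorem measurable_R_next (H k h : ℕ) : Measurable[D.next H k h] (D.R k h) := by
  refine measurable_iff_comap_le.2 ?_
  rw [BorelSpace.measurable_eq (α := ℝ)]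
  exact le_sup_right.trans le_sup_left

theorem next_le_hist_succ {k h : ℕ} (hh : 1 ≤ h) : D.next H k h ≤ D.hist H k (h + 1) := by
  refine sup_le (sup_le (sup_le (sup_le ?_ ?_) ?_) ?_) ?_
  · exact D.past_le_hist H k (h + 1)
  · refine le_trans ?_ (le_sup_right.trans le_sup_left)
    exact biSup_mono fun i hi => by rw [Finset.mem_Icc] at hi ⊢; omega
  · refine le_trans ?_ le_sup_right
    exact biSup_mono fun i hi => by rw [Finset.mem_Ico] at hi ⊢; omega
  · exact le_trans (le_iSup₂_of_le h (by rw [Finset.mem_Ico]; omega) le_rfl) le_sup_right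
  · exact measurable_iff_comap_le.1 (D.measurable_s_hist (by rw [Finset.mem_Icc]; omega))

theorem measurable_s_past {k i h : ℕ} (hi : i ∈ Finset.Ico 1 k) (hh : h ∈ Finset.Icc 1 (H + 1)) :
    Measurable[D.past H k, ⊤] (D.s i h) := by
  refine measurable_iff_comap_le.2 (le_trans ?_ (le_iSup₂_of_le i hi le_rfl))
  rcases Nat.lt_or_ge H h with h1 | h1
  · obtain rfl : h = H + 1 := by have := (Finset.mem_Icc.1 hh).2; omega
    exact le_sup_right
  · refine le_trans ?_ le_sup_left
    refine le_trans ?_ (le_iSup₂_of_le h (by rw [Finset.mem_Icc] at hh ⊢; omega) le_rfl)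
    exact le_sup_left.trans le_sup_left

theorem measurable_a_past {k i h : ℕ} (hi : i ∈ Finset.Ico 1 k) (hh : h ∈ Finset.Icc 1 H) :
    Measurable[D.past H k, ⊤] (D.a i h) := by
  refine measurable_iff_comap_le.2 (le_trans ?_ (le_iSup₂_of_le i hi le_rfl))
  refine le_trans ?_ le_sup_left
  exact le_trans (le_sup_right.trans le_sup_left) (le_iSup₂_of_le h hh le_rfl)

theorem measurable_R_past {k i h : ℕ} (hi : i ∈ Finset.Ico 1 k) (hh : h ∈ Finset.Icc 1 H) :
    Measurable[D.past H k] (D.R i h) := by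
  refine measurable_iff_comap_le.2 (le_trans ?_ (le_iSup₂_of_le i hi le_rfl))
  refine le_trans ?_ le_sup_left
  rw [BorelSpace.measurable_eq (α := ℝ)]
  exact le_trans le_sup_right (le_iSup₂_of_le h hh le_rfl)

theorem next_le_past_succ {k h : ℕ} (hk : 1 ≤ k) (hh : h ∈ Finset.Icc 1 H) :
    D.next H k h ≤ D.past H (k + 1) := by
  have hmem : k ∈ Finset.Ico 1 (k + 1) := by rw [Finset.mem_Ico]; omega
  have h12 := Finset.mem_Icc.1 hh
  refine sup_le (sup_le (sup_le (sup_le ?_ ?_) ?_) ?_) ?_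
  · exact D.past_mono H (Nat.le_succ k)
  · refine iSup₂_le fun j hj => sup_le ?_ ?_
    · exact measurable_iff_comap_le.1
        (D.measurable_s_past hmem (by rw [Finset.mem_Icc] at hj ⊢; omega))
    · exact measurable_iff_comap_le.1
        (D.measurable_a_past hmem (by rw [Finset.mem_Icc] at hj ⊢; omega))
  · refine iSup₂_le fun j hj => ?_
    rw [← BorelSpace.measurable_eq (α := ℝ)]
    exact measurable_iff_comap_le.1
      (D.measurable_R_past hmem (by rw [Finset.mem_Ico] at hj; rw [Finset.mem_Icc]; omega))
  · rw [← BorelSpace.measurable_eq (α := ℝ)]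
    exact measurable_iff_comap_le.1 (D.measurable_R_past hmem hh)
  · exact measurable_iff_comap_le.1 (D.measurable_s_past hmem (by rw [Finset.mem_Icc]; omega))

end Filtration

variable [Fintype S] [DecidableEq S] [m₀ : MeasurableSpace Ω] {μ : Measure Ω} {M : MDP S A}
  {D : Run S A Ω}

namespace IsRunOf

/-- Past measurability is a hypothesis here because this lemma is used inside the induction that
proves it: actions are measurable through policies that are measurable for the past, and the past is
generated in part by earlier actions. -/
theorem measurable_a (hD : D.IsRunOf M μ) {k : ℕ} (hk : 1 ≤ k) (hp : D.past M.H k ≤ m₀) {h : ℕ}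
    (hh : h ∈ Finset.Icc 1 M.H) : Measurable[m₀, ⊤] (D.a k h) :=
  measurable_apply_countable (mβ := ⊤) (g := fun ω s => D.π k ω h s) (i := D.s k h)
    (hD.measurable_s k hk h (by rw [Finset.mem_Icc] at hh ⊢; omega))
    fun s => (hD.measurable_π k hk h hh s).mono hp le_rfl

theorem past_le (hD : D.IsRunOf M μ) (k : ℕ) : D.past M.H k ≤ m₀ := by
  induction k using Nat.strong_induction_on with
  | _ k ih =>
    refine iSup₂_le fun i hi => ?_
    rw [Finset.mem_Ico] at hi
    refine sup_le (iSup₂_le fun h hh => sup_le (sup_le ?_ ?_) ?_) ?_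
    · exact measurable_iff_comap_le.1
        (hD.measurable_s i hi.1 h (by rw [Finset.mem_Icc] at hh ⊢; omega))
    · exact measurable_iff_comap_le.1 (hD.measurable_a hi.1 (ih i hi.2) hh)
    · rw [← BorelSpace.measurable_eq (α := ℝ)]
      exact measurable_iff_comap_le.1 (hD.measurable_R i hi.1 h hh)
    · exact measurable_iff_comap_le.1
        (hD.measurable_s i hi.1 _ (by rw [Finset.mem_Icc]; omega))

theorem next_le (hD : D.IsRunOf M μ) {k h : ℕ} (hk : 1 ≤ k) (hh : h ∈ Finset.Icc 1 M.H) :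
    D.next M.H k h ≤ m₀ :=
  (D.next_le_past_succ hk hh).trans (hD.past_le _)

theorem hist_le (hD : D.IsRunOf M μ) {k h : ℕ} (hk : 1 ≤ k) (hh : h ∈ Finset.Icc 1 M.H) :
    D.hist M.H k h ≤ m₀ :=
  (D.hist_le_next M.H k h).trans (hD.next_le hk hh)

/-- Within an episode the factors are integrated out one step at a time. The result is conditional
on the past alone, so nothing is required of the initial state of the episode. -/
theorem condLeOne_prod [IsProbabilityMeasure μ] (hD : D.IsRunOf M μ) {k : ℕ} (hk : 1 ≤ k)
    {ξ : ℕ → Ω → ℝ≥0∞} (hmeas : ∀ h ∈ Finset.Icc 1 M.H, Measurable[D.next M.H k h] (ξ h))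
    (hcond : ∀ h ∈ Finset.Icc 1 M.H, CondLeOne (D.hist M.H k h) μ (ξ h)) :
    CondLeOne (D.past M.H k) μ fun ω => ∏ h ∈ Finset.Icc 1 M.H, ξ h ω := by
  have key : ∀ n ≤ M.H, CondLeOne (D.past M.H k) μ fun ω => ∏ h ∈ Finset.Icc 1 n, ξ h ω := by
    intro n
    induction n with
    | zero => intro _ B _; simp
    | succ n ih =>
      intro hn
      have hmem : n + 1 ∈ Finset.Icc 1 M.H := by rw [Finset.mem_Icc]; omega
      have e : (fun ω => ∏ h ∈ Finset.Icc 1 (n + 1), ξ h ω)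
          = fun ω => (∏ h ∈ Finset.Icc 1 n, ξ h ω) * ξ (n + 1) ω := by
        funext ω; rw [Finset.prod_Icc_succ_top (by omega)]
      rw [e]
      refine CondLeOne.mul (D.past_le_hist M.H k (n + 1)) (hD.hist_le hk hmem) ?_
        ((hmeas _ hmem).mono (hD.next_le hk hmem) le_rfl) (ih (by omega)) (hcond _ hmem)
      refine Finset.measurable_prod _ fun i hi => ?_
      rw [Finset.mem_Icc] at hi
      have hi' : i ∈ Finset.Icc 1 M.H := by rw [Finset.mem_Icc]; omega
      refine (hmeas i hi').mono ((D.next_le_hist_succ hi.1).trans ?_) le_rfl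
      clear e ih
      obtain ⟨d, rfl⟩ := Nat.exists_eq_add_of_le hi.2
      clear hn hmem
      induction d with
      | zero => exact le_rfl
      | succ d ihd =>
        have := ihd ⟨hi.1, by omega⟩
        refine this.trans ((D.hist_le_next _ _ _).trans ?_)
        exact D.next_le_hist_succ (H := M.H) (k := k) (h := i + d + 1) (by omega)
  exact key M.H le_rfl

/-- Ville's inequality for a product over all steps of all episodes. -/
theorem measure_exists_le_prod_le [IsProbabilityMeasure μ] (hD : D.IsRunOf M μ)
    {ξ : ℕ → ℕ → Ω → ℝ≥0∞}
    (hmeas : ∀ k ≥ 1, ∀ h ∈ Finset.Icc 1 M.H, Measurable[D.next M.H k h] (ξ k h))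
    (hcond : ∀ k ≥ 1, ∀ h ∈ Finset.Icc 1 M.H, CondLeOne (D.hist M.H k h) μ (ξ k h))
    (ℓ : ℝ) (K : ℕ) :
    μ {ω | ∃ k ∈ Finset.Icc 1 K, ENNReal.ofReal (Real.exp ℓ)
      ≤ ∏ i ∈ Finset.Ico 1 k, ∏ h ∈ Finset.Icc 1 M.H, ξ i h ω}
      ≤ ENNReal.ofReal (Real.exp (-ℓ)) := by
  have hv := EQO.measure_exists_le_prod_le (μ := μ) (F := fun n => D.past M.H (n + 1))
    (fun n => hD.past_le _) (fun a b hab => D.past_mono M.H (by omega))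
    (ξ := fun n ω => ∏ h ∈ Finset.Icc 1 M.H, ξ (n + 1) h ω)
    (fun n => Finset.measurable_prod _ fun h hh =>
      (hmeas (n + 1) (by omega) h hh).mono (D.next_le_past_succ (by omega) hh) le_rfl)
    (fun n => hD.condLeOne_prod (by omega) (hmeas (n + 1) (by omega)) (hcond (n + 1) (by omega)))
    (ENNReal.ofReal (Real.exp ℓ)) K
  have hsub : {ω | ∃ k ∈ Finset.Icc 1 K, ENNReal.ofReal (Real.exp ℓ)
      ≤ ∏ i ∈ Finset.Ico 1 k, ∏ h ∈ Finset.Icc 1 M.H, ξ i h ω}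
      ⊆ {ω | ∃ n ≤ K, ENNReal.ofReal (Real.exp ℓ) ≤ ∏ i ∈ Finset.range n,
          ∏ h ∈ Finset.Icc 1 M.H, ξ (i + 1) h ω} := by
    rintro ω ⟨k, hk, hle⟩
    -- Episodes are numbered from `1`, so the product over the episodes before `k` is the
    -- supermartingale after `k - 1` factors.
    refine ⟨k - 1, by rw [Finset.mem_Icc] at hk; omega, hle.trans_eq ?_⟩
    rw [Finset.prod_Ico_eq_prod_range]
    exact Finset.prod_congr rfl fun i _ => by rw [add_comm 1 i]
  refine (measure_mono hsub).trans ?_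
  rw [Real.exp_neg, ENNReal.ofReal_inv_of_pos (Real.exp_pos ℓ)]
  refine ENNReal.le_inv_iff_mul_le.2 ?_
  rwa [mul_comm]

/-- The transition law is given for indicators of single states; as there are finitely many states,
any `g` depending on the history and the next state is a finite combination of these with
history-measurable coefficients. -/
theorem lintegral_transition [IsProbabilityMeasure μ] (hD : D.IsRunOf M μ) {k h : ℕ} (hk : 1 ≤ k)
    (hh : h ∈ Finset.Icc 1 M.H) {g : Ω → S → ℝ≥0∞}
    (hg : ∀ s', Measurable[D.hist M.H k h] fun ω => g ω s') :
    ∫⁻ ω, g ω (D.s k (h + 1) ω) ∂μ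
      = ∫⁻ ω, ∑ s', ENNReal.ofReal (M.P (D.s k h ω) (D.a k h ω) s') * g ω s' ∂μ := by
  have hm := hD.hist_le hk hh
  have hs1 : Measurable[m₀, ⊤] (D.s k (h + 1)) :=
    (D.measurable_s_next M.H k h).mono (hD.next_le hk hh) le_rfl
  have hhh : h ∈ Finset.Icc 1 h := by rw [Finset.mem_Icc] at hh ⊢; omega
  have hPm : ∀ s', Measurable[D.hist M.H k h]
      fun ω => M.P (D.s k h ω) (D.a k h ω) s' := by
    intro s'
    refine measurable_apply_countable (g := fun ω s => M.P s (D.a k h ω) s')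
      (D.measurable_s_hist hhh) fun s => ?_
    exact measurable_comp_of_top (D.measurable_a_hist hhh) fun a => M.P s a s'
  set X : S → Ω → ℝ≥0∞ := fun s' ω => if D.s k (h + 1) ω = s' then 1 else 0 with hX
  have hXm : ∀ s', Measurable (X s') := fun s' =>
    Measurable.ite (measurableSet_eq_of_top hs1 s') measurable_const measurable_const
  have hset : ∀ s' B, MeasurableSet[D.hist M.H k h] B → ∫⁻ ω in B, X s' ω ∂μ
      = ∫⁻ ω in B, ENNReal.ofReal (M.P (D.s k h ω) (D.a k h ω) s') ∂μ := by
    intro s' B hB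
    have hint : Integrable (fun ω => if D.s k (h + 1) ω = s' then (1 : ℝ) else 0) μ := by
      refine Integrable.of_bound (C := 1) ?_ (Filter.Eventually.of_forall fun ω => ?_)
      · exact (Measurable.ite (measurableSet_eq_of_top hs1 s') measurable_const
          measurable_const).aestronglyMeasurable
      · split_ifs <;> simp
    have hintP : Integrable (fun ω => M.P (D.s k h ω) (D.a k h ω) s') μ :=
      integrable_condExp.congr (hD.transition k hk h hh s')
    have e : ∫ ω in B, (if D.s k (h + 1) ω = s' then (1 : ℝ) else 0) ∂μ
        = ∫ ω in B, M.P (D.s k h ω) (D.a k h ω) s' ∂μ := by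
      rw [← setIntegral_condExp hm hint hB]
      exact setIntegral_congr_ae (hm B hB)
        ((hD.transition k hk h hh s').mono fun ω hω _ => hω)
    rw [← ofReal_integral_eq_lintegral_ofReal hintP.integrableOn
      (Filter.Eventually.of_forall fun ω => M.P_nonneg _ _ _), ← e,
      ofReal_integral_eq_lintegral_ofReal hint.integrableOn
      (Filter.Eventually.of_forall fun ω => by dsimp only; split_ifs <;> simp)]
    refine lintegral_congr fun ω => ?_
    simp only [hX]; split_ifs <;> simp
  have hL : ∀ ω, g ω (D.s k (h + 1) ω) = ∑ s', g ω s' * X s' ω := by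
    intro ω; simp [hX]
  simp_rw [hL]
  have hgm : ∀ s', Measurable fun ω => g ω s' := fun s' => (hg s').mono hm le_rfl
  have hPm0 : ∀ s', Measurable fun ω => ENNReal.ofReal (M.P (D.s k h ω) (D.a k h ω) s') :=
    fun s' => ((hPm s').mono hm le_rfl).ennreal_ofReal
  rw [lintegral_finsetSum (f := fun s' ω => g ω s' * X s' ω) _ fun s' _ => (hgm s').mul (hXm s'),
    lintegral_finsetSum (f := fun s' ω => ENNReal.ofReal (M.P (D.s k h ω) (D.a k h ω) s') * g ω s')
      _ fun s' _ => (hPm0 s').mul (hgm s')]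
  refine Finset.sum_congr rfl fun s' _ => ?_
  simp_rw [mul_comm (ENNReal.ofReal _)]
  have hPm' := hPm0 s'
  exact le_antisymm
    (lintegral_mul_le_of_setLIntegral_le hm (hXm s') hPm' (fun B hB => (hset s' B hB).le) (hg s'))
    (lintegral_mul_le_of_setLIntegral_le hm hPm' (hXm s') (fun B hB => (hset s' B hB).ge) (hg s'))

end IsRunOf

end Run

end EQO

namespace EQO

/-! ### Exponential moments of finite distributions -/

/-- The third-order remainder is at most `2/9 |y|³`, which is at most `5/54 y²` in this range, and
`1/2 + 5/54 < 3/5`. -/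
theorem exp_le_quadratic {y : ℝ} (hy : |y| ≤ 5 / 12) : Real.exp y ≤ 1 + y + 3 / 5 * y ^ 2 := by
  have h := Real.exp_bound (x := y) (by linarith) (n := 3) (by norm_num)
  have h2 := (abs_le.1 h).2
  simp only [Finset.sum_range_succ, Finset.sum_range_zero, Nat.factorial, Nat.succ_eq_add_one] at h2
  norm_num at h2
  have h3 : |y| ^ 3 ≤ 5 / 12 * y ^ 2 := by
    have : |y| ^ 3 = |y| * y ^ 2 := by rw [← sq_abs y]; ring
    rw [this]
    exact mul_le_mul_of_nonneg_right hy (sq_nonneg y)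
  nlinarith [sq_nonneg y]

namespace MDP

variable {S A : Type*} [Fintype S]

/-- Bernstein's bound in compensated form: in the quadratic estimate of the exponential the linear
term averages to zero and the quadratic one to the variance; then `1 + x ≤ exp x`. -/
theorem avg_exp_le_one_of_small (M : MDP S A) (s : S) (a : A) (g : S → ℝ) (t : ℝ)
    (h : ∀ s', |t * (g s' - M.avg s a g)| ≤ 5 / 12) :
    M.avg s a (fun s' => Real.exp (t * (g s' - M.avg s a g)
      - 3 / 5 * t ^ 2 * M.var s a g)) ≤ 1 := by
  have h1 : M.avg s a (fun s' => Real.exp (t * (g s' - M.avg s a g)))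
      ≤ 1 + 3 / 5 * t ^ 2 * M.var s a g := by
    refine (M.avg_mono s a fun s' => exp_le_quadratic (h s')).trans_eq ?_
    have e : (fun s' => 1 + t * (g s' - M.avg s a g) + 3 / 5 * (t * (g s' - M.avg s a g)) ^ 2)
        = fun s' => (1 + t * (g s' - M.avg s a g))
          + (3 / 5 * t ^ 2) * (g s' - M.avg s a g) ^ 2 := by
      funext s'; ring
    rw [e, avg_add, avg_add, avg_const_mul, avg_const_mul, avg_sub, avg_const, avg_const, var]
    ring
  have e : (fun s' => Real.exp (t * (g s' - M.avg s a g) - 3 / 5 * t ^ 2 * M.var s a g))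
      = fun s' => Real.exp (-(3 / 5 * t ^ 2 * M.var s a g))
        * Real.exp (t * (g s' - M.avg s a g)) := by
    funext s'; rw [← Real.exp_add]; ring_nf
  rw [e, avg_const_mul]
  have h2 : M.avg s a (fun s' => Real.exp (t * (g s' - M.avg s a g)))
      ≤ Real.exp (3 / 5 * t ^ 2 * M.var s a g) :=
    h1.trans (by linarith [Real.add_one_le_exp (3 / 5 * t ^ 2 * M.var s a g)])
  calc _ ≤ Real.exp (-(3 / 5 * t ^ 2 * M.var s a g)) * Real.exp (3 / 5 * t ^ 2 * M.var s a g) :=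
        mul_le_mul_of_nonneg_left h2 (Real.exp_pos _).le
    _ = 1 := by rw [← Real.exp_add]; simp

/-- Hoeffding's lemma for `P(· | s, a)`. -/
theorem avg_exp_le_one_of_range (M : MDP S A) (s : S) (a : A) (g : S → ℝ) (t lo R : ℝ) (hR : 0 ≤ R)
    (h : ∀ s', g s' ∈ Set.Icc lo (lo + R)) :
    M.avg s a (fun s' => Real.exp (t * (g s' - M.avg s a g) - t ^ 2 * R ^ 2 / 8)) ≤ 1 := by
  let : MeasurableSpace S := ⊤
  have hsum : ∑ s', ENNReal.ofReal (M.P s a s') = 1 := by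
    rw [← ENNReal.ofReal_sum_of_nonneg fun s' _ => M.P_nonneg s a s', M.P_sum, ENNReal.ofReal_one]
  let p : PMF S := PMF.ofFintype (fun s' => ENNReal.ofReal (M.P s a s')) hsum
  have hint : ∀ f : S → ℝ, ∫ x, f x ∂p.toMeasure = M.avg s a f := by
    intro f
    rw [PMF.integral_eq_sum]
    refine Finset.sum_congr rfl fun s' _ => ?_
    simp [p, PMF.ofFintype_apply, ENNReal.toReal_ofReal (M.P_nonneg s a s')]
  have hsg := ProbabilityTheory.hasSubgaussianMGF_of_mem_Icc (μ := p.toMeasure) (X := g)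
    (a := lo) (b := lo + R) measurable_from_top.aemeasurable (Filter.Eventually.of_forall h)
  have hmgf := hsg.mgf_le t
  rw [ProbabilityTheory.mgf, hint, hint] at hmgf
  have e : (fun s' => Real.exp (t * (g s' - M.avg s a g) - t ^ 2 * R ^ 2 / 8))
      = fun s' => Real.exp (-(t ^ 2 * R ^ 2 / 8)) * Real.exp (t * (g s' - M.avg s a g)) := by
    funext s'; rw [← Real.exp_add]; ring_nf
  rw [e, avg_const_mul]
  have e2 : (((‖lo + R - lo‖₊ / 2) ^ 2 : NNReal) : ℝ) * t ^ 2 / 2 = t ^ 2 * R ^ 2 / 8 := by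
    have : ((‖lo + R - lo‖₊ : NNReal) : ℝ) = R := by
      rw [coe_nnnorm, add_sub_cancel_left, Real.norm_of_nonneg hR]
    push_cast
    rw [add_sub_cancel_left, Real.norm_of_nonneg hR]
    ring
  rw [e2] at hmgf
  calc _ ≤ Real.exp (-(t ^ 2 * R ^ 2 / 8)) * Real.exp (t ^ 2 * R ^ 2 / 8) :=
        mul_le_mul_of_nonneg_left hmgf (Real.exp_pos _).le
    _ = 1 := by rw [← Real.exp_add]; simp

end MDP

/-! ### Concentration of sums over the visits of a pair -/

namespace Run

variable {S A Ω : Type*}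

theorem measurableSet_visit (D : Run S A Ω) (s : S) (a : A) {H k h : ℕ} (hh : 1 ≤ h) :
    MeasurableSet[D.hist H k h] {ω | D.s k h ω = s ∧ D.a k h ω = a} :=
  (measurableSet_eq_of_top (D.measurable_s_hist (by rw [Finset.mem_Icc]; omega)) s).inter
    (measurableSet_eq_of_top (D.measurable_a_hist (by rw [Finset.mem_Icc]; omega)) a)

variable [DecidableEq S] [DecidableEq A]

/-- The sum of `Y i h` over the visits of `(s, a)` in the episodes before `k`. -/
def visitSum (D : Run S A Ω) (H k : ℕ) (s : S) (a : A) (Y : ℕ → ℕ → Ω → ℝ) (ω : Ω) : ℝ :=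
  ∑ i ∈ Finset.Ico 1 k, ∑ h ∈ Finset.Icc 1 H, if D.s i h ω = s ∧ D.a i h ω = a then Y i h ω else 0

theorem visitSum_const_mul (D : Run S A Ω) (H k : ℕ) (s : S) (a : A) (c : ℝ) (Y : ℕ → ℕ → Ω → ℝ)
    (ω : Ω) : D.visitSum H k s a (fun i h ω => c * Y i h ω) ω = c * D.visitSum H k s a Y ω := by
  simp only [visitSum, Finset.mul_sum, mul_ite, mul_zero]

theorem visitSum_add (D : Run S A Ω) (H k : ℕ) (s : S) (a : A) (Y Z : ℕ → ℕ → Ω → ℝ)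
    (ω : Ω) : D.visitSum H k s a (fun i h ω => Y i h ω + Z i h ω) ω
      = D.visitSum H k s a Y ω + D.visitSum H k s a Z ω := by
  simp only [visitSum, ← Finset.sum_add_distrib]
  refine Finset.sum_congr rfl fun i _ => Finset.sum_congr rfl fun h _ => ?_
  split_ifs <;> simp

theorem visitSum_const (D : Run S A Ω) (H k : ℕ) (s : S) (a : A) (c : ℝ) (ω : Ω) :
    D.visitSum H k s a (fun _ _ _ => c) ω = c * D.N H k ω s a := by
  simp only [visitSum, N, Nat.cast_sum, Finset.mul_sum, Nat.cast_ite, mul_ite, Nat.cast_one,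
    mul_one, Nat.cast_zero, mul_zero]

theorem visitSum_R_eq (D : Run S A Ω) (H k : ℕ) (s : S) (a : A) {ω : Ω} (hN : D.N H k ω s a ≠ 0) :
    D.visitSum H k s a D.R ω = D.N H k ω s a * D.rHat H k ω s a := by
  have : (D.N H k ω s a : ℝ) ≠ 0 := by exact_mod_cast hN
  rw [rHat, ← mul_assoc, mul_one_div_cancel this, one_mul]
  rfl

theorem PHat_nonneg (D : Run S A Ω) (H k : ℕ) (ω : Ω) (s : S) (a : A) (s' : S) :
    0 ≤ D.PHat H k ω s a s' := by
  unfold PHat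
  refine mul_nonneg (by positivity) (Finset.sum_nonneg fun i _ => Finset.sum_nonneg fun h _ => ?_)
  split_ifs <;> simp

variable [Fintype S]

theorem visitSum_s_eq (D : Run S A Ω) (H k : ℕ) (s : S) (a : A) (g : S → ℝ) {ω : Ω}
    (hN : D.N H k ω s a ≠ 0) :
    D.visitSum H k s a (fun i h ω => g (D.s i (h + 1) ω)) ω
      = D.N H k ω s a * ∑ s', D.PHat H k ω s a s' * g s' := by
  have : (D.N H k ω s a : ℝ) ≠ 0 := by exact_mod_cast hN
  simp only [PHat]
  have e : ∀ s', 1 / (D.N H k ω s a : ℝ) * (∑ i ∈ Finset.Ico 1 k, ∑ h ∈ Finset.Icc 1 H,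
      if D.s i h ω = s ∧ D.a i h ω = a ∧ D.s i (h + 1) ω = s' then (1 : ℝ) else 0) * g s'
      = 1 / (D.N H k ω s a : ℝ) * ∑ i ∈ Finset.Ico 1 k, ∑ h ∈ Finset.Icc 1 H,
      if D.s i h ω = s ∧ D.a i h ω = a then (if D.s i (h + 1) ω = s' then g s' else 0) else 0 := by
    intro s'
    rw [mul_assoc, Finset.sum_mul]
    congr 1
    refine Finset.sum_congr rfl fun i _ => ?_
    rw [Finset.sum_mul]
    refine Finset.sum_congr rfl fun h _ => ?_
    by_cases h1 : D.s i h ω = s ∧ D.a i h ω = a <;> by_cases h2 : D.s i (h + 1) ω = s' <;>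
      simp_all
  simp only [e]
  rw [← Finset.mul_sum, ← mul_assoc, mul_one_div_cancel this, one_mul, Finset.sum_comm]
  refine Finset.sum_congr rfl fun i _ => ?_
  rw [Finset.sum_comm]
  refine Finset.sum_congr rfl fun h _ => ?_
  split_ifs <;> simp

theorem sum_PHat (D : Run S A Ω) (H k : ℕ) (s : S) (a : A) {ω : Ω} (hN : D.N H k ω s a ≠ 0) :
    ∑ s', D.PHat H k ω s a s' = 1 := by
  have h := D.visitSum_s_eq H k s a (fun _ => 1) hN
  rw [visitSum_const] at h
  have : (D.N H k ω s a : ℝ) ≠ 0 := by exact_mod_cast hN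
  simp only [mul_one, one_mul] at h
  exact mul_left_cancel₀ this (by rw [← h, mul_one])

variable [m₀ : MeasurableSpace Ω] {μ : Measure Ω} {M : MDP S A} {D : Run S A Ω}

namespace IsRunOf

/-- Steps that do not visit `(s, a)` contribute the factor `1`, so the exponential supermartingale
needs control only on the visiting event. Ville's inequality then covers all episodes without a
union bound. -/
theorem measure_visitSum_le [IsProbabilityMeasure μ] (hD : D.IsRunOf M μ) (s : S) (a : A)
    {Y : ℕ → ℕ → Ω → ℝ}
    (hmeas : ∀ k ≥ 1, ∀ h ∈ Finset.Icc 1 M.H, Measurable[D.next M.H k h] (Y k h))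
    (hY : ∀ k ≥ 1, ∀ h ∈ Finset.Icc 1 M.H, ∀ B, MeasurableSet[D.hist M.H k h] B →
      B ⊆ {ω | D.s k h ω = s ∧ D.a k h ω = a} →
      ∫⁻ ω in B, ENNReal.ofReal (Real.exp (Y k h ω)) ∂μ ≤ μ B) (ℓ : ℝ) (K : ℕ) :
    μ {ω | ∃ k ∈ Finset.Icc 1 K, ℓ < D.visitSum M.H k s a Y ω}
      ≤ ENNReal.ofReal (Real.exp (-ℓ)) := by
  refine le_trans (measure_mono ?_) (hD.measure_exists_le_prod_le
    (ξ := fun k h ω => if D.s k h ω = s ∧ D.a k h ω = a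
      then ENNReal.ofReal (Real.exp (Y k h ω)) else 1) ?_ ?_ ℓ K)
  · rintro ω ⟨k, hk, hlt⟩
    refine ⟨k, hk, ?_⟩
    have e : ∀ i h, (if D.s i h ω = s ∧ D.a i h ω = a
        then ENNReal.ofReal (Real.exp (Y i h ω)) else 1)
        = ENNReal.ofReal (Real.exp (if D.s i h ω = s ∧ D.a i h ω = a then Y i h ω else 0)) := by
      intro i h; split_ifs <;> simp
    simp only [e]
    simp_rw [← ENNReal.ofReal_prod_of_nonneg fun i _ => (Real.exp_pos _).le, ← Real.exp_sum]
    rw [← ENNReal.ofReal_prod_of_nonneg fun i _ => (Real.exp_pos _).le, ← Real.exp_sum]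
    exact ENNReal.ofReal_le_ofReal (Real.exp_le_exp.2 hlt.le)
  · intro k hk h hh
    have h1 := (Finset.mem_Icc.1 hh).1
    exact Measurable.ite (D.hist_le_next _ _ _ _ (measurableSet_visit D s a h1))
      (Real.measurable_exp.comp (hmeas k hk h hh)).ennreal_ofReal measurable_const
  · intro k hk h hh B hB
    have h1 := (Finset.mem_Icc.1 hh).1
    have hE := measurableSet_visit D s a (H := M.H) (k := k) h1
    set E := {ω | D.s k h ω = s ∧ D.a k h ω = a} with hEdef
    have hm := hD.hist_le hk hh
    have hE0 := hm _ hE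
    -- On the part of the event that visits the pair the hypothesis applies; elsewhere the factor is
    -- `1`.
    rw [← lintegral_inter_add_sdiff _ B hE0, ← measure_inter_add_sdiff B hE0]
    refine add_le_add ?_ ?_
    · refine le_trans (le_of_eq ?_) (hY k hk h hh (B ∩ E) (hB.inter hE) Set.inter_subset_right)
      refine setLIntegral_congr_fun (hm _ (hB.inter hE)) fun ω hω => ?_
      exact if_pos hω.2
    · refine le_of_eq ?_
      have e : ∫⁻ ω in B \ E, (if D.s k h ω = s ∧ D.a k h ω = a
          then ENNReal.ofReal (Real.exp (Y k h ω)) else 1) ∂μ = ∫⁻ ω in B \ E, 1 ∂μ :=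
        setLIntegral_congr_fun (hm _ (hB.diff hE)) fun ω hω => if_neg hω.2
      rw [e]
      simp

theorem measure_visitSum_next_le [IsProbabilityMeasure μ] (hD : D.IsRunOf M μ) (s : S) (a : A)
    {g : S → ℝ} (hg : M.avg s a (fun s' => Real.exp (g s')) ≤ 1) (ℓ : ℝ) (K : ℕ) :
    μ {ω | ∃ k ∈ Finset.Icc 1 K, ℓ < D.visitSum M.H k s a (fun i h ω => g (D.s i (h + 1) ω)) ω}
      ≤ ENNReal.ofReal (Real.exp (-ℓ)) := by
  refine hD.measure_visitSum_le s a (fun k hk h hh => ?_) (fun k hk h hh B hB hBE => ?_) ℓ K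
  · exact measurable_comp_of_top (D.measurable_s_next M.H k h) g
  · have hm := hD.hist_le hk hh
    have hB0 := hm _ hB
    rw [← lintegral_indicator hB0]
    have e := hD.lintegral_transition hk hh
      (g := fun ω s' => B.indicator (fun _ => ENNReal.ofReal (Real.exp (g s'))) ω)
      fun s' => measurable_const.indicator hB
    have e1 : (B.indicator fun ω => ENNReal.ofReal (Real.exp (g (D.s k (h + 1) ω))))
        = fun ω => B.indicator (fun _ => ENNReal.ofReal (Real.exp (g (D.s k (h + 1) ω)))) ω := by
      funext ω; by_cases hω : ω ∈ B <;> simp [hω]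
    rw [e1, e, ← lintegral_indicator_one hB0]
    refine lintegral_mono fun ω => ?_
    by_cases hω : ω ∈ B
    · obtain ⟨h1, h2⟩ := hBE hω
      simp only [hω, Set.indicator_of_mem, h1, h2, Pi.one_apply]
      simp_rw [← ENNReal.ofReal_mul (M.P_nonneg s a _)]
      rw [← ENNReal.ofReal_sum_of_nonneg
        fun s' _ => mul_nonneg (M.P_nonneg s a s') (Real.exp_pos _).le]
      exact ENNReal.ofReal_le_one.2 hg
    · simp [hω]

/-- On a visit of `(s, a)` the variance proxy is the constant `σ j s a`, so the conditional moment
bound can be compensated by a deterministic term, whatever the step of the visit. -/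
theorem measure_visitSum_return_le [IsProbabilityMeasure μ] (hD : D.IsRunOf M μ)
    {σ : ℕ → S → A → ℝ} {Vα : ℝ} (hsub : SubExponentialReturns D M μ σ Vα) {j : ℕ}
    (hj : j ∈ Finset.Icc 1 M.H) (s : S) (a : A) {t : ℝ} (ht : |t| * Vα ≤ 1) (ℓ : ℝ) (K : ℕ) :
    μ {ω | ∃ k ∈ Finset.Icc 1 K, ℓ < D.visitSum M.H k s a (fun i h ω =>
        t * (D.R i h ω + M.Vstar (j + 1) (D.s i (h + 1) ω) - M.Qstar j s a)
          - σ j s a ^ 2 * t ^ 2 / 2) ω}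
      ≤ ENNReal.ofReal (Real.exp (-ℓ)) := by
  refine hD.measure_visitSum_le s a (fun k hk h hh => ?_) (fun k hk h hh B hB hBE => ?_) ℓ K
  · have h1 : Measurable[D.next M.H k h] fun ω => M.Vstar (j + 1) (D.s k (h + 1) ω) :=
      measurable_comp_of_top (D.measurable_s_next M.H k h) _
    have h2 := D.measurable_R_next M.H k h
    exact (((h2.add h1).sub measurable_const).const_mul t).sub measurable_const
  · have hm := hD.hist_le hk hh
    have hB0 := hm _ hB
    obtain ⟨hint, hle⟩ := hsub k hk h hh j hj t ht
    set X : Ω → ℝ := fun ω => D.R k h ω + M.Vstar (j + 1) (D.s k (h + 1) ω)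
        - M.Qstar j (D.s k h ω) (D.a k h ω) with hX
    set c : ℝ := σ j s a ^ 2 * t ^ 2 / 2 with hc
    have hreal : ∫ ω in B, Real.exp (t * X ω) ∂μ ≤ Real.exp c * (μ B).toReal := by
      rw [← setIntegral_condExp hm hint hB]
      have h1 : ∫ ω in B, (μ[fun ω => Real.exp (t * X ω) | D.hist M.H k h]) ω ∂μ
          ≤ ∫ ω in B, Real.exp c ∂μ := by
        refine setIntegral_mono_on_ae integrable_condExp.integrableOn
          (integrable_const _).integrableOn hB0 ?_
        filter_upwards [hle] with ω hω hωB
        obtain ⟨e1, e2⟩ := hBE hωB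
        rw [e1, e2] at hω
        exact hω
      refine h1.trans_eq ?_
      rw [setIntegral_const, smul_eq_mul, mul_comm]
      rfl
    have e1 : ∫⁻ ω in B, ENNReal.ofReal (Real.exp (t * (D.R k h ω
        + M.Vstar (j + 1) (D.s k (h + 1) ω) - M.Qstar j s a) - c)) ∂μ
        = ENNReal.ofReal (Real.exp (-c)) * ∫⁻ ω in B, ENNReal.ofReal (Real.exp (t * X ω)) ∂μ := by
      rw [← lintegral_const_mul' _ _ ENNReal.ofReal_ne_top]
      refine setLIntegral_congr_fun hB0 fun ω hω => ?_
      obtain ⟨e1, e2⟩ := hBE hω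
      simp only [hX, e1, e2]
      rw [← ENNReal.ofReal_mul (Real.exp_pos _).le, ← Real.exp_add]
      ring_nf
    rw [e1, ← ofReal_integral_eq_lintegral_ofReal hint.integrableOn
      (Filter.Eventually.of_forall fun ω => (Real.exp_pos _).le),
      ← ENNReal.ofReal_mul (Real.exp_pos _).le]
    refine le_trans (ENNReal.ofReal_le_ofReal
      (mul_le_mul_of_nonneg_left hreal (Real.exp_pos _).le)) ?_
    rw [← mul_assoc, ← Real.exp_add, neg_add_cancel, Real.exp_zero, one_mul,
      ENNReal.ofReal_toReal (measure_ne_top _ _)]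

end IsRunOf

end Run

/-- Returns with vanishing variance proxy are almost surely exact. -/
theorem Run.IsRunOf.ae_return_eq {S A Ω : Type*} [Fintype S] [DecidableEq S] [MeasurableSpace Ω]
    {μ : Measure Ω} [IsProbabilityMeasure μ] {M : MDP S A} {D : Run S A Ω} (hD : D.IsRunOf M μ)
    {σ : ℕ → S → A → ℝ} {Vα : ℝ} (hVα : 0 ≤ Vα) (hsub : SubExponentialReturns D M μ σ Vα)
    {j : ℕ} (hj : j ∈ Finset.Icc 1 M.H) (hσ : ∀ s a, σ j s a = 0) {k h : ℕ} (hk : 1 ≤ k)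
    (hh : h ∈ Finset.Icc 1 M.H) :
    ∀ᵐ ω ∂μ, D.R k h ω + M.Vstar (j + 1) (D.s k (h + 1) ω)
        - M.Qstar j (D.s k h ω) (D.a k h ω) = 0 := by
  have hm := hD.hist_le hk hh
  set X : Ω → ℝ := fun ω => D.R k h ω + M.Vstar (j + 1) (D.s k (h + 1) ω)
      - M.Qstar j (D.s k h ω) (D.a k h ω) with hX
  -- A positive admissible parameter, also when `Vα = 0`. Both signs give exponential moments at
  -- most `1`, so `2 cosh(tX) - 2 ≥ 0` has nonpositive integral and vanishes almost surely.
  set t : ℝ := 1 / (1 + Vα) with ht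
  have htp : 0 < t := by positivity
  have htV : t * Vα ≤ 1 := by
    rw [ht, div_mul_eq_mul_div, one_mul, div_le_one (by positivity)]; linarith
  have key : ∀ u : ℝ, |u| * Vα ≤ 1 → Integrable (fun ω => Real.exp (u * X ω)) μ ∧
      ∫ ω, Real.exp (u * X ω) ∂μ ≤ 1 := by
    intro u hu
    obtain ⟨hint, hle⟩ := hsub k hk h hh j hj u hu
    refine ⟨hint, ?_⟩
    rw [← integral_condExp hm]
    calc ∫ ω, (μ[fun ω => Real.exp (u * X ω) | D.hist M.H k h]) ω ∂μ ≤ ∫ ω, (1 : ℝ) ∂μ := by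
          refine integral_mono_ae integrable_condExp (integrable_const _) ?_
          filter_upwards [hle] with ω hω
          simpa [hσ] using hω
      _ = 1 := by simp
  obtain ⟨i1, l1⟩ := key t (by rwa [abs_of_pos htp])
  obtain ⟨i2, l2⟩ := key (-t) (by rwa [abs_neg, abs_of_pos htp])
  have hnn : ∀ ω, 0 ≤ Real.exp (t * X ω) + Real.exp (-t * X ω) - 2 := by
    intro ω
    have := Real.one_le_cosh (t * X ω)
    rw [Real.cosh_eq] at this
    rw [neg_mul]
    linarith
  have hzero : ∫ ω, (Real.exp (t * X ω) + Real.exp (-t * X ω) - 2) ∂μ = 0 := by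
    refine le_antisymm ?_ (integral_nonneg hnn)
    have e := integral_sub (i1.add i2) (integrable_const (μ := μ) (2 : ℝ))
    have e2 := integral_add i1 i2
    simp only [Pi.add_apply, integral_const, probReal_univ, one_smul] at e e2
    rw [e, e2]
    linarith
  have hae := (integral_eq_zero_iff_of_nonneg hnn ((i1.add i2).sub (integrable_const _))).1 hzero
  filter_upwards [hae] with ω hω
  by_contra hne
  have hlt := Real.one_lt_cosh.2 (mul_ne_zero htp.ne' hne)
  rw [Real.cosh_eq] at hlt
  simp only [Pi.zero_apply, neg_mul] at hω
  linarith

end EQO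

namespace EQO

/-! ### Planning in one episode -/

variable {S A : Type*} [Fintype S]

/-- The optimistic action value computed from estimates `rh`, `q`, counts `N` and bonuses `b`. -/
def optQ (N : S → A → ℕ) (rh : S → A → ℝ) (q : S → A → S → ℝ) (b : S → A → ℝ) (Vmax : ℝ)
    (v : S → ℝ) (s : S) (a : A) : ℝ :=
  if N s a = 0 then Vmax else min (max (rh s a + ∑ s', q s a s' * v s') 0 + b s a) Vmax

/-- `v` are the values that optimistic planning computes, and `π` is greedy for them. -/
structure IsPlan (M : MDP S A) (N : S → A → ℕ) (rh : S → A → ℝ) (q : S → A → S → ℝ)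
    (b : S → A → ℝ) (Vmax : ℝ) (v : ℕ → S → ℝ) (π : Policy S A) : Prop where
  end_eq : ∀ s, v (M.H + 1) s = 0
  q_nonneg : ∀ s a s', 0 ≤ q s a s'
  b_nonneg : ∀ s a, 0 ≤ b s a
  le_v : ∀ h, 1 ≤ h → h ≤ M.H → ∀ s a, optQ N rh q b Vmax (v (h + 1)) s a ≤ v h s
  v_eq : ∀ h, 1 ≤ h → h ≤ M.H → ∀ s, v h s = optQ N rh q b Vmax (v (h + 1)) s (π h s)

theorem IsPlan.v_le {M : MDP S A} {N : S → A → ℕ} {rh : S → A → ℝ} {q : S → A → S → ℝ}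
    {b : S → A → ℝ} {Vmax : ℝ} {v : ℕ → S → ℝ} {π : Policy S A} (hp : IsPlan M N rh q b Vmax v π)
    (hVmax : 0 ≤ Vmax) {h : ℕ} (h1 : 1 ≤ h) (h2 : h ≤ M.H + 1) (s : S) : v h s ≤ Vmax := by
  rcases Nat.lt_or_ge M.H h with h3 | h3
  · obtain rfl : h = M.H + 1 := by omega
    rw [hp.end_eq]; exact hVmax
  · rw [hp.v_eq h h1 h3, optQ]
    split_ifs
    · exact le_rfl
    · exact min_le_right _ _

variable [DecidableEq S]

/-- `φ` absorbs the errors of the estimates up to one bonus, in both directions. -/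
structure IsSlack (M : MDP S A) (N : S → A → ℕ) (rh : S → A → ℝ) (q : S → A → S → ℝ)
    (b : S → A → ℝ) (Vmax : ℝ) (φ : ℕ → S → ℝ) : Prop where
  end_eq : ∀ s, φ (M.H + 1) s = 0
  nonneg : ∀ h, 1 ≤ h → h ≤ M.H + 1 → ∀ s, 0 ≤ φ h s
  superharmonic : ∀ h, 1 ≤ h → h ≤ M.H → ∀ s a, M.avg s a (φ (h + 1)) ≤ φ h s
  abs_le : ∀ h, 1 ≤ h → h ≤ M.H → ∀ s a, N s a ≠ 0 → b s a < Vmax →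
    |(rh s a + ∑ s', q s a s' * M.Vstar (h + 1) s' - M.Qstar h s a)
      - (∑ s', q s a s' * φ (h + 1) s' - M.avg s a (φ (h + 1)))|
      ≤ b s a + φ h s - M.avg s a (φ (h + 1))

section Analysis

variable {M : MDP S A} {N : S → A → ℕ} {rh : S → A → ℝ} {q : S → A → S → ℝ}
  {b : S → A → ℝ} {Vmax : ℝ} {v : ℕ → S → ℝ} {π : Policy S A} {φ : ℕ → S → ℝ}

/-- Quasi-optimism: the planned values are optimistic up to `φ`. -/
theorem IsPlan.Vstar_le [Fintype A] [Nonempty A] (hp : IsPlan M N rh q b Vmax v π)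
    (hφ : IsSlack M N rh q b Vmax φ) (hVmax : 0 ≤ Vmax) (hV : M.ValueBounded Vmax) :
    ∀ h, 1 ≤ h → h ≤ M.H + 1 → ∀ s, M.Vstar h s ≤ v h s + φ h s := by
  refine M.step_induction ?_ ?_
  · intro s; rw [M.Vstar_succ_H, hp.end_eq, hφ.end_eq]; simp
  · intro h h1 h2 ih s
    obtain ⟨a, ha⟩ := M.exists_Vstar_eq_Qstar h1 h2 s
    have hle := hp.le_v h h1 h2 s a
    have hVs := (M.Vstar_mem hVmax hV h1 (by omega) s).2
    have hφ0 := hφ.nonneg h h1 (by omega) s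
    rcases le_or_gt Vmax (optQ N rh q b Vmax (v (h + 1)) s a) with hcap | hcap
    · linarith
    have hN : N s a ≠ 0 := by
      intro h0; rw [optQ, if_pos h0] at hcap; exact lt_irrefl _ hcap
    rw [optQ, if_neg hN] at hcap hle
    have hlt : max (rh s a + ∑ s', q s a s' * v (h + 1) s') 0 + b s a < Vmax := by
      rcases min_lt_iff.1 hcap with h' | h'
      · exact h'
      · exact absurd h' (lt_irrefl _)
    rw [min_eq_left hlt.le] at hle
    have hb : b s a < Vmax := by
      have := le_max_right (rh s a + ∑ s', q s a s' * v (h + 1) s') 0; linarith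
    -- In the lower half of the slack inequality the true average of `φ` cancels. What remains is
    -- the empirical average of `V* - φ`, and the induction hypothesis compares it with that of the
    -- planned values.
    have habs := (abs_le.1 (hφ.abs_le h h1 h2 s a hN hb)).1
    have hq : ∑ s', q s a s' * M.Vstar (h + 1) s'
        ≤ ∑ s', q s a s' * v (h + 1) s' + ∑ s', q s a s' * φ (h + 1) s' := by
      rw [← Finset.sum_add_distrib]
      refine Finset.sum_le_sum fun s' _ => ?_
      rw [← mul_add]
      exact mul_le_mul_of_nonneg_left (ih s') (hp.q_nonneg s a s')
    have := le_max_left (rh s a + ∑ s', q s a s' * v (h + 1) s') 0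
    linarith

/-- The potential whose drift bounds the suboptimality of the executed policy. -/
def potential (M : MDP S A) (Vmax : ℝ) (v φ : ℕ → S → ℝ) (π : Policy S A) (h : ℕ) (s : S) : ℝ :=
  v h s - M.V π h s + 2 / (5 * Vmax) * (v h s - M.Vstar h s + φ h s) ^ 2 - 3 * φ h s

theorem potential_succ_H [Fintype A] [Nonempty A] (hp : IsPlan M N rh q b Vmax v π)
    (hφ : IsSlack M N rh q b Vmax φ) (s : S) : potential M Vmax v φ π (M.H + 1) s = 0 := by
  simp [potential, hp.end_eq, hφ.end_eq, M.Vstar_succ_H, M.V_succ_H]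

/-- The function inside the square is between `0` and `5/4 Vmax`, so the quadratic term is at most
`5/8 Vmax`, and the difference of values is at most `Vmax`. This bound is what allows the costs to
be truncated. -/
theorem potential_le [Fintype A] [Nonempty A] (hp : IsPlan M N rh q b Vmax v π)
    (hφ : IsSlack M N rh q b Vmax φ) (hVmax : 0 < Vmax) (hV : M.ValueBounded Vmax)
    (hφV : ∀ h, 1 ≤ h → h ≤ M.H + 1 → ∀ s, φ h s ≤ Vmax / 4) {h : ℕ} (h1 : 1 ≤ h)
    (h2 : h ≤ M.H + 1) (s : S) : potential M Vmax v φ π h s ≤ 2 * Vmax := by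
  have e1 := hp.Vstar_le hφ hVmax.le hV h h1 h2 s
  have e2 := hp.v_le hVmax.le h1 h2 s
  have e3 := M.Vstar_mem hVmax.le hV h1 h2 s
  have e4 := M.V_mem hVmax.le hV π h1 h2 s
  have e5 := hφV h h1 h2 s
  have e6 := hφ.nonneg h h1 h2 s
  unfold potential
  set U := v h s - M.Vstar h s + φ h s
  have hU0 : 0 ≤ U := by simp only [U]; linarith
  have hU1 : U ≤ 5 / 4 * Vmax := by simp only [U]; linarith
  have hsq : 2 / (5 * Vmax) * U ^ 2 ≤ 5 / 8 * Vmax := by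
    rw [div_mul_eq_mul_div, div_le_iff₀ (by positivity)]
    nlinarith
  linarith

/-- Quasi-optimism costs one `φ`, and the `-3φ` of the potential has to be given back. -/
theorem le_potential_add [Fintype A] [Nonempty A] (hp : IsPlan M N rh q b Vmax v π)
    (hφ : IsSlack M N rh q b Vmax φ) (hVmax : 0 < Vmax) (hV : M.ValueBounded Vmax) {h : ℕ}
    (h1 : 1 ≤ h) (h2 : h ≤ M.H + 1) (s : S) :
    M.Vstar h s - M.V π h s ≤ potential M Vmax v φ π h s + 4 * φ h s := by
  have e1 := hp.Vstar_le hφ hVmax.le hV h h1 h2 s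
  have : 0 ≤ 2 / (5 * Vmax) * (v h s - M.Vstar h s + φ h s) ^ 2 := by positivity
  unfold potential
  linarith

/-- Here `U` is a value at the current state, `P1` and `P2` are the averages of the next value and
of its square, and `x` is the transition error. The variance splits as `(P2 - U²) + (U² - P1²)`, and
as both values are at most `5/4 V`, the second difference is at most `5/2 V` times the bound on `U -
P1` when that bound is nonnegative. Divided by `5V` this brings back only `x/2`, so the inequality
can be solved for `x`. If the bound on `U - P1` is negative, then `x` is negative and `U² ≤ P2`. -/
theorem drift_aux {V U P1 P2 x b G l : ℝ} (hV : 0 < V) (hU0 : 0 ≤ U) (hU1 : U ≤ 5 / 4 * V)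
    (hP1 : 0 ≤ P1) (hP2 : P1 ^ 2 ≤ P2) (hb : 0 ≤ b) (hG : 0 ≤ G) (hl : 0 ≤ l)
    (hU : U ≤ P1 + (2 * b + 2 * G + x)) (hx : x ≤ (P2 - P1 ^ 2) / (5 * V) + l) :
    x ≤ 2 / (5 * V) * (P2 - U ^ 2) + 2 * b + 2 * G + 2 * l := by
  rcases lt_or_ge (2 * b + 2 * G + x) 0 with he | he
  · have h1 : U ^ 2 ≤ P2 := le_trans (by nlinarith) hP2
    have : 0 ≤ 2 / (5 * V) * (P2 - U ^ 2) := mul_nonneg (by positivity) (by linarith)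
    linarith
  · have h1 : U ^ 2 - P1 ^ 2 ≤ 5 / 2 * V * (2 * b + 2 * G + x) := by
      rcases le_or_gt U P1 with h | h
      · have : U ^ 2 ≤ P1 ^ 2 := by nlinarith
        have : 0 ≤ 5 / 2 * V * (2 * b + 2 * G + x) := by positivity
        linarith
      · have : U ^ 2 - P1 ^ 2 = (U - P1) * (U + P1) := by ring
        have h3 : (U - P1) * (U + P1) ≤ (U - P1) * (5 / 2 * V) :=
          mul_le_mul_of_nonneg_left (by linarith) (by linarith)
        have h4 : (U - P1) * (5 / 2 * V) ≤ (2 * b + 2 * G + x) * (5 / 2 * V) :=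
          mul_le_mul_of_nonneg_right (by linarith) (by positivity)
        linarith
    have h2 : (P2 - P1 ^ 2) / (5 * V) ≤ (P2 - U ^ 2) / (5 * V) + (2 * b + 2 * G + x) / 2 := by
      have : (P2 - U ^ 2) / (5 * V) + (2 * b + 2 * G + x) / 2
          = (P2 - U ^ 2 + 5 / 2 * V * (2 * b + 2 * G + x)) / (5 * V) := by
        field_simp
      rw [this]
      exact div_le_div_of_nonneg_right (by linarith) (by positivity)
    have h3 : 2 / (5 * V) * (P2 - U ^ 2) = 2 * ((P2 - U ^ 2) / (5 * V)) := by ring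
    rw [h3]
    linarith

/-- The drift of the potential along the executed policy. -/
theorem potential_drift [Fintype A] [Nonempty A] (hp : IsPlan M N rh q b Vmax v π)
    (hφ : IsSlack M N rh q b Vmax φ) (hVmax : 0 < Vmax) (hV : M.ValueBounded Vmax)
    (hφV : ∀ h, 1 ≤ h → h ≤ M.H + 1 → ∀ s, φ h s ≤ Vmax / 4) {l : S → A → ℝ}
    (hl : ∀ s a, 0 ≤ l s a)
    (hq : ∀ s a, N s a ≠ 0 → ∀ U : S → ℝ, (∀ s', 0 ≤ U s') → (∀ s', U s' ≤ 5 / 4 * Vmax) →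
      ∑ s', q s a s' * U s' - M.avg s a U ≤ M.var s a U / (5 * Vmax) + l s a)
    {h : ℕ} (h1 : 1 ≤ h) (h2 : h ≤ M.H) (s : S) (hN : N s (π h s) ≠ 0) :
    potential M Vmax v φ π h s ≤ 4 * b s (π h s) + 2 * l s (π h s)
      + max 0 (M.avg s (π h s) (potential M Vmax v φ π (h + 1))) := by
  have hveq := hp.v_eq h h1 h2 s
  have hpl := potential_le hp hφ hVmax hV hφV h1 (by omega) s
  set a := π h s with ha
  have hmax0 := le_max_left 0 (M.avg s a (potential M Vmax v φ π (h + 1)))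
  have hmax1 := le_max_right 0 (M.avg s a (potential M Vmax v φ π (h + 1)))
  have hb := hp.b_nonneg s a
  have hl0 := hl s a
  -- A bonus of at least `Vmax` pays for the whole potential, which is at most `2 Vmax`. Otherwise
  -- the slack inequality is available.
  rcases le_or_gt Vmax (b s a) with hcap | hcap
  · linarith
  rw [optQ, if_neg hN] at hveq
  have hV1 := M.V_mem hVmax.le hV π h1 (by omega) s
  have hVs := M.Vstar_mem hVmax.le hV h1 (by omega) s
  have hφ0 := hφ.nonneg h h1 (by omega) s
  have hqo := hp.Vstar_le hφ hVmax.le hV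
  have hU0 := hqo h h1 (by omega) s
  have hU1 : v h s - M.Vstar h s + φ h s ≤ 5 / 4 * Vmax := by
    linarith [hp.v_le hVmax.le h1 (by omega) s, hφV h h1 (by omega) s]
  rcases lt_or_ge (rh s a + ∑ s', q s a s' * v (h + 1) s') 0 with hx | hx
  -- Clipped at zero: the planned value is at most one bonus, and the quadratic term is at most half
  -- its base since the base is at most `5/4 Vmax`.
  · have hvb : v h s ≤ b s a := by
      rw [hveq, max_eq_right hx.le, zero_add]; exact min_le_left _ _
    refine le_trans ?_ (add_le_add le_rfl hmax0)
    rw [potential]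
    set U := v h s - M.Vstar h s + φ h s with hU
    have hsq : 2 / (5 * Vmax) * U ^ 2 ≤ U / 2 := by
      rw [div_mul_eq_mul_div, div_le_iff₀ (by positivity)]
      nlinarith
    linarith
  · have hvb : v h s ≤ (rh s a + ∑ s', q s a s' * v (h + 1) s') + b s a := by
      conv_lhs => rw [hveq]
      rw [max_eq_left hx]; exact min_le_left _ _
    refine le_trans ?_ (add_le_add le_rfl hmax1)
    have hdev := (abs_le.1 (hφ.abs_le h h1 h2 s a hN hcap)).2
    set U : S → ℝ := fun s' => v (h + 1) s' - M.Vstar (h + 1) s' + φ (h + 1) s' with hUdef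
    have hUn : ∀ s', 0 ≤ U s' := fun s' => by
      have := hqo (h + 1) (by omega) (by omega) s'; simp only [hUdef]; linarith
    have hUle : ∀ s', U s' ≤ 5 / 4 * Vmax := fun s' => by
      have := hp.v_le hVmax.le (h := h + 1) (by omega) (by omega) s'
      have := hφV (h + 1) (by omega) (by omega) s'
      have := (M.Vstar_mem hVmax.le hV (h := h + 1) (by omega) (by omega) s').1
      simp only [hUdef]; linarith
    have hqU := hq s a hN U hUn hUle
    have hqsum : ∑ s', q s a s' * U s' = ∑ s', q s a s' * v (h + 1) s'
        - ∑ s', q s a s' * M.Vstar (h + 1) s' + ∑ s', q s a s' * φ (h + 1) s' := by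
      rw [← Finset.sum_sub_distrib, ← Finset.sum_add_distrib]
      exact Finset.sum_congr rfl fun s' _ => by simp only [hUdef]; ring
    have hPU : M.avg s a U = M.avg s a (v (h + 1)) - M.avg s a (M.Vstar (h + 1))
        + M.avg s a (φ (h + 1)) := by
      rw [hUdef, M.avg_add, M.avg_sub]
    have hPpot : M.avg s a (potential M Vmax v φ π (h + 1))
        = M.avg s a (v (h + 1)) - M.avg s a (M.V π (h + 1))
          + 2 / (5 * Vmax) * M.avg s a (fun s' => U s' ^ 2) - 3 * M.avg s a (φ (h + 1)) := by
      have : potential M Vmax v φ π (h + 1) = fun s' => v (h + 1) s' - M.V π (h + 1) s'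
          + 2 / (5 * Vmax) * U s' ^ 2 - 3 * φ (h + 1) s' := rfl
      rw [this, M.avg_sub, M.avg_add, M.avg_sub, M.avg_const_mul, M.avg_const_mul]
    have hG := hφ.superharmonic h h1 h2 s a
    have hQs := M.Qstar_eq h1 h2 s a
    have hQV := M.Qstar_le_Vstar h1 h2 s a
    have hVπ := M.V_eq π h2 s
    rw [← ha] at hVπ
    rw [M.var_eq] at hqU
    have hvar := M.var_nonneg s a U
    rw [M.var_eq] at hvar
    -- Write `G` for the drop of `φ` and `x` for the error of the transition estimate on `U`. The
    -- upper half of the slack inequality gives `U_h ≤ P U + x + 2b + 2G`, while the planned value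
    -- minus the policy value exceeds its average by at most `x + 2b + G`. Inserting the bound on
    -- `x` leaves `4b + 2l + 3G`, and the term `-3φ` of the potential removes `3G`.
    have hdrift := drift_aux (U := v h s - M.Vstar h s + φ h s) (P1 := M.avg s a U)
      (P2 := M.avg s a fun s' => U s' ^ 2)
      (x := ∑ s', q s a s' * U s' - M.avg s a U) (b := b s a)
      (G := φ h s - M.avg s a (φ (h + 1))) (l := l s a) hVmax (by linarith) hU1
      (M.avg_nonneg s a hUn) (by linarith) hb (by linarith) hl0 (by linarith) hqU
    rw [hPpot, potential]
    linarith

end Analysis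

/-! ### The slack built from the maximal variance proxy -/

/-- `9/8 W - w² / (16 D)`, the shape of the slack. -/
def slackShape (D : ℝ) (W w : ℕ → S → ℝ) (h : ℕ) (s : S) : ℝ :=
  9 / 8 * W h s - 1 / 16 / D * w h s ^ 2

section Shape

variable {M : MDP S A} {σ : ℕ → S → A → ℝ} {W w : ℕ → S → ℝ}

theorem MDP.IsMaxProxy.WdiffStar_nonneg [Nonempty S] (hW : M.IsMaxProxy σ W w) :
    0 ≤ M.WdiffStar σ := by
  obtain ⟨s⟩ := ‹Nonempty S›
  exact (hW.centred_nonneg 1 le_rfl (by omega) s).trans (hW.centred_le 1 le_rfl (by omega) s)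

theorem MDP.IsMaxProxy.Wstar_nonneg [Nonempty S] (hW : M.IsMaxProxy σ W w) :
    0 ≤ M.Wstar σ := by
  obtain ⟨s⟩ := ‹Nonempty S›
  exact (hW.nonneg 1 le_rfl (by omega) s).trans (hW.le_Wstar 1 le_rfl (by omega) s)

theorem MDP.IsMaxProxy.centred_le_self (hW : M.IsMaxProxy σ W w) {h : ℕ} (h1 : 1 ≤ h)
    (h2 : h ≤ M.H + 1) (s : S) : w h s ≤ W h s := by
  obtain ⟨m, hm, hm0, -⟩ := hW.centred
  rw [hm]; linarith [hm0 h h1 h2]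

theorem slackShape_nonneg [Nonempty S] (hW : M.IsMaxProxy σ W w) {h : ℕ} (h1 : 1 ≤ h)
    (h2 : h ≤ M.H + 1) (s : S) : 0 ≤ slackShape (M.WdiffStar σ) W w h s := by
  have hD := hW.WdiffStar_nonneg
  have hw0 := hW.centred_nonneg h h1 h2 s
  have hwD := hW.centred_le h h1 h2 s
  have hwW := hW.centred_le_self h1 h2 s
  have : 1 / 16 / M.WdiffStar σ * w h s ^ 2 ≤ 1 / 16 * w h s := by
    -- If `WdiffStar` vanishes, the convention `1/0 = 0` makes the quadratic term disappear; the
    -- centred proxy is then zero as well.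
    rcases hD.eq_or_lt with h0 | h0
    · rw [← h0]; simp only [div_zero, zero_mul]; positivity
    · rw [div_mul_eq_mul_div, div_le_iff₀ h0]; nlinarith
  unfold slackShape
  linarith

theorem slackShape_le [Nonempty S] (hW : M.IsMaxProxy σ W w) {h : ℕ} (h1 : 1 ≤ h)
    (h2 : h ≤ M.H + 1) (s : S) : slackShape (M.WdiffStar σ) W w h s ≤ 9 / 8 * M.Wstar σ := by
  have hD := hW.WdiffStar_nonneg
  have := hW.le_Wstar h h1 h2 s
  have : 0 ≤ 1 / 16 / M.WdiffStar σ * w h s ^ 2 := by positivity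
  unfold slackShape
  linarith

theorem slackShape_succ_H (hW : M.IsMaxProxy σ W w) (s : S) :
    slackShape (M.WdiffStar σ) W w (M.H + 1) s = 0 := by
  have h1 := hW.centred_le_self (h := M.H + 1) (by omega) le_rfl s
  have h2 := hW.centred_nonneg (M.H + 1) (by omega) le_rfl s
  rw [hW.succ_H] at h1
  simp [slackShape, hW.succ_H, le_antisymm h1 h2]

/-- Let `G ≥ σ²/2` be the drop of `W` and `p` the average of the next centred proxy. The drop of
`-w²/(16D)` is the variance over `16D` minus `(w² - p²)/(16D)`. The latter is at most `G/8`, because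
`w - p ≤ G` by monotonicity of the minima and `w + p ≤ 2D`. The surplus `G/8` of the factor `9/8`
covers exactly this. -/
theorem slackShape_superharmonic [Nonempty S] (hW : M.IsMaxProxy σ W w) {h : ℕ} (h1 : 1 ≤ h)
    (h2 : h ≤ M.H) (s : S) (a : A) :
    σ h s a ^ 2 / 2 + 1 / 16 / M.WdiffStar σ * M.var s a (w (h + 1))
      + M.avg s a (slackShape (M.WdiffStar σ) W w (h + 1))
      ≤ slackShape (M.WdiffStar σ) W w h s := by
  have hD := hW.WdiffStar_nonneg
  obtain ⟨m, hm, hm0, hmm⟩ := hW.centred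
  have hsup := hW.superharmonic h h1 h2 s a
  have hσ2 : 0 ≤ σ h s a ^ 2 := sq_nonneg _
  have e1 : M.avg s a (slackShape (M.WdiffStar σ) W w (h + 1))
      = 9 / 8 * M.avg s a (W (h + 1))
        - 1 / 16 / M.WdiffStar σ * M.avg s a (fun s' => w (h + 1) s' ^ 2) := by
    have : slackShape (M.WdiffStar σ) W w (h + 1) = fun s' => 9 / 8 * W (h + 1) s'
        - 1 / 16 / M.WdiffStar σ * w (h + 1) s' ^ 2 := rfl
    rw [this, M.avg_sub, M.avg_const_mul, M.avg_const_mul]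
  rw [e1, slackShape, M.var_eq]
  have e2 : M.avg s a (w (h + 1)) = M.avg s a (W (h + 1)) - m (h + 1) := by
    have : w (h + 1) = fun s' => W (h + 1) s' - m (h + 1) := funext (hm (h + 1))
    rw [this, M.avg_sub, M.avg_const]
  set p := M.avg s a (w (h + 1)) with hp
  have hp0 : 0 ≤ p := M.avg_nonneg s a (hW.centred_nonneg (h + 1) (by omega) (by omega))
  have hpD : p ≤ M.WdiffStar σ := M.avg_le s a (hW.centred_le (h + 1) (by omega) (by omega))
  have hw0 := hW.centred_nonneg h h1 (by omega) s
  have hwD := hW.centred_le h h1 (by omega) s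
  set G := W h s - M.avg s a (W (h + 1)) with hG
  have hG0 : σ h s a ^ 2 / 2 ≤ G := by simp only [hG]; linarith
  have hwp : w h s - p ≤ G := by
    have := hmm h h1 h2
    rw [e2, hm]; simp only [hG]; linarith
  have key : 1 / 16 / M.WdiffStar σ * (w h s ^ 2 - p ^ 2) ≤ 1 / 8 * G := by
    rcases hD.eq_or_lt with h0 | h0
    · rw [← h0]; simp only [div_zero, zero_mul]; linarith
    · rw [div_mul_eq_mul_div, div_le_iff₀ h0]
      have h3 : w h s ^ 2 - p ^ 2 ≤ 2 * M.WdiffStar σ * G := by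
        rcases le_or_gt (w h s) p with h4 | h4
        · have : 0 ≤ 2 * M.WdiffStar σ * G := mul_nonneg (by linarith) (by linarith)
          nlinarith
        · have h5 : w h s ^ 2 - p ^ 2 = (w h s - p) * (w h s + p) := by ring
          rw [h5]
          calc (w h s - p) * (w h s + p) ≤ G * (2 * M.WdiffStar σ) :=
                mul_le_mul hwp (by linarith) (by linarith) (by linarith)
            _ = _ := by ring
      linarith
  have hW' : W h s = G + M.avg s a (W (h + 1)) := by simp only [hG]; ring
  rw [hW']
  linarith

/-- The difference quotient with respect to `w` is `9/8` minus a number between `0` and `1/8`. -/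
theorem abs_slackShape_sub_le [Nonempty S] (hW : M.IsMaxProxy σ W w) {h : ℕ} (h1 : 1 ≤ h)
    (h2 : h ≤ M.H + 1) (x y : S) :
    |slackShape (M.WdiffStar σ) W w h x - slackShape (M.WdiffStar σ) W w h y|
      ≤ 9 / 8 * |w h x - w h y| := by
  have hD := hW.WdiffStar_nonneg
  obtain ⟨m, hm, -, -⟩ := hW.centred
  have e : slackShape (M.WdiffStar σ) W w h x - slackShape (M.WdiffStar σ) W w h y
      = (w h x - w h y) * (9 / 8 - 1 / 16 / M.WdiffStar σ * (w h x + w h y)) := by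
    rw [slackShape, slackShape, hm h x, hm h y]; ring
  have hx0 := hW.centred_nonneg h h1 h2 x
  have hxD := hW.centred_le h h1 h2 x
  have hy0 := hW.centred_nonneg h h1 h2 y
  have hyD := hW.centred_le h h1 h2 y
  have hb : 1 / 16 / M.WdiffStar σ * (w h x + w h y) ≤ 1 / 8 := by
    rcases hD.eq_or_lt with h0 | h0
    · rw [← h0]; norm_num
    · rw [div_mul_eq_mul_div, div_le_iff₀ h0]; linarith
  have hb0 : 0 ≤ 1 / 16 / M.WdiffStar σ * (w h x + w h y) := by positivity
  rw [e, abs_mul, mul_comm]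
  refine mul_le_mul_of_nonneg_right ?_ (abs_nonneg _)
  rw [abs_le]; constructor <;> linarith

theorem exists_slackShape_mem_Icc [Nonempty S] (hW : M.IsMaxProxy σ W w) {h : ℕ} (h1 : 1 ≤ h)
    (h2 : h ≤ M.H + 1) : ∃ lo, ∀ x, slackShape (M.WdiffStar σ) W w h x
      ∈ Set.Icc lo (lo + 9 / 8 * M.WdiffStar σ) := by
  obtain ⟨x₀, hx₀⟩ := Finite.exists_min (slackShape (M.WdiffStar σ) W w h)
  refine ⟨_, fun x => ⟨hx₀ x, ?_⟩⟩
  have h3 := (abs_le.1 (abs_slackShape_sub_le hW h1 h2 x x₀)).2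
  have h4 : |w h x - w h x₀| ≤ M.WdiffStar σ := by
    have hx0 := hW.centred_nonneg h h1 h2 x
    have hxD := hW.centred_le h h1 h2 x
    have hy0 := hW.centred_nonneg h h1 h2 x₀
    have hyD := hW.centred_le h h1 h2 x₀
    rw [abs_le]; constructor <;> linarith
  linarith

end Shape

end EQO

namespace EQO

/-! ### Properties that hold up to a small probability -/

section FailsLE

variable {Ω : Type*} [MeasurableSpace Ω] {μ : Measure Ω}

/-- `P` fails with (outer) probability at most `c`. -/
def FailsLE (μ : Measure Ω) (c : ℝ) (P : Ω → Prop) : Prop := μ {ω | ¬ P ω} ≤ ENNReal.ofReal c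

theorem FailsLE.mono {c c' : ℝ} {P Q : Ω → Prop} (h : FailsLE μ c P) (hc : c ≤ c')
    (hPQ : ∀ ω, P ω → Q ω) : FailsLE μ c' Q :=
  (measure_mono fun ω (hω : ¬ Q ω) (hP : P ω) => hω (hPQ ω hP)).trans
    (h.trans (ENNReal.ofReal_le_ofReal hc))

theorem FailsLE.and {c c' : ℝ} {P Q : Ω → Prop} (h : FailsLE μ c P) (h' : FailsLE μ c' Q)
    (hc : 0 ≤ c) (hc' : 0 ≤ c') : FailsLE μ (c + c') fun ω => P ω ∧ Q ω := by
  refine le_trans (measure_mono ?_) ((measure_union_le _ _).trans ((add_le_add h h').trans_eq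
    (ENNReal.ofReal_add hc hc').symm))
  intro ω hω
  by_cases hP : P ω
  · exact Or.inr fun hQ => hω ⟨hP, hQ⟩
  · exact Or.inl hP

theorem FailsLE.ball {ι : Type*} (I : Finset ι) {c : ι → ℝ} (hc : ∀ i ∈ I, 0 ≤ c i)
    {P : ι → Ω → Prop} (h : ∀ i ∈ I, FailsLE μ (c i) (P i)) :
    FailsLE μ (∑ i ∈ I, c i) fun ω => ∀ i ∈ I, P i ω := by
  refine le_trans (measure_mono ?_) ((measure_biUnion_finset_le I fun i => {ω | ¬ P i ω}).trans
    ((Finset.sum_le_sum h).trans_eq (ENNReal.ofReal_sum_of_nonneg hc).symm))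
  intro ω hω
  simp only [Set.mem_ofPred_eq, not_forall] at hω
  obtain ⟨i, hi, hP⟩ := hω
  exact Set.mem_biUnion hi hP

theorem FailsLE.of_ae {P : Ω → Prop} (h : ∀ᵐ ω ∂μ, P ω) {c : ℝ} : FailsLE μ c P :=
  le_of_eq_of_le h zero_le

end FailsLE

/-! ### Two-sided deviation bounds -/

namespace Run

variable {S A Ω : Type*} [DecidableEq S] [DecidableEq A]

theorem N_le (D : Run S A Ω) (H k : ℕ) (ω : Ω) (s : S) (a : A) : D.N H k ω s a ≤ (k - 1) * H := by
  calc D.N H k ω s a ≤ ∑ i ∈ Finset.Ico 1 k, ∑ h ∈ Finset.Icc 1 H, 1 :=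
        Finset.sum_le_sum fun i _ => Finset.sum_le_sum fun h _ => by split_ifs <;> simp
    _ = (k - 1) * H := by simp

variable [Fintype S]

/-- The deviation of the empirical one-step return for the planning step `j`. -/
def dev (D : Run S A Ω) (M : MDP S A) (k : ℕ) (ω : Ω) (j : ℕ) (s : S) (a : A) : ℝ :=
  D.rHat M.H k ω s a + ∑ s', D.PHat M.H k ω s a s' * M.Vstar (j + 1) s' - M.Qstar j s a

/-- The deviation of the empirical expectation of `g`. -/
def devP (D : Run S A Ω) (M : MDP S A) (k : ℕ) (ω : Ω) (g : S → ℝ) (s : S) (a : A) : ℝ :=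
  ∑ s', D.PHat M.H k ω s a s' * g s' - M.avg s a g

theorem visitSum_return_eq (D : Run S A Ω) (M : MDP S A) (k j : ℕ) (s : S) (a : A) {ω : Ω}
    (hN : D.N M.H k ω s a ≠ 0) (t c : ℝ) :
    D.visitSum M.H k s a (fun i h ω =>
        t * (D.R i h ω + M.Vstar (j + 1) (D.s i (h + 1) ω) - M.Qstar j s a) - c) ω
      = D.N M.H k ω s a * (t * D.dev M k ω j s a - c) := by
  have e : (fun (i h : ℕ) ω =>
      t * (D.R i h ω + M.Vstar (j + 1) (D.s i (h + 1) ω) - M.Qstar j s a) - c)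
      = fun i h ω => (t * D.R i h ω + t * M.Vstar (j + 1) (D.s i (h + 1) ω))
        + (-(t * M.Qstar j s a + c)) := by
    funext i h ω; ring
  rw [e, visitSum_add, visitSum_add, visitSum_const_mul, visitSum_const_mul, visitSum_const,
    D.visitSum_R_eq _ _ _ _ hN,
    D.visitSum_s_eq M.H k s a (fun s' => M.Vstar (j + 1) s') hN, dev]
  ring

theorem visitSum_next_eq (D : Run S A Ω) (M : MDP S A) (k : ℕ) (g : S → ℝ) (s : S) (a : A) {ω : Ω}
    (hN : D.N M.H k ω s a ≠ 0) (t c : ℝ) :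
    D.visitSum M.H k s a (fun i h ω => t * (g (D.s i (h + 1) ω) - M.avg s a g) - c) ω
      = D.N M.H k ω s a * (t * D.devP M k ω g s a - c) := by
  have e : (fun (i h : ℕ) ω => t * (g (D.s i (h + 1) ω) - M.avg s a g) - c)
      = fun i h ω => t * g (D.s i (h + 1) ω) + (-(t * M.avg s a g + c)) := by
    funext i h ω; ring
  rw [e, visitSum_add, visitSum_const_mul, visitSum_const, D.visitSum_s_eq M.H k s a g hN, devP]
  ring

end Run

theorem abs_le_of_two_sided {x n t l c : ℝ} (hn : 0 < n) (ht : 0 < t)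
    (h1 : n * (t * x - c) ≤ l) (h2 : n * (-t * x - c) ≤ l) : |x| ≤ l / (t * n) + c / t := by
  have e : l / (t * n) + c / t = (l + n * c) / (t * n) := by field_simp
  rw [e, le_div_iff₀ (by positivity)]
  rcases abs_cases x with ⟨h, -⟩ | ⟨h, -⟩ <;> rw [h] <;> nlinarith

namespace Run.IsRunOf

variable {S A Ω : Type*} [DecidableEq S] [DecidableEq A] [Fintype S] [m₀ : MeasurableSpace Ω]
  {μ : Measure Ω} [IsProbabilityMeasure μ] {M : MDP S A} {D : Run S A Ω}

/-- Ville's inequality at the parameters `t` and `-t`, divided by the count. The first term is the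
price of the probability, the second the compensator. -/
theorem failsLE_dev (hD : D.IsRunOf M μ) {σ : ℕ → S → A → ℝ} {Vα : ℝ}
    (hsub : SubExponentialReturns D M μ σ Vα) {j : ℕ} (hj : j ∈ Finset.Icc 1 M.H) (s : S) (a : A)
    {t : ℝ} (ht : 0 < t) (htV : t * Vα ≤ 1) (ℓ : ℝ) (K : ℕ) :
    FailsLE μ (2 * Real.exp (-ℓ)) fun ω => ∀ k ∈ Finset.Icc 1 K, D.N M.H k ω s a ≠ 0 →
      |D.dev M k ω j s a| ≤ ℓ / (t * D.N M.H k ω s a) + σ j s a ^ 2 * t / 2 := by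
  have key : ∀ u : ℝ, |u| = t → FailsLE μ (Real.exp (-ℓ)) fun ω => ∀ k ∈ Finset.Icc 1 K,
      D.N M.H k ω s a ≠ 0 →
      D.N M.H k ω s a * (u * D.dev M k ω j s a - σ j s a ^ 2 * t ^ 2 / 2) ≤ ℓ := by
    intro u hu
    refine le_trans (measure_mono ?_)
      (hD.measure_visitSum_return_le hsub hj s a (t := u) (by rwa [hu]) ℓ K)
    intro ω hω
    simp only [Set.mem_ofPred_eq, not_forall, not_le] at hω ⊢
    obtain ⟨k, hk, hN, hlt⟩ := hω
    refine ⟨k, hk, ?_⟩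
    rwa [D.visitSum_return_eq M k j s a hN, ← sq_abs u, hu]
  refine ((key t (abs_of_pos ht)).and (key (-t) (by rw [abs_neg, abs_of_pos ht]))
    (Real.exp_pos _).le (Real.exp_pos _).le).mono (by linarith) ?_
  rintro ω ⟨h1, h2⟩ k hk hN
  have hn : (0 : ℝ) < D.N M.H k ω s a := by exact_mod_cast Nat.pos_of_ne_zero hN
  refine (abs_le_of_two_sided hn ht (h1 k hk hN) (h2 k hk hN)).trans_eq ?_
  congr 1
  field_simp

theorem failsLE_devP (hD : D.IsRunOf M μ) {g : S → ℝ} (s : S) (a : A) {t c : ℝ} (ht : 0 < t)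
    (h1 : M.avg s a (fun s' => Real.exp (t * (g s' - M.avg s a g) - c)) ≤ 1)
    (h2 : M.avg s a (fun s' => Real.exp (-t * (g s' - M.avg s a g) - c)) ≤ 1) (ℓ : ℝ) (K : ℕ) :
    FailsLE μ (2 * Real.exp (-ℓ)) fun ω => ∀ k ∈ Finset.Icc 1 K, D.N M.H k ω s a ≠ 0 →
      |D.devP M k ω g s a| ≤ ℓ / (t * D.N M.H k ω s a) + c / t := by
  have key : ∀ u : ℝ, M.avg s a (fun s' => Real.exp (u * (g s' - M.avg s a g) - c)) ≤ 1 →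
      FailsLE μ (Real.exp (-ℓ)) fun ω => ∀ k ∈ Finset.Icc 1 K, D.N M.H k ω s a ≠ 0 →
      D.N M.H k ω s a * (u * D.devP M k ω g s a - c) ≤ ℓ := by
    intro u hu
    refine le_trans (measure_mono ?_)
      (hD.measure_visitSum_next_le s a (g := fun s' => u * (g s' - M.avg s a g) - c) hu ℓ K)
    intro ω hω
    simp only [Set.mem_ofPred_eq, not_forall, not_le] at hω ⊢
    obtain ⟨k, hk, hN, hlt⟩ := hω
    refine ⟨k, hk, ?_⟩
    rwa [D.visitSum_next_eq M k g s a hN]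
  refine ((key t h1).and (key (-t) h2) (Real.exp_pos _).le (Real.exp_pos _).le).mono
    (by linarith) ?_
  rintro ω ⟨h1, h2⟩ k hk hN
  have hn : (0 : ℝ) < D.N M.H k ω s a := by exact_mod_cast Nat.pos_of_ne_zero hN
  exact abs_le_of_two_sided hn ht (h1 k hk hN) (h2 k hk hN)

end Run.IsRunOf

/-! ### Logarithmic factors -/

theorem sum_inv_sq_le (n : ℕ) : ∑ i ∈ Finset.range n, 1 / ((i : ℝ) + 1) ^ 2 ≤ 2 := by
  rcases Nat.eq_zero_or_pos n with rfl | hn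
  · simp
  have : ∀ n : ℕ, 1 ≤ n → ∑ i ∈ Finset.range n, 1 / ((i : ℝ) + 1) ^ 2 ≤ 2 - 1 / (n : ℝ) := by
    intro n hn
    induction n, hn using Nat.le_induction with
    | base => norm_num
    | succ n hn ih =>
      rw [Finset.sum_range_succ]
      have hn0 : (0 : ℝ) < n := by exact_mod_cast hn
      have h1 : 1 / ((n : ℝ) + 1) ^ 2 ≤ 1 / n - 1 / (n + 1) := by
        have : 1 / (n : ℝ) - 1 / (n + 1) = 1 / (n * (n + 1)) := by field_simp; ring
        rw [this]
        exact one_div_le_one_div_of_le (by positivity) (by nlinarith)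
      push_cast
      linarith
  have h := this n hn
  have : (0 : ℝ) ≤ 1 / n := by positivity
  linarith

section Ell

variable {S A : Type*} [Fintype S]

theorem log_exp_two_mul (M : MDP S A) {k : ℕ} (hk : 1 ≤ k) :
    Real.log (Real.exp 2 * k * M.H) = 2 + Real.log (k * M.H) := by
  have h1 : (0 : ℝ) < k := by exact_mod_cast hk
  have h2 : (0 : ℝ) < M.H := by exact_mod_cast M.one_le_H
  rw [mul_assoc, Real.log_mul (Real.exp_pos 2).ne' (by positivity), Real.log_exp]

theorem two_le_log (M : MDP S A) {k : ℕ} (hk : 1 ≤ k) :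
    2 ≤ Real.log (Real.exp 2 * k * M.H) := by
  rw [log_exp_two_mul M hk]
  have h1 : (1 : ℝ) ≤ k := by exact_mod_cast hk
  have h2 : (1 : ℝ) ≤ M.H := by exact_mod_cast M.one_le_H
  have := Real.log_nonneg (one_le_mul_of_one_le_of_one_le h1 h2)
  linarith

variable [Fintype A]

/-- `32 H S A / δ`. -/
def baseFactor (M : MDP S A) (δ : ℝ) : ℝ := 32 * M.H * Fintype.card S * Fintype.card A / δ

theorem ell₁_eq (M : MDP S A) (i : ℕ) (δ : ℝ) :
    ell₁ M i δ = Real.log (baseFactor M δ * (i : ℝ) ^ 2) := by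
  rw [ell₁, baseFactor]; congr 1; ring

theorem ell₂_eq (M : MDP S A) (k : ℕ) (δ : ℝ) :
    ell₂ M k δ = Real.log (baseFactor M δ * Real.log (Real.exp 2 * k * M.H) ^ 2) := by
  rw [ell₂, baseFactor]; congr 1; ring

variable [Nonempty S] [Nonempty A]

theorem card_factor_ge_one (M : MDP S A) :
    1 ≤ (M.H : ℝ) ∧ 1 ≤ (Fintype.card S : ℝ) ∧ 1 ≤ (Fintype.card A : ℝ) :=
  ⟨by exact_mod_cast M.one_le_H, by exact_mod_cast Fintype.card_pos,
    by exact_mod_cast Fintype.card_pos⟩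

theorem baseFactor_ge (M : MDP S A) {δ : ℝ} (hδ : δ ∈ Set.Ioc (0 : ℝ) 1) :
    32 * (M.H * Fintype.card S * Fintype.card A) ≤ baseFactor M δ := by
  obtain ⟨h1, h2, h3⟩ := card_factor_ge_one M
  rw [baseFactor, le_div_iff₀ hδ.1]
  have : 0 ≤ 32 * ((M.H : ℝ) * Fintype.card S * Fintype.card A) := by positivity
  nlinarith [hδ.2]

theorem one_le_HSA (M : MDP S A) : 1 ≤ (M.H : ℝ) * Fintype.card S * Fintype.card A := by
  obtain ⟨h1, h2, h3⟩ := card_factor_ge_one M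
  exact one_le_mul_of_one_le_of_one_le (one_le_mul_of_one_le_of_one_le h1 h2) h3

theorem baseFactor_ge_32 (M : MDP S A) {δ : ℝ} (hδ : δ ∈ Set.Ioc (0 : ℝ) 1) :
    32 ≤ baseFactor M δ := by
  have := baseFactor_ge M hδ
  have := one_le_HSA M
  linarith

theorem ell₂_mono (M : MDP S A) {δ : ℝ} (hδ : δ ∈ Set.Ioc (0 : ℝ) 1) {k K : ℕ} (hk : 1 ≤ k)
    (hkK : k ≤ K) : ell₂ M k δ ≤ ell₂ M K δ := by
  rw [ell₂_eq, ell₂_eq]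
  have hB := baseFactor_ge_32 M hδ
  have h2 := two_le_log M hk
  have hHp : (0 : ℝ) < M.H := by exact_mod_cast M.one_le_H
  have hkp : (0 : ℝ) < k := by exact_mod_cast hk
  have hle : Real.log (Real.exp 2 * k * M.H) ≤ Real.log (Real.exp 2 * K * M.H) := by
    apply Real.log_le_log (by positivity)
    have : (k : ℝ) ≤ K := by exact_mod_cast hkK
    gcongr
  apply Real.log_le_log (by positivity)
  gcongr

theorem exp_neg_log_baseFactor (M : MDP S A) {δ : ℝ} (hδ : δ ∈ Set.Ioc (0 : ℝ) 1) (x : ℝ)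
    (hx : 0 < x) : Real.exp (-Real.log (baseFactor M δ * x ^ 2))
      = δ / (32 * (M.H * Fintype.card S * Fintype.card A)) * (1 / x ^ 2) := by
  have hB := baseFactor_ge_32 M hδ
  have := one_le_HSA M
  have hδ' := hδ.1.ne'
  rw [Real.exp_neg, Real.exp_log (by positivity), baseFactor]
  have h1 : (M.H : ℝ) * Fintype.card S * Fintype.card A ≠ 0 := by positivity
  field_simp

theorem log_128_le_ell₂ (M : MDP S A) {δ : ℝ} (hδ : δ ∈ Set.Ioc (0 : ℝ) 1) {k : ℕ} (hk : 1 ≤ k) :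
    Real.log 128 ≤ ell₂ M k δ := by
  rw [ell₂_eq]
  have hB := baseFactor_ge_32 M hδ
  have h2 := two_le_log M hk
  apply Real.log_le_log (by norm_num)
  have : (4 : ℝ) ≤ Real.log (Real.exp 2 * k * M.H) ^ 2 := by nlinarith
  nlinarith

/-- The iterated logarithm is at least `2`, so the argument is at least `32 · 4 = 2⁷`, and `7 log 2
> 24/5`. -/
theorem ell₂_ge (M : MDP S A) {δ : ℝ} (hδ : δ ∈ Set.Ioc (0 : ℝ) 1) {k : ℕ} (hk : 1 ≤ k) :
    24 / 5 ≤ ell₂ M k δ := by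
  refine le_trans ?_ (log_128_le_ell₂ M hδ hk)
  have : (128 : ℝ) = 2 ^ 7 := by norm_num
  rw [this, Real.log_pow]
  have := Real.log_two_gt_d9
  push_cast
  linarith

theorem ell₁_ge (M : MDP S A) {δ : ℝ} (hδ : δ ∈ Set.Ioc (0 : ℝ) 1) {i : ℕ} (hi : 1 ≤ i) :
    3 ≤ ell₁ M i δ := by
  have h1 : Real.log 32 ≤ ell₁ M i δ := by
    rw [ell₁_eq]
    have hB := baseFactor_ge_32 M hδ
    have : (1 : ℝ) ≤ (i : ℝ) ^ 2 := one_le_pow₀ (by exact_mod_cast hi)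
    exact Real.log_le_log (by norm_num) (by nlinarith)
  have : (32 : ℝ) = 2 ^ 5 := by norm_num
  rw [this, Real.log_pow] at h1
  have := Real.log_two_gt_d9
  push_cast at h1
  linarith

end Ell

/-- Choice of the grid point in a geometric peeling of the range of `n`. -/
theorem exists_peeling {s n : ℝ} (hs : 0 < s) (hn : 1 ≤ n) :
    ∃ m : ℕ, (m : ℝ) ≤ Real.log n + 1 ∧ ∀ l L v : ℝ, 0 < l → l ≤ L → v ≤ s ^ 2 / 4 →
      2 * √l / (s * Real.exp (m / 2)) ≤ 2 * √(L / n) / s ∧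
      l / (2 * √l / (s * Real.exp (m / 2)) * n) + v * (2 * √l / (s * Real.exp (m / 2))) / 2
        ≤ s * √(L / n) := by
  have hn0 : 0 < n := by linarith
  -- With `m = ⌈log n⌉` the grid value `exp(m/2)` lies between `√n` and `1.7 √n`, since `e < 1.7²`.
  -- So the parameter `2√l/(s exp(m/2))` is within a constant factor of `2√l/(s√n)`, although it
  -- depends on `n` only through `m`.
  refine ⟨⌈Real.log n⌉₊, (Nat.ceil_lt_add_one (Real.log_nonneg hn)).le, ?_⟩
  intro l L v hl hlL hv
  set m := ⌈Real.log n⌉₊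
  set E := Real.exp ((m : ℝ) / 2) with hE
  have hE0 : 0 < E := Real.exp_pos _
  have hE2 : E ^ 2 = Real.exp m := by
    rw [hE, ← Real.exp_nat_mul]; congr 1; push_cast; ring
  set r := √n with hr
  have hr0 : 0 < r := Real.sqrt_pos.2 hn0
  have hr2 : r ^ 2 = n := Real.sq_sqrt hn0.le
  have h1 : r ≤ E := by
    rw [← abs_of_pos hr0, ← abs_of_pos hE0, ← sq_le_sq, hr2, hE2]
    calc n = Real.exp (Real.log n) := (Real.exp_log hn0).symm
      _ ≤ _ := Real.exp_le_exp.2 (Nat.le_ceil _)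
  have h2 : E ≤ 17 / 10 * r := by
    have h3 : E ^ 2 ≤ (17 / 10 * r) ^ 2 := by
      rw [hE2, mul_pow, hr2]
      have h4 : Real.exp m ≤ Real.exp (Real.log n + 1) :=
        Real.exp_le_exp.2 (Nat.ceil_lt_add_one (Real.log_nonneg hn)).le
      rw [Real.exp_add, Real.exp_log hn0] at h4
      have := Real.exp_one_lt_d9
      nlinarith
    exact (abs_le_of_sq_le_sq' h3 (by positivity)).2
  have hsl : 0 < √l := Real.sqrt_pos.2 hl
  have hlq : √l ^ 2 = l := Real.sq_sqrt hl.le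
  have hLr : √(L / n) = √L / r := Real.sqrt_div' L hn0.le
  have hlL' : √l ≤ √L := Real.sqrt_le_sqrt hlL
  constructor
  · rw [hLr, div_le_div_iff₀ (by positivity) hs]
    have h3 : √l ≤ √L / r * E := by
      rw [div_mul_eq_mul_div, le_div_iff₀ hr0]
      exact mul_le_mul hlL' h1 hr0.le (Real.sqrt_nonneg _)
    nlinarith
  · have e1 : l / (2 * √l / (s * E) * n) = √l * s * (E / (2 * r ^ 2)) := by
      rw [hr2]
      field_simp
      rw [hlq]
    have e2 : v * (2 * √l / (s * E)) / 2 ≤ √l * s * (1 / (4 * E)) := by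
      calc v * (2 * √l / (s * E)) / 2 ≤ s ^ 2 / 4 * (2 * √l / (s * E)) / 2 := by gcongr
        _ = √l * s * (1 / (4 * E)) := by field_simp
    have e3 : E / (2 * r ^ 2) + 1 / (4 * E) ≤ 1 / r := by
      have : E / (2 * r ^ 2) + 1 / (4 * E) = (2 * E ^ 2 + r ^ 2) / (4 * r ^ 2 * E) := by
        field_simp; ring
      rw [this, div_le_div_iff₀ (by positivity) hr0]
      -- This quadratic inequality holds for `E/r` between `1 ± 1/√2`, and `1.7 < 1 + 1/√2`.
      have : 2 * E ^ 2 + r ^ 2 ≤ 4 * r * E := by nlinarith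
      nlinarith
    rw [e1, hLr]
    calc √l * s * (E / (2 * r ^ 2)) + v * (2 * √l / (s * E)) / 2
        ≤ √l * s * (E / (2 * r ^ 2)) + √l * s * (1 / (4 * E)) := by linarith
      _ = √l * s * (E / (2 * r ^ 2) + 1 / (4 * E)) := by ring
      _ ≤ √l * s * (1 / r) := by gcongr
      _ ≤ √L * s * (1 / r) := by gcongr
      _ = s * (√L / r) := by ring

end EQO

/-! ### Deviation events, uniform over steps, pairs and episodes -/

namespace EQO

theorem FailsLE.family {Ω ι : Type*} [MeasurableSpace Ω] {μ : Measure Ω} (I : Finset ι) (n : ℕ)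
    {P : ι → ℕ → Ω → Prop} {c C : ℝ} (hc : 0 ≤ c) (hC : I.card * c ≤ C)
    (h : ∀ i ∈ I, ∀ m ∈ Finset.range n, FailsLE μ (c * (1 / ((m : ℝ) + 1) ^ 2)) (P i m)) :
    FailsLE μ (2 * C) fun ω => ∀ i ∈ I, ∀ m ∈ Finset.range n, P i m ω := by
  have hs : ∑ m ∈ Finset.range n, c * (1 / ((m : ℝ) + 1) ^ 2) ≤ 2 * c := by
    rw [← Finset.mul_sum]
    nlinarith [sum_inv_sq_le n]
  refine (FailsLE.ball I (c := fun _ => 2 * c) (fun _ _ => by positivity) fun i hi =>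
    (FailsLE.ball (Finset.range n) (fun _ _ => by positivity) (h i hi)).mono hs
      fun _ h => h).mono ?_ fun _ h => h
  rw [Finset.sum_const, nsmul_eq_mul]
  linarith

/-- Bernstein at the parameter `y = |u|/(3V)` would turn the term `3/5 y p |u|` into exactly `p
u²/(5V)`. A grid point in `[4/5 y, y]` loses only a factor `5/4` in the other term, whence `15/2 = 2
· 3 · 5/4`. For `|u| ≤ 15/2 V L/n` the bound `|q - p| ≤ 1` is enough, so arbitrarily small
parameters are not needed. -/
theorem le_rpow_grid_aux {p q u V L n : ℝ} {T : ℝ} (hV : 0 < V) (hp : 0 ≤ p)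
    (hqp : |q - p| ≤ 1) (hu : |u| ≤ 5 / 4 * V) (hn : 1 ≤ n) (hL : 24 / 5 ≤ L) (hT : Real.log n ≤ T)
    (h : ∀ i : ℕ, (i : ℝ) + 1 ≤ 5 * (2 + T) →
      |q - p| ≤ 2 * L / (5 / 12 * (4 / 5) ^ i * n) + 3 / 5 * (5 / 12 * (4 / 5) ^ i) * p) :
    (q - p) * u ≤ p * u ^ 2 / (5 * V) + 15 / 2 * V * L / n := by
  have hn0 : 0 < n := by linarith
  set x := |u| with hx
  have hx0 : 0 ≤ x := abs_nonneg u
  have hqx : (q - p) * u ≤ |q - p| * x := by rw [hx, ← abs_mul]; exact le_abs_self _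
  have hu2 : u ^ 2 = x ^ 2 := (sq_abs u).symm
  rw [hu2]
  rcases le_or_gt x (15 / 2 * V * L / n) with hsmall | hbig
  · have h1 : |q - p| * x ≤ x := mul_le_of_le_one_left hx0 hqp
    have h2 : 0 ≤ p * x ^ 2 / (5 * V) := by positivity
    linarith
  have hxp : 0 < x := lt_of_le_of_lt (by positivity) hbig
  set y := x / (3 * V) with hy
  have hy0 : 0 < y := by positivity
  have hy1 : 12 / 5 * y ≤ 1 := by
    rw [hy]
    have : x / (3 * V) ≤ 5 / 12 := by rw [div_le_iff₀ (by positivity)]; linarith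
    linarith
  obtain ⟨i₀, hi1, hi2⟩ := exists_nat_pow_near_of_lt_one (x := 12 / 5 * y) (y := (4 / 5 : ℝ))
    (by positivity) hy1 (by norm_num) (by norm_num)
  set t := 5 / 12 * (4 / 5 : ℝ) ^ (i₀ + 1) with ht
  have ht0 : 0 < t := by positivity
  have hty : t ≤ y := by rw [ht]; linarith
  have hyt : y ≤ 5 / 4 * t := by rw [ht, pow_succ]; linarith
  -- For large `|u|` the parameter exceeds `2L/n ≥ 1/n`, so the exponent is at most `log n / log
  -- (5/4) ≤ 5 log n`. This bounds the size of the grid.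
  have hi : ((i₀ + 1 : ℕ) : ℝ) + 1 ≤ 5 * (2 + T) := by
    have h1 : 2 * L / n < t := by
      have : 15 / 2 * V * L / n < 3 * V * (5 / 4 * t) := by
        calc 15 / 2 * V * L / n < x := hbig
          _ = 3 * V * y := by rw [hy]; field_simp
          _ ≤ _ := by gcongr
      have e : 15 / 2 * V * L / n = (15 / 4 * V) * (2 * L / n) := by ring
      rw [e] at this
      have e2 : 3 * V * (5 / 4 * t) = (15 / 4 * V) * t := by ring
      rw [e2] at this
      exact lt_of_mul_lt_mul_left this (by positivity)
    have h2 : (5 / 4 : ℝ) ^ (i₀ + 1) ≤ n := by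
      have h3 : (4 / 5 : ℝ) ^ (i₀ + 1) * (5 / 4 : ℝ) ^ (i₀ + 1) = 1 := by
        rw [← mul_pow]; norm_num
      have h4 : 1 / n ≤ (4 / 5 : ℝ) ^ (i₀ + 1) := by
        have : 1 / n ≤ 2 * L / n := by gcongr; linarith
        have : t ≤ (4 / 5 : ℝ) ^ (i₀ + 1) := by rw [ht]; linarith
        linarith
      have h5 : (0 : ℝ) < (5 / 4 : ℝ) ^ (i₀ + 1) := by positivity
      rw [div_le_iff₀ hn0] at h4
      nlinarith
    have h3 := Real.log_le_log (by positivity) h2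
    rw [Real.log_pow] at h3
    have h4 : (1 / 5 : ℝ) ≤ Real.log (5 / 4) := by
      have := Real.one_sub_inv_le_log_of_pos (x := (5 / 4 : ℝ)) (by norm_num)
      norm_num at this ⊢
      linarith
    have h5 : ((i₀ + 1 : ℕ) : ℝ) * (1 / 5) ≤ ((i₀ + 1 : ℕ) : ℝ) * Real.log (5 / 4) := by gcongr
    linarith
  have hb := h (i₀ + 1) hi
  rw [← ht] at hb
  calc (q - p) * u ≤ |q - p| * x := hqx
    _ ≤ (2 * L / (t * n) + 3 / 5 * t * p) * x := by gcongr
    _ = 2 * L * x / n * (1 / t) + 3 / 5 * p * x * t := by field_simp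
    _ ≤ 2 * L * x / n * (5 / 4 / y) + 3 / 5 * p * x * y := by
        gcongr ?_ + ?_
        · refine mul_le_mul_of_nonneg_left ?_ (by positivity)
          rw [div_le_div_iff₀ ht0 hy0]; linarith
        · gcongr
    _ = _ := by rw [hy]; field_simp; ring

theorem grid_mem_range {n K H k m : ℕ} (hn : n ≠ 0) (hnk : n ≤ k * H) (hk : k ≤ K)
    (hm : (m : ℝ) ≤ Real.log n + 1) : m ∈ Finset.range (K * H + 1) := by
  have h1 : Real.log n ≤ n - 1 :=
    Real.log_le_sub_one_of_pos (by exact_mod_cast Nat.pos_of_ne_zero hn)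
  have h2 : m ≤ n := by
    have : (m : ℝ) ≤ n := by linarith
    exact_mod_cast this
  have h3 : k * H ≤ K * H := Nat.mul_le_mul_right H hk
  rw [Finset.mem_range]
  omega

section

variable {S A : Type*} [Fintype S] {M : MDP S A} {δ : ℝ}

variable [Fintype A]

/-- The grid index satisfies `m + 1 ≤ 2 + log n ≤ log(e² k H)`: this is the source of the iterated
logarithm and of the factor `e²` in `ell₂`. -/
theorem log_grid_le_ell₂ {k : ℕ} (hk : 1 ≤ k) {n : ℝ} (hn : 1 ≤ n) (hnk : n ≤ k * M.H) {m : ℕ}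
    (hm : (m : ℝ) ≤ Real.log n + 1) (hB : 0 < baseFactor M δ) :
    Real.log (baseFactor M δ * ((m : ℝ) + 1) ^ 2) ≤ ell₂ M k δ := by
  rw [ell₂_eq, log_exp_two_mul M hk]
  have := Real.log_le_log (by linarith) hnk
  refine Real.log_le_log (by positivity) (mul_le_mul_of_nonneg_left ?_ hB.le)
  exact pow_le_pow_left₀ (by positivity) (by linarith) 2

theorem log_grid_pos [Nonempty S] [Nonempty A] (hδ : δ ∈ Set.Ioc (0 : ℝ) 1) (m : ℕ) :
    0 < Real.log (baseFactor M δ * ((m : ℝ) + 1) ^ 2) := by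
  have hB := baseFactor_ge_32 M hδ
  refine Real.log_pos ?_
  have : (1 : ℝ) ≤ ((m : ℝ) + 1) ^ 2 := one_le_pow₀ (by linarith [Nat.cast_nonneg (α := ℝ) m])
  nlinarith

/-- A union bound over steps, states, actions and a grid. -/
theorem failsLE_grid [Nonempty S] [Nonempty A] {Ω : Type*} [MeasurableSpace Ω]
    {μ : Measure Ω} (hδ : δ ∈ Set.Ioc (0 : ℝ) 1) (n : ℕ) {P : ℕ → S → A → ℕ → Ω → Prop}
    (h : ∀ j ∈ Finset.Icc 1 M.H, ∀ s a, ∀ m ∈ Finset.range n,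
      FailsLE μ (2 * Real.exp (-Real.log (baseFactor M δ * ((m : ℝ) + 1) ^ 2))) (P j s a m)) :
    FailsLE μ (δ / 8) fun ω => ∀ j ∈ Finset.Icc 1 M.H, ∀ s a, ∀ m ∈ Finset.range n,
      P j s a m ω := by
  have hHSA := one_le_HSA M
  have hδ0 := hδ.1
  -- There are `HSA` triples, each with weight `2δ/(32HSA)`, which makes `δ/16`; summing the weights
  -- `1/(m+1)²` over the grid costs another factor `2`.
  refine (FailsLE.family (Finset.Icc 1 M.H ×ˢ (Finset.univ : Finset (S × A))) n
    (P := fun i m ω => P i.1 i.2.1 i.2.2 m ω)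
    (c := 2 * (δ / (32 * (M.H * Fintype.card S * Fintype.card A)))) (C := δ / 16)
    (by positivity) ?_ ?_).mono (by linarith) ?_
  · rw [Finset.card_product, Finset.card_univ, Fintype.card_prod, Nat.card_Icc,
      Nat.add_sub_cancel]
    push_cast
    obtain ⟨h1, h2, h3⟩ := card_factor_ge_one M
    have : (0 : ℝ) < M.H := by linarith
    refine le_of_eq ?_
    field_simp
    norm_num
  · rintro ⟨j, s, a⟩ hi m hm
    refine (h j (Finset.mem_product.1 hi).1 s a m hm).mono (le_of_eq ?_) fun _ h => h
    rw [exp_neg_log_baseFactor M hδ _ (by positivity)]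
    ring
  · intro ω hω j hj s a m hm
    exact hω (j, s, a) (Finset.mem_product.2 ⟨hj, Finset.mem_univ _⟩) m hm

end

section

variable {S A Ω : Type*} [Fintype S] [DecidableEq S] {M : MDP S A}

/-- Degenerate case in which dividing by `WdiffStar` is meaningless: the slack is constant in the
state and has no empirical error. -/
theorem slackShape_eq_of_WdiffStar_eq_zero [Nonempty S] {σ : ℕ → S → A → ℝ} {W w : ℕ → S → ℝ}
    (hW : M.IsMaxProxy σ W w) (h0 : M.WdiffStar σ = 0)
    {h : ℕ} (h1 : 1 ≤ h) (h2 : h ≤ M.H + 1) :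
    ∃ c, ∀ s', slackShape (M.WdiffStar σ) W w h s' = c := by
  obtain ⟨lo, hlo⟩ := exists_slackShape_mem_Icc hW h1 h2
  refine ⟨lo, fun s' => le_antisymm ?_ (hlo s').1⟩
  simpa [h0] using (hlo s').2

theorem Run.devP_const_eq_zero [DecidableEq A] {D : Run S A Ω} {k : ℕ} {ω : Ω} {s : S} {a : A}
    (hN : D.N M.H k ω s a ≠ 0) {g : S → ℝ} {c : ℝ} (hg : ∀ s', g s' = c) :
    D.devP M k ω g s a = 0 := by
  have : g = fun _ => c := funext hg
  rw [Run.devP, this, M.avg_const, ← Finset.sum_mul, D.sum_PHat M.H k s a hN]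
  ring

end

namespace Run.IsRunOf

variable {S A Ω : Type*} [Fintype S] [DecidableEq S] [Nonempty S] [Fintype A] [DecidableEq A]
  [Nonempty A] [m₀ : MeasurableSpace Ω]
  {μ : Measure Ω} [IsProbabilityMeasure μ] {M : MDP S A} {D : Run S A Ω}
  {σ : ℕ → S → A → ℝ} {Vα Vmax : ℝ} {δ : ℝ} {W w : ℕ → S → ℝ}

/-- This is the bound for bonuses of the form `c₁/N`. The weight `1/i²` of the `i`-th parameter is
the factor `i²` inside `ell₁`. -/
theorem failsLE_dev_linear (hD : D.IsRunOf M μ) (hsub : SubExponentialReturns D M μ σ Vα)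
    (hδ : δ ∈ Set.Ioc (0 : ℝ) 1) {lam : ℕ → ℝ} (hlam : ∀ i ≥ 1, 0 < lam i)
    (hlamV : ∀ i ≥ 1, lam i * Vα ≤ 1) (n K : ℕ) :
    FailsLE μ (δ / 8) fun ω => ∀ i ∈ Finset.Icc 1 n, ∀ j ∈ Finset.Icc 1 M.H, ∀ s a,
      ∀ k ∈ Finset.Icc 1 K, D.N M.H k ω s a ≠ 0 → |D.dev M k ω j s a|
        ≤ ell₁ M i δ / (lam i * D.N M.H k ω s a) + σ j s a ^ 2 * lam i / 2 := by
  refine (failsLE_grid (M := M) hδ n (P := fun j s a m ω => ∀ k ∈ Finset.Icc 1 K,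
    D.N M.H k ω s a ≠ 0 → |D.dev M k ω j s a|
        ≤ ell₁ M (m + 1) δ / (lam (m + 1) * D.N M.H k ω s a) + σ j s a ^ 2 * lam (m + 1) / 2)
    ?_).mono le_rfl ?_
  · intro j hj s a m _
    have := hD.failsLE_dev hsub hj s a (hlam (m + 1) (by omega)) (hlamV (m + 1) (by omega))
      (ell₁ M (m + 1) δ) K
    rw [ell₁_eq] at this ⊢
    push_cast at this ⊢
    exact this
  · intro ω hω i hi j hj s a
    rw [Finset.mem_Icc] at hi
    have := hω j hj s a (i - 1) (by rw [Finset.mem_range]; omega)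
    rwa [Nat.sub_add_cancel hi.1] at this

/-- This is the bound for bonuses of the form `c₂/√N`: peel over the count and choose the nearly
optimal parameter. The parameter must satisfy `t Vα ≤ 1`; as `sigmaMax² ≥ 2 Vα Vmax`, this follows
from the restriction to square-root bounds below `Vmax`. -/
theorem failsLE_dev_sqrt (hD : D.IsRunOf M μ) (hσ : ∀ h s a, 0 ≤ σ h s a) (hVα : 0 ≤ Vα)
    (hVmax : 0 ≤ Vmax) (hsub : SubExponentialReturns D M μ σ Vα)
    (hδ : δ ∈ Set.Ioc (0 : ℝ) 1) (K : ℕ) :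
    FailsLE μ (δ / 8) fun ω => ∀ j ∈ Finset.Icc 1 M.H, ∀ s a, ∀ k ∈ Finset.Icc 1 K,
      D.N M.H k ω s a ≠ 0 →
      M.sigmaMax σ Vα Vmax * √(ell₂ M k δ / D.N M.H k ω s a) < Vmax →
      |D.dev M k ω j s a| ≤ M.sigmaMax σ Vα Vmax * √(ell₂ M k δ / D.N M.H k ω s a) := by
  set sm := M.sigmaMax σ Vα Vmax with hsm
  have hsm0 : 0 ≤ sm := (Real.sqrt_nonneg _).trans (le_max_right _ _)
  have hσsm : ∀ j ∈ Finset.Icc 1 M.H, ∀ s a, 2 * σ j s a ≤ sm := fun j hj s a =>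
    M.two_mul_le_sigmaMax σ Vα Vmax (Finset.mem_Icc.1 hj).1 (Finset.mem_Icc.1 hj).2 s a
  have hsmV : 2 * Vα * Vmax ≤ sm ^ 2 := by
    have h1 : √(2 * Vα * Vmax) ≤ sm := le_max_right _ _
    calc 2 * Vα * Vmax = √(2 * Vα * Vmax) ^ 2 := (Real.sq_sqrt (by positivity)).symm
      _ ≤ sm ^ 2 := pow_le_pow_left₀ (Real.sqrt_nonneg _) h1 2
  have hB := baseFactor_ge_32 M hδ
  -- If `sigmaMax` vanishes there is no scale to peel with, but all variance proxies vanish and the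
  -- returns are almost surely exact.
  rcases hsm0.eq_or_lt with h0 | hpos
  · have hσ0 : ∀ j ∈ Finset.Icc 1 M.H, ∀ s a, σ j s a = 0 := fun j hj s a =>
      le_antisymm (by linarith [hσsm j hj s a]) (hσ j s a)
    have hae : ∀ᵐ ω ∂μ, ∀ j ∈ Finset.Icc 1 M.H, ∀ i ∈ Finset.Ico 1 K, ∀ h ∈ Finset.Icc 1 M.H,
        D.R i h ω + M.Vstar (j + 1) (D.s i (h + 1) ω) - M.Qstar j (D.s i h ω) (D.a i h ω) = 0 := by
      refine (Finset.eventually_all _).2 fun j hj => (Finset.eventually_all _).2 fun i hi =>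
        (Finset.eventually_all _).2 fun h hh => ?_
      exact hD.ae_return_eq hVα hsub hj (hσ0 j hj) (Finset.mem_Ico.1 hi).1 hh
    refine FailsLE.of_ae (hae.mono fun ω hω j hj s a k hk hN _ => ?_)
    have h1 := D.visitSum_return_eq M k j s a hN 1 0
    have h2 : D.visitSum M.H k s a (fun i h ω =>
        1 * (D.R i h ω + M.Vstar (j + 1) (D.s i (h + 1) ω) - M.Qstar j s a) - 0) ω = 0 := by
      refine Finset.sum_eq_zero fun i hi => Finset.sum_eq_zero fun h hh => ?_
      split_ifs with hv
      · have := hω j hj i (by rw [Finset.mem_Ico] at hi ⊢; rw [Finset.mem_Icc] at hk; omega) h hh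
        rw [hv.1, hv.2] at this
        linarith
      · rfl
    rw [h2] at h1
    have hN' : (D.N M.H k ω s a : ℝ) ≠ 0 := by exact_mod_cast hN
    have h3 : D.dev M k ω j s a = 0 := by
      rcases mul_eq_zero.1 h1.symm with h | h
      · exact absurd h hN'
      · linarith
    rw [h3, ← h0]
    simp
  refine (failsLE_grid (M := M) hδ (K * M.H + 1)
    (P := fun j s a m ω => 2 * √(Real.log (baseFactor M δ * ((m : ℝ) + 1) ^ 2))
        / (sm * Real.exp (m / 2)) * Vα ≤ 1 → ∀ k ∈ Finset.Icc 1 K,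
      D.N M.H k ω s a ≠ 0 → |D.dev M k ω j s a|
        ≤ Real.log (baseFactor M δ * ((m : ℝ) + 1) ^ 2)
          / (2 * √(Real.log (baseFactor M δ * ((m : ℝ) + 1) ^ 2))
            / (sm * Real.exp (m / 2)) * D.N M.H k ω s a)
        + σ j s a ^ 2 * (2 * √(Real.log (baseFactor M δ * ((m : ℝ) + 1) ^ 2))
            / (sm * Real.exp (m / 2))) / 2)
    ?_).mono le_rfl ?_
  · intro j hj s a m _
    -- Grid parameters beyond the sub-exponential range carry no claim.
    by_cases hf : 2 * √(Real.log (baseFactor M δ * ((m : ℝ) + 1) ^ 2))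
        / (sm * Real.exp (m / 2)) * Vα ≤ 1
    · have ht : 0 < 2 * √(Real.log (baseFactor M δ * ((m : ℝ) + 1) ^ 2))
          / (sm * Real.exp (m / 2)) := by
        have := Real.sqrt_pos.2 (log_grid_pos (M := M) hδ m)
        positivity
      exact (hD.failsLE_dev hsub hj s a ht hf _ K).mono le_rfl fun ω h _ => h
    · exact FailsLE.of_ae (Filter.Eventually.of_forall fun ω h => absurd h hf)
  · intro ω hω j hj s a k hk hN hcap
    rw [Finset.mem_Icc] at hk
    have hNk : D.N M.H k ω s a ≤ k * M.H :=
      (D.N_le M.H k ω s a).trans (Nat.mul_le_mul_right _ (by omega))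
    have hn1 : (1 : ℝ) ≤ D.N M.H k ω s a := by exact_mod_cast Nat.one_le_iff_ne_zero.2 hN
    set n : ℝ := (D.N M.H k ω s a : ℝ) with hn
    have hnk : n ≤ k * M.H := by rw [hn]; exact_mod_cast hNk
    obtain ⟨m, hm, hpeel⟩ := exists_peeling hpos hn1
    obtain ⟨h1, h2⟩ := hpeel _ (ell₂ M k δ) (σ j s a ^ 2) (log_grid_pos (M := M) hδ m)
      (log_grid_le_ell₂ hk.1 hn1 hnk hm (by linarith)) (by
        nlinarith [hσsm j hj s a, hσ j s a])
    refine le_trans (hω j hj s a m (grid_mem_range hN hNk hk.2 hm) ?_ k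
      (Finset.mem_Icc.2 hk) hN) h2
    refine (mul_le_mul_of_nonneg_right h1 hVα).trans ?_
    set e := √(ell₂ M k δ / n) with he
    have he0 : 0 ≤ e := Real.sqrt_nonneg _
    rw [div_mul_eq_mul_div, div_le_one hpos]
    have hVpos : 0 < Vmax := lt_of_le_of_lt (by positivity) hcap
    have h3 : 2 * e * Vα * Vmax ≤ sm * Vmax := by
      calc 2 * e * Vα * Vmax = e * (2 * Vα * Vmax) := by ring
        _ ≤ e * sm ^ 2 := by gcongr
        _ = sm * (sm * e) := by ring
        _ ≤ sm * Vmax := by gcongr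
    exact le_of_mul_le_mul_right h3 hVpos

/-- Bernstein at `t = 1/(13 W_diff)`, with the `9/8`-Lipschitz bound for the variance. The number
`13` is the least integer with `3/5 · (9/8)² / 13 ≤ 1/16`, so that the variance term is within what
the slack pays. -/
theorem failsLE_devP_linear (hD : D.IsRunOf M μ) (hW : M.IsMaxProxy σ W w)
    (hδ : δ ∈ Set.Ioc (0 : ℝ) 1) (K : ℕ) :
    FailsLE μ (δ / 8) fun ω => ∀ j ∈ Finset.Icc 1 M.H, ∀ s a, ∀ k ∈ Finset.Icc 1 K,
      D.N M.H k ω s a ≠ 0 → |D.devP M k ω (slackShape (M.WdiffStar σ) W w (j + 1)) s a|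
        ≤ 13 * M.WdiffStar σ * ell₁ M 1 δ / D.N M.H k ω s a
          + 1 / 16 / M.WdiffStar σ * M.var s a (w (j + 1)) := by
  rcases hW.WdiffStar_nonneg.eq_or_lt with h0 | hpos
  · refine FailsLE.of_ae (Filter.Eventually.of_forall fun ω j hj s a k hk hN => ?_)
    rw [Finset.mem_Icc] at hj
    obtain ⟨c, hc⟩ := slackShape_eq_of_WdiffStar_eq_zero hW h0.symm (h := j + 1) (by omega)
      (by omega)
    rw [devP_const_eq_zero hN hc, ← h0]
    simp
  set d := M.WdiffStar σ with hd
  refine (failsLE_grid (M := M) hδ 1 (P := fun j s a _ ω => ∀ k ∈ Finset.Icc 1 K,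
    D.N M.H k ω s a ≠ 0 → |D.devP M k ω (slackShape d W w (j + 1)) s a|
        ≤ 13 * d * ell₁ M 1 δ / D.N M.H k ω s a
          + 1 / 16 / d * M.var s a (w (j + 1))) ?_).mono le_rfl
    fun ω hω j hj s a => hω j hj s a 0 (by simp)
  intro j hj s a m hm
  rw [Finset.mem_Icc] at hj
  obtain rfl : m = 0 := by simpa using hm
  obtain ⟨lo, hlo⟩ := exists_slackShape_mem_Icc hW (h := j + 1) (by omega) (by omega)
  rw [← hd] at hlo
  set f := slackShape d W w (j + 1) with hf
  have hav1 := M.le_avg s a fun s' => (hlo s').1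
  have hav2 := M.avg_le s a fun s' => (hlo s').2
  have hsm : ∀ s', |f s' - M.avg s a f| ≤ 9 / 8 * d := fun s' => by
    have := hlo s'
    rw [abs_le]; constructor <;> linarith [this.1, this.2]
  have ht : 0 < 1 / (13 * d) := by positivity
  have hsm2 : ∀ u : ℝ, |u| = 1 / (13 * d) → ∀ s', |u * (f s' - M.avg s a f)| ≤ 5 / 12 := by
    intro u hu s'
    rw [abs_mul, hu]
    calc 1 / (13 * d) * |f s' - M.avg s a f| ≤ 1 / (13 * d) * (9 / 8 * d) := by
          gcongr; exact hsm s'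
      _ ≤ 5 / 12 := by field_simp; norm_num
  have h1 := M.avg_exp_le_one_of_small s a f (1 / (13 * d)) (hsm2 _ (abs_of_pos ht))
  have h2 := M.avg_exp_le_one_of_small s a f (-(1 / (13 * d)))
    (hsm2 _ (by rw [abs_neg, abs_of_pos ht]))
  rw [neg_sq] at h2
  refine (hD.failsLE_devP s a ht h1 h2 (ell₁ M 1 δ) K).mono (le_of_eq ?_) ?_
  · rw [ell₁_eq]; norm_num
  · intro ω hω k hk hN
    refine (hω k hk hN).trans ?_
    have hN' : (0 : ℝ) < D.N M.H k ω s a := by exact_mod_cast Nat.pos_of_ne_zero hN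
    have hvar := M.var_le_of_lipschitz s a (f := f) (g := w (j + 1)) (c := 9 / 8) fun x y => by
      have := abs_slackShape_sub_le hW (h := j + 1) (by omega) (by omega) x y
      rwa [← hd, ← hf] at this
    refine add_le_add (le_of_eq ?_) ?_
    · field_simp
    · have e : 3 / 5 * (1 / (13 * d)) ^ 2 * M.var s a f / (1 / (13 * d))
          = 3 / 65 / d * M.var s a f := by field_simp; norm_num; ring
      rw [e]
      calc 3 / 65 / d * M.var s a f ≤ 3 / 65 / d * ((9 / 8) ^ 2 * M.var s a (w (j + 1))) := by
            gcongr
        _ = (3 / 65 * (9 / 8) ^ 2) / d * M.var s a (w (j + 1)) := by ring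
        _ ≤ 1 / 16 / d * M.var s a (w (j + 1)) := by
            have := M.var_nonneg s a (w (j + 1))
            gcongr
            norm_num

/-- Hoeffding with range `9/8 W_diff`, peeled over the count. The scale `3/2 W_diff` leaves room,
since peeling only needs the variance proxy, a quarter of the squared range, to be at most a quarter
of the squared scale. -/
theorem failsLE_devP_sqrt (hD : D.IsRunOf M μ) (hW : M.IsMaxProxy σ W w)
    (hδ : δ ∈ Set.Ioc (0 : ℝ) 1) (K : ℕ) :
    FailsLE μ (δ / 8) fun ω => ∀ j ∈ Finset.Icc 1 M.H, ∀ s a, ∀ k ∈ Finset.Icc 1 K,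
      D.N M.H k ω s a ≠ 0 → |D.devP M k ω (slackShape (M.WdiffStar σ) W w (j + 1)) s a|
        ≤ 3 / 2 * M.WdiffStar σ * √(ell₂ M k δ / D.N M.H k ω s a) := by
  rcases hW.WdiffStar_nonneg.eq_or_lt with h0 | hpos
  · refine FailsLE.of_ae (Filter.Eventually.of_forall fun ω j hj s a k hk hN => ?_)
    rw [Finset.mem_Icc] at hj
    obtain ⟨c, hc⟩ := slackShape_eq_of_WdiffStar_eq_zero hW h0.symm (h := j + 1) (by omega)
      (by omega)
    rw [devP_const_eq_zero hN hc, ← h0]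
    simp
  set d := M.WdiffStar σ with hd
  have hB := baseFactor_ge_32 M hδ
  refine (failsLE_grid (M := M) hδ (K * M.H + 1)
    (P := fun j s a m ω => ∀ k ∈ Finset.Icc 1 K, D.N M.H k ω s a ≠ 0 →
      |D.devP M k ω (slackShape d W w (j + 1)) s a|
        ≤ Real.log (baseFactor M δ * ((m : ℝ) + 1) ^ 2)
          / (2 * √(Real.log (baseFactor M δ * ((m : ℝ) + 1) ^ 2))
            / (3 / 2 * d * Real.exp (m / 2)) * D.N M.H k ω s a)
        + (9 / 8 * d) ^ 2 / 4 * (2 * √(Real.log (baseFactor M δ * ((m : ℝ) + 1) ^ 2))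
            / (3 / 2 * d * Real.exp (m / 2))) / 2)
    ?_).mono le_rfl ?_
  · intro j hj s a m _
    rw [Finset.mem_Icc] at hj
    obtain ⟨lo, hlo⟩ := exists_slackShape_mem_Icc hW (h := j + 1) (by omega) (by omega)
    rw [← hd] at hlo
    set f := slackShape d W w (j + 1) with hf
    set t := 2 * √(Real.log (baseFactor M δ * ((m : ℝ) + 1) ^ 2))
            / (3 / 2 * d * Real.exp (m / 2)) with htdef
    have ht : 0 < t := by
      have := Real.sqrt_pos.2 (log_grid_pos (M := M) hδ m)
      positivity
    have h1 := M.avg_exp_le_one_of_range s a f t lo (9 / 8 * d) (by positivity) hlo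
    have h2 := M.avg_exp_le_one_of_range s a f (-t) lo (9 / 8 * d) (by positivity) hlo
    rw [neg_sq] at h2
    refine (hD.failsLE_devP s a ht h1 h2 _ K).mono le_rfl ?_
    intro ω hω k hk hN
    refine (hω k hk hN).trans (le_of_eq ?_)
    congr 1
    field_simp
    norm_num
  · intro ω hω j hj s a k hk hN
    rw [Finset.mem_Icc] at hk
    have hNk : D.N M.H k ω s a ≤ k * M.H :=
      (D.N_le M.H k ω s a).trans (Nat.mul_le_mul_right _ (by omega))
    have hn1 : (1 : ℝ) ≤ D.N M.H k ω s a := by exact_mod_cast Nat.one_le_iff_ne_zero.2 hN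
    obtain ⟨m, hm, hpeel⟩ := exists_peeling (s := 3 / 2 * d) (by positivity) hn1
    have hnk : (D.N M.H k ω s a : ℝ) ≤ k * M.H := by exact_mod_cast hNk
    obtain ⟨-, h2⟩ := hpeel _ (ell₂ M k δ) ((9 / 8 * d) ^ 2 / 4) (log_grid_pos (M := M) hδ m)
      (log_grid_le_ell₂ hk.1 hn1 hnk hm (by linarith)) (by nlinarith [sq_nonneg d])
    exact le_trans (hω j hj s a m (grid_mem_range hN hNk hk.2 hm) k (Finset.mem_Icc.2 hk) hN) h2

/-- Uniformity over `U` comes from controlling each coordinate of the empirical kernel on a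
geometric grid of parameters; for given `U` each coordinate then selects its own parameter. Summing
over next states turns the quadratic terms into the variance and costs a factor `S` in the
remainder. -/
theorem failsLE_devP_all (hD : D.IsRunOf M μ) (hδ : δ ∈ Set.Ioc (0 : ℝ) 1) (hVmax : 0 < Vmax)
    (K : ℕ) :
    FailsLE μ (δ / 32) fun ω => ∀ s a, ∀ k ∈ Finset.Icc 1 K, D.N M.H k ω s a ≠ 0 →
      ∀ U : S → ℝ, (∀ s', 0 ≤ U s') → (∀ s', U s' ≤ 5 / 4 * Vmax) →
        ∑ s', D.PHat M.H k ω s a s' * U s' - M.avg s a U ≤ M.var s a U / (5 * Vmax)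
          + 15 / 2 * Fintype.card S * Vmax * ell₂ M k δ / D.N M.H k ω s a := by
  obtain ⟨hH1, hS1, hA1⟩ := card_factor_ge_one M
  have hδ0 := hδ.1
  -- There are `S²A` coordinates with weight `2/C` each, hence `δ/64`, and the sum over the grid
  -- doubles this.
  set C : ℝ := 128 * Fintype.card S ^ 2 * Fintype.card A / δ with hCdef
  have hC0 : 0 < C := by positivity
  set n := ⌈5 * Real.log (Real.exp 2 * K * M.H)⌉₊ with hn
  refine (FailsLE.family (Finset.univ : Finset (S × A × S)) n
    (P := fun i m ω => ∀ k ∈ Finset.Icc 1 K, D.N M.H k ω i.1 i.2.1 ≠ 0 →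
      |D.PHat M.H k ω i.1 i.2.1 i.2.2 - M.P i.1 i.2.1 i.2.2|
        ≤ Real.log (C * ((m : ℝ) + 1) ^ 2) / (5 / 12 * (4 / 5) ^ m * D.N M.H k ω i.1 i.2.1)
          + 3 / 5 * (5 / 12 * (4 / 5) ^ m) * M.P i.1 i.2.1 i.2.2)
    (c := 2 / C) (C := δ / 64) (by positivity) ?_ ?_).mono (by linarith) ?_
  · rw [Finset.card_univ, Fintype.card_prod, Fintype.card_prod]
    push_cast
    refine le_of_eq ?_
    rw [hCdef]
    field_simp
    norm_num
  · rintro ⟨s, a, s₁⟩ - m -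
    set g : S → ℝ := fun s' => if s' = s₁ then 1 else 0 with hg
    have havg : M.avg s a g = M.P s a s₁ := by simp [MDP.avg, hg]
    have hg01 : ∀ s', 0 ≤ g s' ∧ g s' ≤ 1 := fun s' => by
      simp only [hg]; split_ifs <;> simp
    have ha0 := M.le_avg s a fun s' => (hg01 s').1
    have ha1 := M.avg_le s a fun s' => (hg01 s').2
    have hvar : M.var s a g ≤ M.P s a s₁ := by
      have : (fun s' => g s' ^ 2) = g := by
        funext s'; simp only [hg]; split_ifs <;> simp
      rw [M.var_eq, this, havg]
      nlinarith [sq_nonneg (M.P s a s₁)]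
    set t : ℝ := 5 / 12 * (4 / 5) ^ m with ht
    have ht0 : 0 < t := by positivity
    have ht1 : t ≤ 5 / 12 := by
      have : (4 / 5 : ℝ) ^ m ≤ 1 := pow_le_one₀ (by norm_num) (by norm_num)
      rw [ht]; linarith
    have hsm : ∀ u : ℝ, |u| = t → ∀ s', |u * (g s' - M.avg s a g)| ≤ 5 / 12 := by
      intro u hu s'
      rw [abs_mul, hu]
      have : |g s' - M.avg s a g| ≤ 1 := by
        rw [abs_le]; constructor <;> linarith [(hg01 s').1, (hg01 s').2]
      nlinarith
    have h1 := M.avg_exp_le_one_of_small s a g t (hsm t (abs_of_pos ht0))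
    have h2 := M.avg_exp_le_one_of_small s a g (-t) (hsm (-t) (by rw [abs_neg, abs_of_pos ht0]))
    rw [neg_sq] at h2
    refine (hD.failsLE_devP s a ht0 h1 h2 (Real.log (C * ((m : ℝ) + 1) ^ 2)) K).mono
      (le_of_eq ?_) ?_
    · rw [Real.exp_neg, Real.exp_log (by positivity)]
      field_simp
    · intro ω hω k hk hN
      have hdev : D.devP M k ω g s a = D.PHat M.H k ω s a s₁ - M.P s a s₁ := by
        rw [devP, havg]; simp [hg]
      rw [← hdev]
      refine (hω k hk hN).trans (add_le_add le_rfl ?_)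
      have e : 3 / 5 * t ^ 2 * M.var s a g / t = 3 / 5 * t * M.var s a g := by
        field_simp
      rw [e]
      gcongr
  · intro ω hω s a k hk hN U hU0 hU1
    have hk' := hk
    rw [Finset.mem_Icc] at hk'
    have hNk : D.N M.H k ω s a ≤ k * M.H :=
      (D.N_le M.H k ω s a).trans (Nat.mul_le_mul_right _ (by omega))
    have hn1 : (1 : ℝ) ≤ D.N M.H k ω s a := by exact_mod_cast Nat.one_le_iff_ne_zero.2 hN
    have hnk : (D.N M.H k ω s a : ℝ) ≤ k * M.H := by exact_mod_cast hNk
    have hsumq := D.sum_PHat M.H k s a hN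
    have hL2 := ell₂_ge M hδ hk'.1
    have hbar : ∀ s', |U s' - M.avg s a U| ≤ 5 / 4 * Vmax := fun s' => by
      have h1 := M.le_avg s a hU0
      have h2 := M.avg_le s a hU1
      rw [abs_le]; constructor <;> linarith [hU0 s', hU1 s']
    have hterm : ∀ s', (D.PHat M.H k ω s a s' - M.P s a s') * (U s' - M.avg s a U)
        ≤ M.P s a s' * (U s' - M.avg s a U) ^ 2 / (5 * Vmax)
          + 15 / 2 * Vmax * ell₂ M k δ / D.N M.H k ω s a := by
      intro s'
      have hq0 := D.PHat_nonneg M.H k ω s a s'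
      have hp0 := M.P_nonneg s a s'
      have hq1 : D.PHat M.H k ω s a s' ≤ 1 := by
        rw [← hsumq]
        exact Finset.single_le_sum (f := fun s' => D.PHat M.H k ω s a s')
          (fun i _ => D.PHat_nonneg M.H k ω s a i) (Finset.mem_univ s')
      have hp1 : M.P s a s' ≤ 1 := by
        rw [← M.P_sum s a]
        exact Finset.single_le_sum (f := fun s' => M.P s a s')
          (fun i _ => M.P_nonneg s a i) (Finset.mem_univ s')
      refine le_rpow_grid_aux (T := Real.log (k * M.H)) hVmax hp0
        (by rw [abs_le]; constructor <;> linarith) (hbar s') hn1 hL2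
        (Real.log_le_log (by linarith) hnk) ?_
      intro i hi
      rw [← log_exp_two_mul M hk'.1] at hi
      have hlogk := two_le_log M hk'.1
      have hHp : (0 : ℝ) < M.H := by linarith
      have hkp : (0 : ℝ) < k := by exact_mod_cast hk'.1
      have hkK : Real.log (Real.exp 2 * k * M.H) ≤ Real.log (Real.exp 2 * K * M.H) := by
        apply Real.log_le_log (by positivity)
        have : (k : ℝ) ≤ K := by exact_mod_cast hk'.2
        gcongr
      have him : i ∈ Finset.range n := by
        rw [Finset.mem_range, hn, Nat.lt_ceil]
        linarith
      refine (hω (s, a, s') (Finset.mem_univ _) i him k hk hN).trans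
        (add_le_add (div_le_div_of_nonneg_right ?_ (by positivity)) le_rfl)
      -- The grid is longer than the one behind `ell₂` and the union is over more objects, but
      -- squaring the argument of the logarithm absorbs both: `(i + 1)² ≤ 25 log²`, and `128 · 25 ≤
      -- 1024 · 4`.
      have e : 2 * ell₂ M k δ = Real.log ((baseFactor M δ
          * Real.log (Real.exp 2 * k * M.H) ^ 2) ^ 2) := by
        rw [Real.log_pow, ell₂_eq]; norm_num
      rw [e]
      apply Real.log_le_log (by positivity)
      set Lg := Real.log (Real.exp 2 * k * M.H) with hLg
      have hB : baseFactor M δ ^ 2 = 1024 * (M.H ^ 2 * Fintype.card A) * (Fintype.card S ^ 2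
          * Fintype.card A / δ) / δ := by
        rw [baseFactor]; field_simp; norm_num
      have h1 : ((i : ℝ) + 1) ^ 2 ≤ 25 * Lg ^ 2 := by
        have : (0 : ℝ) ≤ i := Nat.cast_nonneg i
        nlinarith
      have h2 : (4 : ℝ) ≤ Lg ^ 2 := by nlinarith
      set Z : ℝ := Fintype.card S ^ 2 * Fintype.card A / δ with hZ
      have hZ0 : 0 < Z := by positivity
      have hCZ : C = 128 * Z := by rw [hCdef, hZ]; ring
      have h3 : 1024 * Z ≤ baseFactor M δ ^ 2 := by
        rw [hB, le_div_iff₀ hδ0]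
        have h4 : (1 : ℝ) ≤ M.H ^ 2 * Fintype.card A :=
          one_le_mul_of_one_le_of_one_le (one_le_pow₀ hH1) hA1
        have h5 : 1024 * Z * δ ≤ 1024 * Z := mul_le_of_le_one_right (by positivity) hδ.2
        nlinarith
      rw [hCZ, mul_pow]
      calc 128 * Z * ((i : ℝ) + 1) ^ 2 ≤ 128 * Z * (25 * Lg ^ 2) := by gcongr
        _ ≤ 1024 * Z * (Lg ^ 2 * 4) := by nlinarith [mul_pos hZ0 (by positivity : 0 < Lg ^ 2)]
        _ ≤ 1024 * Z * (Lg ^ 2 * Lg ^ 2) := by gcongr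
        _ ≤ baseFactor M δ ^ 2 * (Lg ^ 2 * Lg ^ 2) := by gcongr
        _ = _ := by ring
    -- Both kernels have total mass `1`, so `U` may be centred at its true average.
    have e1 : ∑ s', D.PHat M.H k ω s a s' * U s' - M.avg s a U
        = ∑ s', (D.PHat M.H k ω s a s' - M.P s a s') * (U s' - M.avg s a U) := by
      simp_rw [sub_mul, mul_sub, Finset.sum_sub_distrib, ← Finset.sum_mul]
      rw [hsumq, M.P_sum]
      simp only [MDP.avg]
      ring
    rw [e1]
    refine (Finset.sum_le_sum fun s' _ => hterm s').trans (le_of_eq ?_)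
    have e2 : ∑ s', M.P s a s' * (U s' - M.avg s a U) ^ 2 = M.var s a U := rfl
    rw [Finset.sum_add_distrib, ← Finset.sum_div, Finset.sum_const, Finset.card_univ, nsmul_eq_mul,
      e2]
    ring

end Run.IsRunOf

end EQO

/-! ### The plan of an episode and its slack -/

namespace EQO

theorem minMul_cases (x : ℝ) (c : ℝ≥0∞) (y : ℝ) :
    minMul x c y = x ∨ c ≠ ⊤ ∧ minMul x c y = c.toReal * y := by
  unfold minMul
  split_ifs with h
  · exact Or.inl rfl
  · rcases min_choice x (c.toReal * y) with h' | h'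
    · exact Or.inl h'
    · exact Or.inr ⟨h, h'⟩

theorem minMul_nonneg {x : ℝ} {c : ℝ≥0∞} {y : ℝ} (hx : 0 ≤ x) (hy : 0 ≤ y) : 0 ≤ minMul x c y := by
  unfold minMul
  split_ifs
  · exact hx
  · exact le_min hx (mul_nonneg ENNReal.toReal_nonneg hy)

theorem minMul_le_left (x : ℝ) (c : ℝ≥0∞) (y : ℝ) : minMul x c y ≤ x := by
  unfold minMul
  split_ifs
  · exact le_rfl
  · exact min_le_left _ _

theorem minMul_le_right {x : ℝ} {c : ℝ≥0∞} (hc : c ≠ ⊤) (y : ℝ) : minMul x c y ≤ c.toReal * y := by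
  rw [minMul, if_neg hc]
  exact min_le_right _ _

theorem le_minMul {t x : ℝ} {c : ℝ≥0∞} {y : ℝ} (hx : t ≤ x) (hy : c ≠ ⊤ → t ≤ c.toReal * y) :
    t ≤ minMul x c y := by
  unfold minMul
  split_ifs with h
  · exact hx
  · exact le_min hx (hy h)

variable {S A Ω : Type*} [DecidableEq S] [DecidableEq A]

theorem Run.bonus_nonneg (D : Run S A Ω) {c₁ : ℕ → ℝ} (c₂ : ℕ → ℝ≥0∞) (H : ℕ) {k : ℕ}
    (hc : 0 ≤ c₁ k) (ω : Ω) (s : S) (a : A) : 0 ≤ D.bonus c₁ c₂ H k ω s a :=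
  minMul_nonneg (by positivity) (by positivity)

variable [Fintype S]

/-- The planned value `V_h^k`. -/
def Run.Vest (D : Run S A Ω) (c₁ : ℕ → ℝ) (c₂ : ℕ → ℝ≥0∞) (Vmax : ℝ) (H k : ℕ) (ω : Ω)
    (h : ℕ) (s : S) : ℝ :=
  D.planV c₁ c₂ Vmax H k ω (H + 1 - h) s

theorem Run.FollowsEQOPlus.isPlan [Fintype A] [Nonempty A] {D : Run S A Ω} {M : MDP S A}
    {c₁ : ℕ → ℝ} {c₂ : ℕ → ℝ≥0∞} {Vmax : ℝ} (halg : D.FollowsEQOPlus M.H c₁ c₂ Vmax) {k : ℕ}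
    (hk : 1 ≤ k) (hc₁ : 0 < c₁ k) (ω : Ω) :
    IsPlan M (D.N M.H k ω) (D.rHat M.H k ω) (D.PHat M.H k ω) (D.bonus c₁ c₂ M.H k ω) Vmax
      (D.Vest c₁ c₂ Vmax M.H k ω) (D.π k ω) := by
  have hsup : ∀ h, 1 ≤ h → h ≤ M.H → ∀ s, D.Vest c₁ c₂ Vmax M.H k ω h s
      = ⨆ a, D.planQ c₁ c₂ Vmax M.H k ω (D.Vest c₁ c₂ Vmax M.H k ω (h + 1)) s a := by
    intro h h1 h2 s
    have e1 : M.H + 1 - h = (M.H - h) + 1 := by omega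
    have e2 : M.H + 1 - (h + 1) = M.H - h := by omega
    have e3 : D.Vest c₁ c₂ Vmax M.H k ω (h + 1) = D.planV c₁ c₂ Vmax M.H k ω (M.H - h) := by
      funext s'; rw [Run.Vest, e2]
    rw [e3, Run.Vest, e1, Run.planV]
  have hle : ∀ h, 1 ≤ h → h ≤ M.H → ∀ s a,
      D.planQ c₁ c₂ Vmax M.H k ω (D.Vest c₁ c₂ Vmax M.H k ω (h + 1)) s a
        ≤ D.Vest c₁ c₂ Vmax M.H k ω h s := by
    intro h h1 h2 s a
    rw [hsup h h1 h2]
    exact le_ciSup (f := fun a =>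
      D.planQ c₁ c₂ Vmax M.H k ω (D.Vest c₁ c₂ Vmax M.H k ω (h + 1)) s a)
      (Set.finite_range _).bddAbove a
  refine ⟨fun s => ?_, D.PHat_nonneg M.H k ω, D.bonus_nonneg c₂ M.H hc₁.le ω, hle, ?_⟩
  · simp [Run.Vest, Run.planV]
  · intro h h1 h2 s
    refine le_antisymm ?_ (hle h h1 h2 s _)
    rw [hsup h h1 h2]
    refine ciSup_le fun a => ?_
    have e2 : M.H + 1 - (h + 1) = M.H - h := by omega
    have := halg k hk h (Finset.mem_Icc.2 ⟨h1, h2⟩) ω s a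
    have e3 : D.Vest c₁ c₂ Vmax M.H k ω (h + 1) = D.planV c₁ c₂ Vmax M.H k ω (M.H - h) := by
      funext s'; rw [Run.Vest, e2]
    rw [e3]
    exact this

theorem Run.devP_const_mul (D : Run S A Ω) (M : MDP S A) (k : ℕ) (ω : Ω) (c : ℝ) (g : S → ℝ)
    (s : S) (a : A) : D.devP M k ω (fun s' => c * g s') s a = c * D.devP M k ω g s a := by
  rw [Run.devP, Run.devP, M.avg_const_mul, mul_sub, Finset.mul_sum]
  congr 1
  exact Finset.sum_congr rfl fun _ _ => by ring

/-- The deviation bounds turn `lam * slackShape` into a slack. -/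
theorem isSlack_slackShape [Nonempty S] {D : Run S A Ω} {M : MDP S A} {σ : ℕ → S → A → ℝ}
    {W w : ℕ → S → ℝ} (hW : M.IsMaxProxy σ W w) {c₁ : ℕ → ℝ} {c₂ : ℕ → ℝ≥0∞} {Vmax sm : ℝ}
    {k : ℕ} {ω : Ω} {lam l L₁ L₂ : ℝ} (hc₁ : 0 < c₁ k) (hlam : 0 < lam) (hl : 0 ≤ l)
    (hlow : l / lam + 13 * lam * M.WdiffStar σ * L₁ ≤ c₁ k) (hup : c₁ k ≤ 4 * l / lam)
    (hc₂ : ENNReal.ofReal ((sm + 6 * M.WdiffStar σ * l / c₁ k) * √L₂) ≤ c₂ k)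
    (h₁ : ∀ j ∈ Finset.Icc 1 M.H, ∀ s a, D.N M.H k ω s a ≠ 0 →
      |D.dev M k ω j s a| ≤ l / (lam * D.N M.H k ω s a) + σ j s a ^ 2 * lam / 2)
    (h₂ : ∀ j ∈ Finset.Icc 1 M.H, ∀ s a, D.N M.H k ω s a ≠ 0 →
      sm * √(L₂ / D.N M.H k ω s a) < Vmax → |D.dev M k ω j s a| ≤ sm * √(L₂ / D.N M.H k ω s a))
    (h₃ : ∀ j ∈ Finset.Icc 1 M.H, ∀ s a, D.N M.H k ω s a ≠ 0 →
      |D.devP M k ω (slackShape (M.WdiffStar σ) W w (j + 1)) s a|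
        ≤ 13 * M.WdiffStar σ * L₁ / D.N M.H k ω s a
          + 1 / 16 / M.WdiffStar σ * M.var s a (w (j + 1)))
    (h₄ : ∀ j ∈ Finset.Icc 1 M.H, ∀ s a, D.N M.H k ω s a ≠ 0 →
      |D.devP M k ω (slackShape (M.WdiffStar σ) W w (j + 1)) s a|
        ≤ 3 / 2 * M.WdiffStar σ * √(L₂ / D.N M.H k ω s a)) :
    IsSlack M (D.N M.H k ω) (D.rHat M.H k ω) (D.PHat M.H k ω) (D.bonus c₁ c₂ M.H k ω) Vmax
      (fun h s => lam * slackShape (M.WdiffStar σ) W w h s) := by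
  have hD0 := hW.WdiffStar_nonneg
  have hsup : ∀ h, 1 ≤ h → h ≤ M.H → ∀ s a,
      σ h s a ^ 2 * lam / 2 + lam * (1 / 16 / M.WdiffStar σ * M.var s a (w (h + 1)))
        ≤ lam * slackShape (M.WdiffStar σ) W w h s
          - M.avg s a (fun s' => lam * slackShape (M.WdiffStar σ) W w (h + 1) s') := by
    intro h h1 h2 s a
    have := mul_le_mul_of_nonneg_left (slackShape_superharmonic hW h1 h2 s a) hlam.le
    rw [M.avg_const_mul]
    linarith
  have hvar0 : ∀ h s a, 0 ≤ lam * (1 / 16 / M.WdiffStar σ * M.var s a (w (h + 1))) := by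
    intro h s a
    have := M.var_nonneg s a (w (h + 1))
    positivity
  have hσ0 : ∀ h s a, 0 ≤ σ h s a ^ 2 * lam / 2 := fun h s a => by positivity
  refine ⟨fun s => ?_, fun h h1 h2 s => ?_, fun h h1 h2 s a => ?_, fun h h1 h2 s a hN hb => ?_⟩
  · simp only [slackShape_succ_H hW, mul_zero]
  · exact mul_nonneg hlam.le (slackShape_nonneg hW h1 h2 s)
  · linarith [hsup h h1 h2 s a, hvar0 h s a, hσ0 h s a]
  · have hj : h ∈ Finset.Icc 1 M.H := Finset.mem_Icc.2 ⟨h1, h2⟩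
    have e : ∑ s', D.PHat M.H k ω s a s' * (lam * slackShape (M.WdiffStar σ) W w (h + 1) s')
        - M.avg s a (fun s' => lam * slackShape (M.WdiffStar σ) W w (h + 1) s')
        = lam * D.devP M k ω (slackShape (M.WdiffStar σ) W w (h + 1)) s a :=
      D.devP_const_mul M k ω lam _ s a
    rw [e]
    change |D.dev M k ω h s a - _| ≤ _
    refine (abs_sub _ _).trans ?_
    rw [abs_mul, abs_of_pos hlam]
    have hn : (0 : ℝ) < D.N M.H k ω s a := by exact_mod_cast Nat.pos_of_ne_zero hN
    have hs := hsup h h1 h2 s a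
    -- If `c₁/N` is the smaller bonus, the lower condition on `c₁` covers the `1/N` terms, and the
    -- drop of the slack pays the parts `λσ²/2` and `λ Var/(16 W_diff)`. If `c₂/√N` is smaller, it
    -- covers both square-root bounds by itself.
    rcases minMul_cases (c₁ k / (D.N M.H k ω s a : ℝ)) (c₂ k)
      (1 / √(D.N M.H k ω s a : ℝ)) with hbe | ⟨hfin, hbe⟩
    · have hbe' : D.bonus c₁ c₂ M.H k ω s a = c₁ k / (D.N M.H k ω s a : ℝ) := hbe
      rw [hbe']
      have e1 := h₁ h hj s a hN
      have e2 := mul_le_mul_of_nonneg_left (h₃ h hj s a hN) hlam.le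
      have e3 : (l / lam + 13 * lam * M.WdiffStar σ * L₁) / D.N M.H k ω s a
          ≤ c₁ k / D.N M.H k ω s a := div_le_div_of_nonneg_right hlow hn.le
      have e4 : (l / lam + 13 * lam * M.WdiffStar σ * L₁) / D.N M.H k ω s a
          = l / (lam * D.N M.H k ω s a)
            + lam * (13 * M.WdiffStar σ * L₁ / D.N M.H k ω s a) := by
        field_simp
      linarith
    · have hbe' : D.bonus c₁ c₂ M.H k ω s a = (c₂ k).toReal * (1 / √(D.N M.H k ω s a : ℝ)) := hbe
      rw [hbe'] at hb ⊢
      have hc2 : (sm + 6 * M.WdiffStar σ * l / c₁ k) * √L₂ ≤ (c₂ k).toReal :=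
        (ENNReal.ofReal_le_iff_le_toReal hfin).1 hc₂
      have hsq : √(L₂ / (D.N M.H k ω s a : ℝ)) = √L₂ * (1 / √(D.N M.H k ω s a : ℝ)) := by
        rw [Real.sqrt_div' _ hn.le]; ring
      have hble : (sm + 6 * M.WdiffStar σ * l / c₁ k) * √(L₂ / (D.N M.H k ω s a : ℝ))
          ≤ (c₂ k).toReal * (1 / √(D.N M.H k ω s a : ℝ)) := by
        rw [hsq, ← mul_assoc]
        exact mul_le_mul_of_nonneg_right hc2 (by positivity)
      set r := √(L₂ / (D.N M.H k ω s a : ℝ)) with hr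
      have hr0 : 0 ≤ r := Real.sqrt_nonneg _
      have h6 : 0 ≤ 6 * M.WdiffStar σ * l / c₁ k := by positivity
      have e1 := h₂ h hj s a hN (by nlinarith)
      have e2 := mul_le_mul_of_nonneg_left (h₄ h hj s a hN) hlam.le
      rw [← hr] at e1 e2
      -- The upper condition gives `λ ≤ 4l/c₁`, and `4 · 3/2` is the constant `6` in the threshold
      -- for `c₂`. Also the bonus below `Vmax` forces the square-root bound below `Vmax`, as
      -- required for `h₂`.
      have e3 : lam * (3 / 2 * M.WdiffStar σ * r) ≤ 6 * M.WdiffStar σ * l / c₁ k * r := by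
        have : lam ≤ 4 * l / c₁ k := by
          rw [le_div_iff₀ hc₁]
          rw [le_div_iff₀ hlam] at hup
          linarith
        calc lam * (3 / 2 * M.WdiffStar σ * r)
            ≤ 4 * l / c₁ k * (3 / 2 * M.WdiffStar σ * r) := by gcongr
          _ = _ := by ring
      linarith [hvar0 h s a, hσ0 h s a]

end EQO

/-! ### From expected to realised costs -/

namespace EQO

namespace Run

variable {S A Ω : Type*}

theorem hist_mono (D : Run S A Ω) (H k : ℕ) : Monotone (D.hist H k) := by
  intro h h' hh
  refine sup_le_sup (sup_le_sup le_rfl ?_) ?_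
  · exact biSup_mono fun i hi => by rw [Finset.mem_Icc] at hi ⊢; omega
  · exact biSup_mono fun i hi => by rw [Finset.mem_Ico] at hi ⊢; omega

theorem measurable_at_visit [Finite S] [Finite A] (D : Run S A Ω) {β : Type*}
    {mβ : MeasurableSpace β} {H k h : ℕ}
    (hh : 1 ≤ h) {g : Ω → S → A → β} (hg : ∀ s a, Measurable[D.hist H k h] fun ω => g ω s a) :
    Measurable[D.hist H k h] fun ω => g ω (D.s k h ω) (D.a k h ω) := by
  have hmem : h ∈ Finset.Icc 1 h := by rw [Finset.mem_Icc]; omega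
  refine measurable_apply_countable (g := fun ω s => g ω s (D.a k h ω))
    (D.measurable_s_hist hmem) fun s => ?_
  exact measurable_apply_countable (g := fun ω a => g ω s a) (D.measurable_a_hist hmem) (hg s)

variable [DecidableEq S] [DecidableEq A]

/-- The number of visits of `(s, a)` before step `h` of episode `k`, within that episode. -/
def inCount (D : Run S A Ω) (k h : ℕ) (ω : Ω) (s : S) (a : A) : ℕ :=
  ∑ j ∈ Finset.Ico 1 h, if D.s k j ω = s ∧ D.a k j ω = a then 1 else 0

/-- At step `h` of episode `k`, the visited pair has been visited within the episode at least as
often as before it. -/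
def Doubling (D : Run S A Ω) (H k h : ℕ) (ω : Ω) : Prop :=
  D.N H k ω (D.s k h ω) (D.a k h ω) ≤ D.inCount k h ω (D.s k h ω) (D.a k h ω)

/-- Some step before `h` of episode `k` was doubling. -/
def Stopped (D : Run S A Ω) (H k h : ℕ) (ω : Ω) : Prop := ∃ j ∈ Finset.Ico 1 h, D.Doubling H k j ω

theorem stopped_succ (D : Run S A Ω) (H k : ℕ) {h : ℕ} (hh : 1 ≤ h) (ω : Ω) :
    D.Stopped H k (h + 1) ω ↔ D.Stopped H k h ω ∨ D.Doubling H k h ω := by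
  unfold Stopped
  constructor
  · rintro ⟨j, hj, hd⟩
    rw [Finset.mem_Ico] at hj
    rcases Nat.lt_or_ge j h with h1 | h1
    · exact Or.inl ⟨j, by rw [Finset.mem_Ico]; omega, hd⟩
    · obtain rfl : j = h := by omega
      exact Or.inr hd
  · rintro (⟨j, hj, hd⟩ | hd)
    · exact ⟨j, by rw [Finset.mem_Ico] at hj ⊢; omega, hd⟩
    · exact ⟨h, by rw [Finset.mem_Ico]; omega, hd⟩

theorem measurable_N (D : Run S A Ω) (H k : ℕ) (s : S) (a : A) :
    Measurable[D.past H k] fun ω => D.N H k ω s a := by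
  refine Finset.measurable_sum _ fun i hi => Finset.measurable_sum _ fun h hh => ?_
  refine Measurable.ite ?_ measurable_const measurable_const
  exact (measurableSet_eq_of_top (D.measurable_s_past hi
      (by rw [Finset.mem_Icc] at hh ⊢; omega)) s).inter
    (measurableSet_eq_of_top (D.measurable_a_past hi hh) a)

theorem measurable_inCount (D : Run S A Ω) (H k h : ℕ) (s : S) (a : A) :
    Measurable[D.hist H k h] fun ω => D.inCount k h ω s a := by
  refine Finset.measurable_sum _ fun j hj => ?_
  refine Measurable.ite ?_ measurable_const measurable_const
  have hmem : j ∈ Finset.Icc 1 h := by rw [Finset.mem_Ico] at hj; rw [Finset.mem_Icc]; omega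
  exact (measurableSet_eq_of_top (D.measurable_s_hist hmem) s).inter
    (measurableSet_eq_of_top (D.measurable_a_hist hmem) a)

section Measurability

variable [Finite S] [Finite A]

theorem measurableSet_doubling (D : Run S A Ω) (H k : ℕ) {h : ℕ} (hh : 1 ≤ h) :
    MeasurableSet[D.hist H k h] {ω | D.Doubling H k h ω} := by
  have h1 := D.measurable_at_visit (H := H) (k := k) hh (g := fun ω s a => D.N H k ω s a)
    fun s a => (D.measurable_N H k s a).mono (D.past_le_hist H k h) le_rfl
  have h2 := D.measurable_at_visit (H := H) (k := k) hh (g := fun ω s a => D.inCount k h ω s a)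
    fun s a => D.measurable_inCount H k h s a
  let _ := D.hist H k h
  exact measurableSet_le h1 h2

theorem measurableSet_stopped (D : Run S A Ω) (H k h : ℕ) :
    MeasurableSet[D.hist H k h] {ω | D.Stopped H k h ω} := by
  have : {ω | D.Stopped H k h ω} = ⋃ j ∈ Finset.Ico 1 h, {ω | D.Doubling H k j ω} := by
    ext ω; simp [Stopped]
  rw [this]
  refine Finset.measurableSet_biUnion _ fun j hj => ?_
  rw [Finset.mem_Ico] at hj
  exact D.hist_mono H k hj.2.le _ (D.measurableSet_doubling H k hj.1)

end Measurability

open Classical in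
/-- The cost of step `h` of episode `k` for the cost function `y` of the episode: `1/2` at the first
doubling step and nothing after it. -/
def stepCost (D : Run S A Ω) (H : ℕ) (y : ℕ → Ω → S → A → ℝ) (k h : ℕ) (ω : Ω) : ℝ :=
  if D.Stopped H k h ω then 0 else if D.Doubling H k h ω then 1 / 2
  else y k ω (D.s k h ω) (D.a k h ω)

open Classical in
/-- `1 - z` before the first doubling step, and `1` after it. -/
def survival (D : Run S A Ω) (H : ℕ) (z : ℕ → ℕ → Ω → S → ℝ) (k h : ℕ) (ω : Ω) (s : S) : ℝ :=
  if D.Stopped H k h ω then 1 else 1 - z k h ω s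

theorem survival_pos {D : Run S A Ω} {H : ℕ} {z : ℕ → ℕ → Ω → S → ℝ} {k h : ℕ} {ω : Ω} {s : S}
    (hz1 : z k h ω s ≤ 1 / 2) : 0 < D.survival H z k h ω s := by
  unfold survival
  split_ifs <;> linarith

variable [Fintype S] {M : MDP S A} {D : Run S A Ω}

/-- After a stop both sides are `1` and nothing is charged. At the stop the survival jumps to `1`,
which the cost `1/2` pays since `exp(-1) ≤ 1/2 ≤ 1 - z`. Before it, `1 - P z' ≤ 1 - z + y ≤ (1 -
z)(1 + 2y)` because `1 - z ≥ 1/2`, and `1 + 2y ≤ exp(2y)`. Hence the truncation at `1/2` and the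
factor `2` on costs. -/
theorem avg_survival_le {H : ℕ} {z : ℕ → ℕ → Ω → S → ℝ} {y : ℕ → Ω → S → A → ℝ} {k h : ℕ}
    {ω : Ω} (hh : 1 ≤ h) (hz1 : z k h ω (D.s k h ω) ≤ 1 / 2)
    (hy0 : 0 ≤ y k ω (D.s k h ω) (D.a k h ω))
    (hrec : D.N H k ω (D.s k h ω) (D.a k h ω) ≠ 0 → z k h ω (D.s k h ω)
      ≤ y k ω (D.s k h ω) (D.a k h ω) + M.avg (D.s k h ω) (D.a k h ω) (z k (h + 1) ω)) :
    Real.exp (-2 * D.stepCost H y k h ω)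
      * M.avg (D.s k h ω) (D.a k h ω) (D.survival H z k (h + 1) ω)
      ≤ D.survival H z k h ω (D.s k h ω) := by
  have hsucc := D.stopped_succ H k hh ω
  by_cases h1 : D.Stopped H k h ω
  · have h2 : D.Stopped H k (h + 1) ω := hsucc.2 (Or.inl h1)
    have e : D.survival H z k (h + 1) ω = fun _ => 1 := by funext s'; rw [survival, if_pos h2]
    rw [e, M.avg_const, stepCost, if_pos h1, survival, if_pos h1]
    simp
  rw [stepCost, if_neg h1, survival, if_neg h1]
  by_cases h3 : D.Doubling H k h ω
  · have h2 : D.Stopped H k (h + 1) ω := hsucc.2 (Or.inr h3)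
    have e : D.survival H z k (h + 1) ω = fun _ => 1 := by funext s'; rw [survival, if_pos h2]
    rw [e, M.avg_const, if_pos h3]
    have : Real.exp (-2 * (1 / 2)) ≤ 1 / 2 := by
      have e2 : (-2 * (1 / 2) : ℝ) = -1 := by norm_num
      rw [e2, Real.exp_neg, ← one_div]
      have := Real.exp_one_gt_d9
      exact one_div_le_one_div_of_le (by norm_num) (by linarith)
    linarith
  · have h2 : ¬ D.Stopped H k (h + 1) ω := fun h => (hsucc.1 h).elim h1 h3
    have hN : D.N H k ω (D.s k h ω) (D.a k h ω) ≠ 0 := by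
      intro h0; apply h3; rw [Doubling, h0]; exact Nat.zero_le _
    have e : D.survival H z k (h + 1) ω = fun s' => 1 - z k (h + 1) ω s' := by
      funext s'; rw [survival, if_neg h2]
    rw [e, M.avg_sub, M.avg_const, if_neg h3]
    have hr := hrec hN
    set yv := y k ω (D.s k h ω) (D.a k h ω)
    set zv := z k h ω (D.s k h ω)
    have h5 : Real.exp (-2 * yv) * (1 + 2 * yv) ≤ 1 := by
      have h6 : 1 + 2 * yv ≤ Real.exp (2 * yv) := by linarith [Real.add_one_le_exp (2 * yv)]
      calc Real.exp (-2 * yv) * (1 + 2 * yv) ≤ Real.exp (-2 * yv) * Real.exp (2 * yv) := by gcongr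
        _ = 1 := by rw [← Real.exp_add]; simp
    have h7 : 1 - M.avg (D.s k h ω) (D.a k h ω) (z k (h + 1) ω) ≤ (1 - zv) * (1 + 2 * yv) := by
      nlinarith
    calc _ ≤ Real.exp (-2 * yv) * ((1 - zv) * (1 + 2 * yv)) := by gcongr
      _ = (1 - zv) * (Real.exp (-2 * yv) * (1 + 2 * yv)) := by ring
      _ ≤ (1 - zv) * 1 := by gcongr; linarith
      _ = 1 - zv := mul_one _

/-- The potentials `z` at the start of the episodes are bounded by the costs along the
trajectories, up to an additive `ℓ` and with failure probability `exp (-ℓ)`. -/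
theorem IsRunOf.failsLE_sum_potential [Fintype A] [MeasurableSpace Ω] {μ : Measure Ω}
    [IsProbabilityMeasure μ] (hD : D.IsRunOf M μ)
    {z : ℕ → ℕ → Ω → S → ℝ} {y : ℕ → Ω → S → A → ℝ}
    (hzm : ∀ k ≥ 1, ∀ h ∈ Finset.Icc 1 (M.H + 1), ∀ s,
      Measurable[D.past M.H k] fun ω => z k h ω s)
    (hym : ∀ k ≥ 1, ∀ s a, Measurable[D.past M.H k] fun ω => y k ω s a)
    (hz1 : ∀ k ≥ 1, ∀ h ∈ Finset.Icc 1 (M.H + 1), ∀ ω s, z k h ω s ≤ 1 / 2)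
    (hzend : ∀ k ≥ 1, ∀ ω s, z k (M.H + 1) ω s = 0)
    (hy0 : ∀ k ≥ 1, ∀ ω s a, 0 ≤ y k ω s a)
    (hrec : ∀ k ≥ 1, ∀ h ∈ Finset.Icc 1 M.H, ∀ ω s, D.N M.H k ω s (D.π k ω h s) ≠ 0 →
      z k h ω s ≤ y k ω s (D.π k ω h s) + M.avg s (D.π k ω h s) (z k (h + 1) ω))
    (ℓ : ℝ) (K : ℕ) :
    FailsLE μ (Real.exp (-ℓ)) fun ω => ∑ k ∈ Finset.Icc 1 K, z k 1 ω (D.s k 1 ω)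
      ≤ 2 * ∑ k ∈ Finset.Icc 1 K, ∑ h ∈ Finset.Icc 1 M.H, D.stepCost M.H y k h ω + ℓ := by
  -- Ratios of consecutive survivals, discounted by the cost: conditionally of mean at most `1` by
  -- `avg_survival_le`, with a product over the episode that telescopes.
  set G : ℕ → ℕ → Ω → S → ℝ := fun k h ω s' => Real.exp (-2 * D.stepCost M.H y k h ω)
    * D.survival M.H z k (h + 1) ω s' / D.survival M.H z k h ω (D.s k h ω) with hG
  have hGm : ∀ k ≥ 1, ∀ h ∈ Finset.Icc 1 M.H, ∀ s',
      Measurable[D.hist M.H k h] fun ω => G k h ω s' := by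
    intro k hk h hh s'
    have hh' := Finset.mem_Icc.1 hh
    have hst := D.measurableSet_stopped M.H k h
    have hdb := D.measurableSet_doubling M.H k hh'.1
    have hst2 : MeasurableSet[D.hist M.H k h] {ω | D.Stopped M.H k (h + 1) ω} := by
      have : {ω | D.Stopped M.H k (h + 1) ω}
          = {ω | D.Stopped M.H k h ω} ∪ {ω | D.Doubling M.H k h ω} := by
        ext ω; exact D.stopped_succ M.H k hh'.1 ω
      rw [this]; exact hst.union hdb
    have hp := D.past_le_hist M.H k h
    have m1 : Measurable[D.hist M.H k h] fun ω => D.stepCost M.H y k h ω := by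
      refine Measurable.ite hst measurable_const (Measurable.ite hdb measurable_const ?_)
      exact D.measurable_at_visit hh'.1 (g := fun ω s a => y k ω s a)
        fun s a => (hym k hk s a).mono hp le_rfl
    have m2 : Measurable[D.hist M.H k h] fun ω => D.survival M.H z k (h + 1) ω s' := by
      refine Measurable.ite hst2 measurable_const (measurable_const.sub ?_)
      exact (hzm k hk (h + 1) (by rw [Finset.mem_Icc]; omega) s').mono hp le_rfl
    have m3 : Measurable[D.hist M.H k h] fun ω => D.survival M.H z k h ω (D.s k h ω) := by
      refine Measurable.ite hst measurable_const (measurable_const.sub ?_)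
      refine measurable_apply_countable (g := fun ω s => z k h ω s)
        (D.measurable_s_hist (by rw [Finset.mem_Icc]; omega)) fun s => ?_
      exact (hzm k hk h (by rw [Finset.mem_Icc]; omega) s).mono hp le_rfl
    exact ((Real.measurable_exp.comp (m1.const_mul (-2))).mul m2).div m3
  have hsurv : ∀ k ≥ 1, ∀ h ∈ Finset.Icc 1 (M.H + 1), ∀ ω s, 0 < D.survival M.H z k h ω s :=
    fun k hk h hh ω s => survival_pos (hz1 k hk h hh ω s)
  have hG0 : ∀ k ≥ 1, ∀ h ∈ Finset.Icc 1 M.H, ∀ ω s', 0 ≤ G k h ω s' := by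
    intro k hk h hh ω s'
    rw [Finset.mem_Icc] at hh
    have h1 := hsurv k hk h (by rw [Finset.mem_Icc]; omega) ω (D.s k h ω)
    have h2 := hsurv k hk (h + 1) (by rw [Finset.mem_Icc]; omega) ω s'
    simp only [hG]
    positivity
  refine le_trans (measure_mono ?_) (hD.measure_exists_le_prod_le
    (ξ := fun k h ω => ENNReal.ofReal (G k h ω (D.s k (h + 1) ω))) ?_ ?_ ℓ (K + 1))
  · intro ω hω
    -- The products run over the episodes before the chosen index.
    refine ⟨K + 1, by rw [Finset.mem_Icc]; omega, ?_⟩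
    have hIco : Finset.Ico 1 (K + 1) = Finset.Icc 1 K := by
      ext i; rw [Finset.mem_Ico, Finset.mem_Icc]; omega
    rw [hIco]
    have hprod : ∀ k ∈ Finset.Icc 1 K, ENNReal.ofReal (Real.exp (z k 1 ω (D.s k 1 ω)
        - 2 * ∑ h ∈ Finset.Icc 1 M.H, D.stepCost M.H y k h ω))
        ≤ ∏ h ∈ Finset.Icc 1 M.H, ENNReal.ofReal (G k h ω (D.s k (h + 1) ω)) := by
      intro k hk
      have hk1 := (Finset.mem_Icc.1 hk).1
      rw [← ENNReal.ofReal_prod_of_nonneg fun h hh => hG0 k hk1 h hh ω _]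
      refine ENNReal.ofReal_le_ofReal ?_
      have htel : ∀ n ≤ M.H, ∏ h ∈ Finset.Icc 1 n, G k h ω (D.s k (h + 1) ω)
          = Real.exp (-2 * ∑ h ∈ Finset.Icc 1 n, D.stepCost M.H y k h ω)
            * D.survival M.H z k (n + 1) ω (D.s k (n + 1) ω)
            / D.survival M.H z k 1 ω (D.s k 1 ω) := by
        intro n
        induction n with
        | zero =>
          intro _
          have := (hsurv k hk1 1 (by rw [Finset.mem_Icc]; omega) ω (D.s k 1 ω)).ne'
          simp [this]
        | succ n ih =>
          intro hn
          rw [Finset.prod_Icc_succ_top (by omega), Finset.sum_Icc_succ_top (by omega),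
            ih (by omega), mul_add, Real.exp_add]
          have h1 := (hsurv k hk1 1 (by rw [Finset.mem_Icc]; omega) ω (D.s k 1 ω)).ne'
          have h2 := (hsurv k hk1 (n + 1) (by rw [Finset.mem_Icc]; omega) ω
            (D.s k (n + 1) ω)).ne'
          simp only [hG]
          field_simp
      rw [htel M.H le_rfl]
      have hlast : 1 ≤ D.survival M.H z k (M.H + 1) ω (D.s k (M.H + 1) ω) := by
        unfold survival; split_ifs
        · exact le_rfl
        · rw [hzend k hk1]; simp
      have hfirst : D.survival M.H z k 1 ω (D.s k 1 ω) = 1 - z k 1 ω (D.s k 1 ω) := by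
        rw [survival, if_neg]
        rintro ⟨j, hj, -⟩
        simp at hj
      have hfp := hsurv k hk1 1 (by rw [Finset.mem_Icc]; omega) ω (D.s k 1 ω)
      rw [le_div_iff₀ hfp, hfirst]
      rw [hfirst] at hfp
      -- The product ends at a survival of at least `1`, because the potential vanishes after step
      -- `H`, and starts at `1 - z`. Dividing by `1 - z ≤ exp(-z)` produces the potential in the
      -- exponent.
      have he : 1 - z k 1 ω (D.s k 1 ω) ≤ Real.exp (-z k 1 ω (D.s k 1 ω)) := by
        linarith [Real.add_one_le_exp (-z k 1 ω (D.s k 1 ω))]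
      calc Real.exp (z k 1 ω (D.s k 1 ω) - 2 * ∑ h ∈ Finset.Icc 1 M.H, D.stepCost M.H y k h ω)
            * (1 - z k 1 ω (D.s k 1 ω))
          ≤ Real.exp (z k 1 ω (D.s k 1 ω) - 2 * ∑ h ∈ Finset.Icc 1 M.H, D.stepCost M.H y k h ω)
            * Real.exp (-z k 1 ω (D.s k 1 ω)) := by gcongr
        _ = Real.exp (-2 * ∑ h ∈ Finset.Icc 1 M.H, D.stepCost M.H y k h ω) := by
            rw [← Real.exp_add]; congr 1; ring
        _ ≤ _ := le_mul_of_one_le_right (Real.exp_pos _).le hlast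
    refine le_trans ?_ (Finset.prod_le_prod' hprod)
    rw [← ENNReal.ofReal_prod_of_nonneg fun k _ => (Real.exp_pos _).le, ← Real.exp_sum,
      Finset.sum_sub_distrib, ← Finset.mul_sum]
    refine ENNReal.ofReal_le_ofReal (Real.exp_le_exp.2 ?_)
    simp only [Set.mem_ofPred_eq, not_le] at hω
    linarith
  · intro k hk h hh
    refine Measurable.ennreal_ofReal ?_
    refine measurable_apply_countable (g := fun ω s' => G k h ω s') (D.measurable_s_next M.H k h)
      fun s' => (hGm k hk h hh s').mono (D.hist_le_next M.H k h) le_rfl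
  · intro k hk h hh B hB
    have hh' := Finset.mem_Icc.1 hh
    have hm := hD.hist_le hk hh
    have hB0 := hm _ hB
    rw [← lintegral_indicator hB0]
    have e := hD.lintegral_transition hk hh
      (g := fun ω s' => B.indicator (fun ω => ENNReal.ofReal (G k h ω s')) ω)
      fun s' => ((hGm k hk h hh s').ennreal_ofReal).indicator hB
    have e1 : (B.indicator fun ω => ENNReal.ofReal (G k h ω (D.s k (h + 1) ω)))
        = fun ω => B.indicator (fun ω' => ENNReal.ofReal (G k h ω' (D.s k (h + 1) ω))) ω := by
      funext ω; by_cases hω : ω ∈ B <;> simp [hω]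
    rw [e1, e, ← lintegral_indicator_one hB0]
    refine lintegral_mono fun ω => ?_
    by_cases hω : ω ∈ B
    · simp only [hω, Set.indicator_of_mem, Pi.one_apply]
      simp_rw [← ENNReal.ofReal_mul (M.P_nonneg _ _ _)]
      rw [← ENNReal.ofReal_sum_of_nonneg
        fun s' _ => mul_nonneg (M.P_nonneg _ _ s') (hG0 k hk h hh ω s')]
      refine ENNReal.ofReal_le_one.2 ?_
      have hp := hsurv k hk h (by rw [Finset.mem_Icc]; omega) ω (D.s k h ω)
      have hkey := avg_survival_le (M := M) (D := D) (H := M.H) (z := z) (y := y) (k := k) (ω := ω)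
        hh'.1 (hz1 k hk h (by rw [Finset.mem_Icc]; omega) ω _) (hy0 k hk ω _ _)
        (hrec k hk h hh ω (D.s k h ω))
      have e3 : ∑ s', M.P (D.s k h ω) (D.a k h ω) s' * G k h ω s'
          = (Real.exp (-2 * D.stepCost M.H y k h ω)
            * M.avg (D.s k h ω) (D.a k h ω) (D.survival M.H z k (h + 1) ω))
            / D.survival M.H z k h ω (D.s k h ω) := by
        simp only [hG, MDP.avg, Finset.mul_sum, Finset.sum_div]
        exact Finset.sum_congr rfl fun s' _ => by ring
      rw [e3, div_le_one hp]
      exact hkey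
    · simp [hω]

end Run

end EQO

/-! ### Pathwise sums over visits -/

namespace EQO

namespace Run

variable {S A Ω : Type*} [DecidableEq S] [DecidableEq A] (D : Run S A Ω)

theorem inCount_one (k : ℕ) (ω : Ω) (s : S) (a : A) : D.inCount k 1 ω s a = 0 := by
  simp [inCount]

theorem inCount_succ (k : ℕ) {h : ℕ} (hh : 1 ≤ h) (ω : Ω) (s : S) (a : A) :
    D.inCount k (h + 1) ω s a = D.inCount k h ω s a
      + if D.s k h ω = s ∧ D.a k h ω = a then 1 else 0 := by
  rw [inCount, Finset.sum_Ico_succ_top hh]; rfl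

theorem inCount_mono (k : ℕ) {h h' : ℕ} (hh : h ≤ h') (ω : Ω) (s : S) (a : A) :
    D.inCount k h ω s a ≤ D.inCount k h' ω s a :=
  Finset.sum_le_sum_of_subset (Finset.Ico_subset_Ico_right hh)

theorem N_succ (H : ℕ) {k : ℕ} (hk : 1 ≤ k) (ω : Ω) (s : S) (a : A) :
    D.N H (k + 1) ω s a = D.N H k ω s a + D.inCount k (H + 1) ω s a := by
  have e : Finset.Ico 1 (H + 1) = Finset.Icc 1 H := by
    ext i; rw [Finset.mem_Ico, Finset.mem_Icc]; omega
  rw [N, Finset.sum_Ico_succ_top hk, inCount, e]; rfl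

theorem N_one (H : ℕ) (ω : Ω) (s : S) (a : A) : D.N H 1 ω s a = 0 := by simp [N]

/-- The number of visits, before step `h` of episode `k`, of the pair visited at that step. -/
def visitIndex (H k h : ℕ) (ω : Ω) : ℕ :=
  D.N H k ω (D.s k h ω) (D.a k h ω) + D.inCount k h ω (D.s k h ω) (D.a k h ω)

theorem N_succ_le (H K : ℕ) (ω : Ω) (s : S) (a : A) : (D.N H (K + 1) ω s a : ℝ) ≤ K * H := by
  have := D.N_le H (K + 1) ω s a
  rw [Nat.add_sub_cancel] at this
  exact_mod_cast this

theorem visitIndex_bounds {H k h : ℕ} {ω : Ω} (hd : ¬ D.Doubling H k h ω) :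
    1 ≤ D.N H k ω (D.s k h ω) (D.a k h ω) ∧
    D.N H k ω (D.s k h ω) (D.a k h ω) ≤ D.visitIndex H k h ω ∧
    D.visitIndex H k h ω + 1 ≤ 2 * D.N H k ω (D.s k h ω) (D.a k h ω) := by
  unfold Doubling at hd
  unfold visitIndex
  omega

open Classical in
theorem stepCost_le {H : ℕ} {y : ℕ → Ω → S → A → ℝ} {k h : ℕ} {ω : Ω}
    (hy : 0 ≤ y k ω (D.s k h ω) (D.a k h ω)) :
    D.stepCost H y k h ω ≤ (if D.Doubling H k h ω then 0 else y k ω (D.s k h ω) (D.a k h ω))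
      + 1 / 2 * (if ¬ D.Stopped H k h ω ∧ D.Doubling H k h ω then (1 : ℝ) else 0) := by
  unfold stepCost
  by_cases h1 : D.Stopped H k h ω <;> by_cases h2 : D.Doubling H k h ω <;> simp [h1, h2, hy]

variable [Fintype S] [Fintype A]

/-- A step raises the running count of exactly one pair by one, so the increments of `f` telescope
pair by pair. -/
theorem sum_visitIndex_episode (f : ℕ → ℝ) (H k : ℕ) (ω : Ω) (n : ℕ) :
    ∑ h ∈ Finset.Icc 1 n, (f (D.visitIndex H k h ω + 1) - f (D.visitIndex H k h ω))
      = ∑ p : S × A, (f (D.N H k ω p.1 p.2 + D.inCount k (n + 1) ω p.1 p.2)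
        - f (D.N H k ω p.1 p.2)) := by
  induction n with
  | zero => simp [inCount_one]
  | succ n ih =>
    rw [Finset.sum_Icc_succ_top (by omega), ih, ← eq_sub_iff_add_eq', ← Finset.sum_sub_distrib,
      Finset.sum_eq_single (D.s k (n + 1) ω, D.a k (n + 1) ω)]
    · simp [inCount_succ, visitIndex, ← add_assoc]
    · rintro ⟨s, a⟩ - hp
      have : ¬ (D.s k (n + 1) ω = s ∧ D.a k (n + 1) ω = a) := by
        rintro ⟨rfl, rfl⟩; exact hp rfl
      simp [D.inCount_succ k (show 1 ≤ n + 1 by omega), this]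
    · simp

/-- Telescoping of `f` along the visits of all pairs. -/
theorem sum_visitIndex (f : ℕ → ℝ) (H K : ℕ) (ω : Ω) :
    ∑ k ∈ Finset.Icc 1 K, ∑ h ∈ Finset.Icc 1 H,
        (f (D.visitIndex H k h ω + 1) - f (D.visitIndex H k h ω))
      = ∑ p : S × A, (f (D.N H (K + 1) ω p.1 p.2) - f 0) := by
  induction K with
  | zero => simp [N_one]
  | succ K ih =>
    rw [Finset.sum_Icc_succ_top (by omega), ih, sum_visitIndex_episode, ← Finset.sum_add_distrib]
    refine Finset.sum_congr rfl fun p _ => ?_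
    rw [D.N_succ H (show 1 ≤ K + 1 by omega)]
    ring

theorem sum_N (H K : ℕ) (ω : Ω) :
    ∑ p : S × A, (D.N H (K + 1) ω p.1 p.2 : ℝ) = K * H := by
  have := D.sum_visitIndex (fun n => (n : ℝ)) H K ω
  simpa using this.symm

open Classical in
-- Off doubling steps the frozen count is at least half of `n + 1`, where `n` is the running count;
-- so `1/N ≤ 2/(n + 1) ≤ 2(log(n + 1) - log n)`, and this telescopes.
theorem sum_inv_N_le (H K : ℕ) (hK : 1 ≤ K) (hH : 1 ≤ H) (ω : Ω) :
    ∑ k ∈ Finset.Icc 1 K, ∑ h ∈ Finset.Icc 1 H,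
        (if D.Doubling H k h ω then 0 else 1 / (D.N H k ω (D.s k h ω) (D.a k h ω) : ℝ))
      ≤ 2 * (Fintype.card S * Fintype.card A * Real.log (K * H)) := by
  -- The convention `log 0 = 0` keeps the increments nonnegative from `n = 0` on.
  have hmono : ∀ n : ℕ, Real.log n ≤ Real.log (n + 1 : ℕ) := by
    intro n
    rcases Nat.eq_zero_or_pos n with rfl | hn
    · simp
    · exact Real.log_le_log (by positivity) (by push_cast; linarith)
  have hterm : ∀ k ∈ Finset.Icc 1 K, ∀ h ∈ Finset.Icc 1 H,
      (if D.Doubling H k h ω then 0 else 1 / (D.N H k ω (D.s k h ω) (D.a k h ω) : ℝ))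
      ≤ 2 * (Real.log (D.visitIndex H k h ω + 1 : ℕ) - Real.log (D.visitIndex H k h ω : ℕ)) := by
    intro k _ h _
    split_ifs with hd
    · linarith [hmono (D.visitIndex H k h ω)]
    · obtain ⟨h1, h2, h3⟩ := D.visitIndex_bounds hd
      have h1' : (1 : ℝ) ≤ D.N H k ω (D.s k h ω) (D.a k h ω) := by exact_mod_cast h1
      have h2' : (D.N H k ω (D.s k h ω) (D.a k h ω) : ℝ) ≤ D.visitIndex H k h ω := by
        exact_mod_cast h2
      have h3' : (D.visitIndex H k h ω : ℝ) + 1 ≤ 2 * D.N H k ω (D.s k h ω) (D.a k h ω) := by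
        exact_mod_cast h3
      set n : ℝ := (D.visitIndex H k h ω : ℝ)
      set m : ℝ := (D.N H k ω (D.s k h ω) (D.a k h ω) : ℝ)
      have hn : 0 < n := by linarith
      have hl := Real.one_sub_inv_le_log_of_pos (show 0 < (n + 1) / n by positivity)
      rw [Real.log_div (by positivity) hn.ne'] at hl
      have e : 1 - ((n + 1) / n)⁻¹ = 1 / (n + 1) := by field_simp; ring
      rw [e] at hl
      have : 1 / m ≤ 2 * (1 / (n + 1)) := by
        rw [mul_one_div, div_le_div_iff₀ (by linarith) (by linarith)]; linarith
      push_cast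
      linarith
  calc _ ≤ ∑ k ∈ Finset.Icc 1 K, ∑ h ∈ Finset.Icc 1 H,
        2 * (Real.log (D.visitIndex H k h ω + 1 : ℕ) - Real.log (D.visitIndex H k h ω : ℕ)) :=
        Finset.sum_le_sum fun k hk => Finset.sum_le_sum fun h hh => hterm k hk h hh
    _ = 2 * ∑ p : S × A, (Real.log (D.N H (K + 1) ω p.1 p.2) - Real.log (0 : ℕ)) := by
        rw [← D.sum_visitIndex (fun n => Real.log n)]
        simp_rw [Finset.mul_sum]
    _ ≤ 2 * ∑ _p : S × A, Real.log (K * H) := by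
        gcongr with p
        have hKH : (1 : ℝ) ≤ K * H := by exact_mod_cast Nat.mul_pos hK hH
        rcases Nat.eq_zero_or_pos (D.N H (K + 1) ω p.1 p.2) with h0 | h0
        · rw [h0]; simpa using Real.log_nonneg hKH
        · have := Real.log_le_log (by exact_mod_cast h0) (D.N_succ_le H K ω p.1 p.2)
          simpa using this
    _ = _ := by simp

open Classical in
-- Off doubling steps `1/√N ≤ √2/√(n + 1) ≤ 2√2(√(n + 1) - √n)` with the running count `n`. After
-- telescoping, Cauchy–Schwarz over the pairs uses that all counts add up to `KH`.
theorem sum_inv_sqrt_N_le (H K : ℕ) (ω : Ω) :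
    ∑ k ∈ Finset.Icc 1 K, ∑ h ∈ Finset.Icc 1 H,
        (if D.Doubling H k h ω then 0 else 1 / √(D.N H k ω (D.s k h ω) (D.a k h ω) : ℝ))
      ≤ 2 * √2 * √(H * Fintype.card S * Fintype.card A * K) := by
  have hterm : ∀ k ∈ Finset.Icc 1 K, ∀ h ∈ Finset.Icc 1 H,
      (if D.Doubling H k h ω then 0 else 1 / √(D.N H k ω (D.s k h ω) (D.a k h ω) : ℝ))
      ≤ 2 * √2 * (√(D.visitIndex H k h ω + 1 : ℕ) - √(D.visitIndex H k h ω : ℕ)) := by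
    intro k _ h _
    split_ifs with hd
    · have : √(D.visitIndex H k h ω : ℕ) ≤ √(D.visitIndex H k h ω + 1 : ℕ) :=
        Real.sqrt_le_sqrt (by push_cast; linarith)
      have h2 := sub_nonneg.2 this
      positivity
    · obtain ⟨h1, h2, h3⟩ := D.visitIndex_bounds hd
      have h1' : (1 : ℝ) ≤ D.N H k ω (D.s k h ω) (D.a k h ω) := by exact_mod_cast h1
      have h3' : (D.visitIndex H k h ω : ℝ) + 1 ≤ 2 * D.N H k ω (D.s k h ω) (D.a k h ω) := by
        exact_mod_cast h3
      have hn : (0 : ℝ) ≤ D.visitIndex H k h ω := by positivity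
      push_cast
      set n : ℝ := (D.visitIndex H k h ω : ℝ)
      set m : ℝ := (D.N H k ω (D.s k h ω) (D.a k h ω) : ℝ)
      have hm : 0 < √m := Real.sqrt_pos.2 (by linarith)
      have hs : √(n + 1) ≤ √2 * √m := by
        rw [← Real.sqrt_mul (by norm_num)]; exact Real.sqrt_le_sqrt h3'
      have hle : √n ≤ √(n + 1) := Real.sqrt_le_sqrt (by linarith)
      have e1 : √(n + 1) * √(n + 1) = n + 1 := Real.mul_self_sqrt (by linarith)
      have e2 : √n * √n = n := Real.mul_self_sqrt hn
      have e3 : (√(n + 1) - √n) * (√(n + 1) + √n) = 1 := by linarith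
      have h4 : 1 ≤ 2 * √(n + 1) * (√(n + 1) - √n) := by
        nlinarith [sub_nonneg.2 hle]
      rw [div_le_iff₀ hm]
      calc 1 ≤ 2 * √(n + 1) * (√(n + 1) - √n) := h4
        _ ≤ 2 * (√2 * √m) * (√(n + 1) - √n) := by
          have := sub_nonneg.2 hle
          gcongr
        _ = _ := by ring
  calc _ ≤ ∑ k ∈ Finset.Icc 1 K, ∑ h ∈ Finset.Icc 1 H,
        2 * √2 * (√(D.visitIndex H k h ω + 1 : ℕ) - √(D.visitIndex H k h ω : ℕ)) :=
        Finset.sum_le_sum fun k hk => Finset.sum_le_sum fun h hh => hterm k hk h hh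
    _ = 2 * √2 * ∑ p : S × A, √(D.N H (K + 1) ω p.1 p.2 : ℝ) := by
        have := D.sum_visitIndex (fun n => √(n : ℝ)) H K ω
        simp only [Nat.cast_zero, Real.sqrt_zero, sub_zero] at this
        rw [← this]
        simp_rw [Finset.mul_sum]
    _ ≤ _ := by
        gcongr
        refine Real.le_sqrt_of_sq_le ?_
        have := sq_sum_le_card_mul_sum_sq (s := (Finset.univ : Finset (S × A)))
          (f := fun p => √(D.N H (K + 1) ω p.1 p.2 : ℝ))
        simp only [Real.sq_sqrt (Nat.cast_nonneg _)] at this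
        rw [D.sum_N, Finset.card_univ, Fintype.card_prod] at this
        push_cast at this
        linarith

open Classical in
-- An episode has at most one first doubling step, and by its end the count of that pair plus one
-- has at least doubled. Adding one also covers unvisited pairs. So each such episode adds at least
-- `log 2` to a telescoping sum of logarithms.
theorem sum_first_doubling_le (H K : ℕ) (hK : 1 ≤ K) (hH : 1 ≤ H) (ω : Ω) :
    Real.log 2 * ∑ k ∈ Finset.Icc 1 K, ∑ h ∈ Finset.Icc 1 H,
        (if ¬ D.Stopped H k h ω ∧ D.Doubling H k h ω then (1 : ℝ) else 0)
      ≤ Fintype.card S * Fintype.card A * Real.log (2 * K * H) := by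
  have hmono : Monotone fun n : ℕ => Real.log (n + 1 : ℝ) := fun m n hmn =>
    Real.log_le_log (by positivity) (by have : (m : ℝ) ≤ n := by exact_mod_cast hmn
                                        linarith)
  have hterm : ∀ k ∈ Finset.Icc 1 K, Real.log 2 * ∑ h ∈ Finset.Icc 1 H,
        (if ¬ D.Stopped H k h ω ∧ D.Doubling H k h ω then (1 : ℝ) else 0)
      ≤ ∑ h ∈ Finset.Icc 1 H, (Real.log ((D.visitIndex H k h ω + 1 : ℕ) + 1 : ℝ)
        - Real.log ((D.visitIndex H k h ω : ℕ) + 1 : ℝ)) := by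
    intro k hk
    have hk1 := (Finset.mem_Icc.1 hk).1
    rw [D.sum_visitIndex_episode (fun n => Real.log (n + 1 : ℝ))]
    have hnn : ∀ p ∈ (Finset.univ : Finset (S × A)), 0 ≤
        Real.log ((D.N H k ω p.1 p.2 + D.inCount k (H + 1) ω p.1 p.2 : ℕ) + 1 : ℝ)
          - Real.log ((D.N H k ω p.1 p.2 : ℕ) + 1 : ℝ) := fun p _ =>
      sub_nonneg.2 (hmono (Nat.le_add_right _ _))
    by_cases hex : ∃ h ∈ Finset.Icc 1 H, ¬ D.Stopped H k h ω ∧ D.Doubling H k h ω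
    · obtain ⟨h, hh, hns, hd⟩ := hex
      rw [Finset.sum_eq_single_of_mem h hh, if_pos ⟨hns, hd⟩, mul_one]
      · refine le_trans ?_ (Finset.single_le_sum hnn
          (Finset.mem_univ (D.s k h ω, D.a k h ω)))
        rw [Finset.mem_Icc] at hh
        have h1 : 2 * (D.N H k ω (D.s k h ω) (D.a k h ω) + 1) ≤
            D.N H k ω (D.s k h ω) (D.a k h ω)
              + D.inCount k (H + 1) ω (D.s k h ω) (D.a k h ω) + 1 := by
          have h2 := D.inCount_mono k (show h + 1 ≤ H + 1 by omega) ω (D.s k h ω) (D.a k h ω)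
          rw [D.inCount_succ k hh.1, if_pos ⟨rfl, rfl⟩] at h2
          unfold Doubling at hd
          omega
        rw [le_sub_iff_add_le, ← Real.log_mul (by norm_num) (by positivity)]
        exact Real.log_le_log (by positivity) (by exact_mod_cast h1)
      · intro h' hh' hne
        rw [if_neg]
        rintro ⟨hns', hd'⟩
        rw [Finset.mem_Icc] at hh hh'
        rcases Nat.lt_or_gt_of_ne hne with hlt | hlt
        · exact hns ⟨h', by rw [Finset.mem_Ico]; omega, hd'⟩
        · exact hns' ⟨h, by rw [Finset.mem_Ico]; omega, hd⟩
    · rw [Finset.sum_eq_zero, mul_zero]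
      · exact Finset.sum_nonneg hnn
      · intro h hh
        rw [if_neg]
        exact fun hc => hex ⟨h, hh, hc⟩
  rw [Finset.mul_sum]
  calc _ ≤ _ := Finset.sum_le_sum hterm
    _ = ∑ p : S × A, (Real.log ((D.N H (K + 1) ω p.1 p.2 : ℕ) + 1 : ℝ)
          - Real.log ((0 : ℕ) + 1 : ℝ)) :=
        D.sum_visitIndex (fun n => Real.log (n + 1 : ℝ)) H K ω
    _ ≤ ∑ _p : S × A, Real.log (2 * K * H) := by
        refine Finset.sum_le_sum fun p _ => ?_
        have hKH : (1 : ℝ) ≤ K * H := by exact_mod_cast Nat.mul_pos hK hH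
        have h1 := D.N_succ_le H K ω p.1 p.2
        simp only [Nat.cast_zero, zero_add, Real.log_one, sub_zero]
        exact Real.log_le_log (by positivity) (by linarith)
    _ = _ := by simp

end Run

end EQO

/-! ### Truncated costs of the executed policies -/

namespace EQO

namespace Run

variable {S A Ω : Type*} [DecidableEq S] [DecidableEq A]

theorem measurable_bonus (D : Run S A Ω) (c₁ : ℕ → ℝ) (c₂ : ℕ → ℝ≥0∞) (H k : ℕ) (s : S) (a : A) :
    Measurable[D.past H k] fun ω => D.bonus c₁ c₂ H k ω s a :=
  (measurable_from_nat (f := fun n : ℕ => minMul (c₁ k / (n : ℝ)) (c₂ k) (1 / √(n : ℝ)))).comp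
    (D.measurable_N H k s a)

variable [Fintype S]

/-- The expected cost over the last `n` steps of episode `k` for the cost function `y`,
truncated at `1/2` and equal to `1/2` at pairs that have not been visited. -/
def truncatedCost (D : Run S A Ω) (M : MDP S A) (y : ℕ → Ω → S → A → ℝ) (k : ℕ) (ω : Ω) :
    ℕ → S → ℝ
  | 0 => fun _ => 0
  | n + 1 => fun s =>
    if D.N M.H k ω s (D.π k ω (M.H - n) s) = 0 then 1 / 2
    else min (1 / 2) (y k ω s (D.π k ω (M.H - n) s)
      + M.avg s (D.π k ω (M.H - n) s) (truncatedCost D M y k ω n))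

variable {D : Run S A Ω} {M : MDP S A} {y : ℕ → Ω → S → A → ℝ} {k : ℕ}

theorem truncatedCost_succ (ω : Ω) (n : ℕ) (s : S) : D.truncatedCost M y k ω (n + 1) s
    = if D.N M.H k ω s (D.π k ω (M.H - n) s) = 0 then 1 / 2
      else min (1 / 2) (y k ω s (D.π k ω (M.H - n) s)
        + M.avg s (D.π k ω (M.H - n) s) (D.truncatedCost M y k ω n)) := rfl

theorem truncatedCost_le (ω : Ω) (n : ℕ) (s : S) : D.truncatedCost M y k ω n s ≤ 1 / 2 := by
  cases n with
  | zero => simp [truncatedCost]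
  | succ n =>
    rw [truncatedCost_succ]
    split_ifs
    · exact le_rfl
    · exact min_le_left _ _

theorem truncatedCost_nonneg {ω : Ω} (hy : ∀ s a, 0 ≤ y k ω s a) (n : ℕ) (s : S) :
    0 ≤ D.truncatedCost M y k ω n s := by
  induction n generalizing s with
  | zero => simp [truncatedCost]
  | succ n ih =>
    rw [truncatedCost_succ]
    split_ifs
    · norm_num
    · exact le_min (by norm_num) (add_nonneg (hy _ _) (M.avg_nonneg _ _ ih))

theorem truncatedCost_step {ω : Ω} {h : ℕ} (h2 : h ≤ M.H) (s : S)
    (hN : D.N M.H k ω s (D.π k ω h s) ≠ 0) :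
    D.truncatedCost M y k ω (M.H + 1 - h) s = min (1 / 2) (y k ω s (D.π k ω h s)
      + M.avg s (D.π k ω h s) (D.truncatedCost M y k ω (M.H + 1 - (h + 1)))) := by
  have e1 : M.H + 1 - h = (M.H - h) + 1 := by omega
  have e2 : M.H + 1 - (h + 1) = M.H - h := by omega
  have e3 : M.H - (M.H - h) = h := by omega
  rw [e1, e2, truncatedCost_succ, e3, if_neg hN]

theorem IsRunOf.measurable_truncatedCost [Countable A] [MeasurableSpace Ω] {μ : Measure Ω}
    (hD : D.IsRunOf M μ) (hk : 1 ≤ k) (hym : ∀ s a, Measurable[D.past M.H k] fun ω => y k ω s a)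
    {n : ℕ} (hn : n ≤ M.H) (s : S) :
    Measurable[D.past M.H k] fun ω => D.truncatedCost M y k ω n s := by
  induction n generalizing s with
  | zero => simp only [truncatedCost]; exact measurable_const
  | succ n ih =>
    have hπ := hD.measurable_π k hk (M.H - n) (by rw [Finset.mem_Icc]; omega) s
    have m1 : Measurable[D.past M.H k] fun ω => D.N M.H k ω s (D.π k ω (M.H - n) s) :=
      measurable_apply_countable (g := fun ω a => D.N M.H k ω s a) hπ
        fun a => D.measurable_N M.H k s a
    have m2 : Measurable[D.past M.H k] fun ω => y k ω s (D.π k ω (M.H - n) s) :=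
      measurable_apply_countable (g := fun ω a => y k ω s a) hπ fun a => hym s a
    have m3 : Measurable[D.past M.H k] fun ω => M.avg s (D.π k ω (M.H - n) s)
        (D.truncatedCost M y k ω n) :=
      measurable_apply_countable (g := fun ω a => M.avg s a (D.truncatedCost M y k ω n)) hπ
        fun a => Finset.measurable_sum _ fun s' _ => (ih (by omega) s').const_mul _
    simp only [truncatedCost]
    refine Measurable.ite ?_ measurable_const (measurable_const.min (m2.add m3))
    exact m1 (measurableSet_singleton 0)

/-- The sum of the truncated costs at the starts of the episodes. -/
theorem IsRunOf.failsLE_sum_truncatedCost [Fintype A] [MeasurableSpace Ω] {μ : Measure Ω}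
    [IsProbabilityMeasure μ] (hD : D.IsRunOf M μ)
    (hym : ∀ k ≥ 1, ∀ s a, Measurable[D.past M.H k] fun ω => y k ω s a)
    (hy0 : ∀ k ≥ 1, ∀ ω s a, 0 ≤ y k ω s a) (ℓ : ℝ) (K : ℕ) :
    FailsLE μ (Real.exp (-ℓ)) fun ω => ∑ k ∈ Finset.Icc 1 K,
        D.truncatedCost M y k ω M.H (D.s k 1 ω)
      ≤ 2 * ∑ k ∈ Finset.Icc 1 K, ∑ h ∈ Finset.Icc 1 M.H, D.stepCost M.H y k h ω + ℓ := by
  have := hD.failsLE_sum_potential (z := fun k h ω s => D.truncatedCost M y k ω (M.H + 1 - h) s)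
    (y := y) ?_ hym ?_ ?_ hy0 ?_ ℓ K
  · exact this
  · intro k hk h hh s
    rw [Finset.mem_Icc] at hh
    exact hD.measurable_truncatedCost hk (hym k hk) (by omega) s
  · exact fun k _ h _ ω s => truncatedCost_le ω _ s
  · intro k _ ω s
    simp [truncatedCost]
  · intro k hk h hh ω s hN
    rw [truncatedCost_step (Finset.mem_Icc.1 hh).2 s hN]
    exact min_le_right _ _

end Run

variable {S A Ω : Type*} [DecidableEq S] [DecidableEq A] [Fintype S] [Fintype A] [Nonempty A]

/-- The potential of an episode is bounded by its truncated cost. -/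
theorem potential_le_truncatedCost {D : Run S A Ω} {M : MDP S A} {k : ℕ} {ω : Ω}
    {rh : S → A → ℝ} {q : S → A → S → ℝ} {b : S → A → ℝ} {Vmax : ℝ} {v φ : ℕ → S → ℝ}
    (hp : IsPlan M (D.N M.H k ω) rh q b Vmax v (D.π k ω))
    (hφ : IsSlack M (D.N M.H k ω) rh q b Vmax φ) (hVmax : 0 < Vmax) (hV : M.ValueBounded Vmax)
    (hφV : ∀ h, 1 ≤ h → h ≤ M.H + 1 → ∀ s, φ h s ≤ Vmax / 4) {l : S → A → ℝ}
    (hl : ∀ s a, 0 ≤ l s a)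
    (hq : ∀ s a, D.N M.H k ω s a ≠ 0 → ∀ U : S → ℝ, (∀ s', 0 ≤ U s') →
      (∀ s', U s' ≤ 5 / 4 * Vmax) →
      ∑ s', q s a s' * U s' - M.avg s a U ≤ M.var s a U / (5 * Vmax) + l s a)
    {y : ℕ → Ω → S → A → ℝ} (hy : ∀ s a, y k ω s a = (4 * b s a + 2 * l s a) / (4 * Vmax)) :
    ∀ h, 1 ≤ h → h ≤ M.H + 1 → ∀ s,
      potential M Vmax v φ (D.π k ω) h s ≤ 4 * Vmax * D.truncatedCost M y k ω (M.H + 1 - h) s := by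
  have hy0 : ∀ s a, 0 ≤ y k ω s a := fun s a => by
    rw [hy]; have := hp.b_nonneg s a; have := hl s a; positivity
  refine M.step_induction ?_ ?_
  · intro s
    rw [potential_succ_H hp hφ]
    simp [Run.truncatedCost]
  · intro h h1 h2 ih s
    have hle := potential_le hp hφ hVmax hV hφV h1 (by omega) s
    -- At an unvisited pair nothing is estimated; the cost `1/2`, in units of `4 Vmax`, is the a
    -- priori bound `2 Vmax` on the potential. The same bound allows the minimum with `1/2` at
    -- visited pairs.
    by_cases hN : D.N M.H k ω s (D.π k ω h s) = 0
    · have e1 : M.H + 1 - h = (M.H - h) + 1 := by omega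
      have e3 : M.H - (M.H - h) = h := by omega
      rw [e1, Run.truncatedCost_succ, e3, if_pos hN]
      linarith
    · rw [Run.truncatedCost_step h2 s hN, mul_min_of_nonneg _ _ (by positivity)]
      refine le_min (by linarith) ?_
      refine (potential_drift hp hφ hVmax hV hφV hl hq h1 h2 s hN).trans ?_
      set a := D.π k ω h s
      have e : 4 * Vmax * y k ω s a = 4 * b s a + 2 * l s a := by rw [hy]; field_simp
      rw [mul_add, e]
      gcongr
      refine max_le ?_ ?_
      · exact mul_nonneg (by positivity) (M.avg_nonneg _ _ (Run.truncatedCost_nonneg hy0 _))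
      · rw [← M.avg_const_mul]
        exact M.avg_mono _ _ ih

end EQO

namespace EQO

/-! ### Existence of auxiliary sequences -/

section Levels

variable (m : ℕ → ℕ) (k₀ : ℕ)

/-- The number of values that `m` takes on `[k₀, k]`, but at least `1`. -/
def levelCount (k : ℕ) : ℕ := max 1 ((Finset.Icc k₀ k).image m).card

variable {m k₀}

theorem one_le_levelCount (k : ℕ) : 1 ≤ levelCount m k₀ k := le_max_left _ _

theorem levelCount_of_lt {k : ℕ} (hk : k < k₀) : levelCount m k₀ k = 1 := by
  simp [levelCount, Finset.Icc_eq_empty_of_lt hk]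

theorem levelCount_of_le {k : ℕ} (hk : k₀ ≤ k) :
    levelCount m k₀ k = ((Finset.Icc k₀ k).image m).card := by
  refine max_eq_right (Finset.card_pos.2 ?_)
  exact ⟨m k, Finset.mem_image_of_mem m (by rw [Finset.mem_Icc]; omega)⟩

theorem levelCount_le_self (h₀ : 1 ≤ k₀) {k : ℕ} (hk : 1 ≤ k) : levelCount m k₀ k ≤ k := by
  refine max_le hk (Finset.card_image_le.trans ?_)
  rw [Nat.card_Icc]
  omega

theorem levelCount_le_succ (hm : ∀ i j, k₀ ≤ i → i ≤ j → m i ≤ m j) (k : ℕ) :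
    levelCount m k₀ k ≤ m k + 1 := by
  refine max_le (by omega) ?_
  calc _ ≤ (Finset.range (m k + 1)).card := by
        refine Finset.card_le_card fun x hx => ?_
        obtain ⟨i, hi, rfl⟩ := Finset.mem_image.1 hx
        rw [Finset.mem_Icc] at hi
        rw [Finset.mem_range]
        exact Nat.lt_succ_of_le (hm i k hi.1 hi.2)
    _ = _ := Finset.card_range _

/-- Nested images of equal size coincide, so the later level was already attained, and monotonicity
makes it equal to the earlier one. Hence a parameter chosen per count depends only on the level. -/
theorem eq_of_levelCount_eq (hm : ∀ i j, k₀ ≤ i → i ≤ j → m i ≤ m j) {k l : ℕ} (hk : k₀ ≤ k)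
    (hl : k₀ ≤ l) (h : levelCount m k₀ k = levelCount m k₀ l) : m k = m l := by
  wlog hkl : k ≤ l generalizing k l
  · exact (this hl hk h.symm (by omega)).symm
  rw [levelCount_of_le hk, levelCount_of_le hl] at h
  have he := Finset.eq_of_subset_of_card_le
    (Finset.image_subset_image (f := m) (Finset.Icc_subset_Icc_right (a := k₀) hkl)) h.ge
  have : m l ∈ (Finset.Icc k₀ k).image m := by
    rw [he]; exact Finset.mem_image_of_mem m (by rw [Finset.mem_Icc]; omega)
  obtain ⟨i, hi, hil⟩ := Finset.mem_image.1 this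
  rw [Finset.mem_Icc] at hi
  exact le_antisymm (hm k l hk hkl) (hil ▸ hm i k hi.1 hi.2)

end Levels

theorem exists_dyadic_level {x : ℝ} (hx : 1 ≤ x) :
    2 ^ Nat.log 2 ⌊x⌋₊ ≤ x ∧ x ≤ 2 * 2 ^ Nat.log 2 ⌊x⌋₊ := by
  have h1 : ⌊x⌋₊ ≠ 0 := (Nat.floor_pos.2 hx).ne'
  have h2 : (2 : ℝ) ^ Nat.log 2 ⌊x⌋₊ ≤ ⌊x⌋₊ := by exact_mod_cast Nat.pow_log_le_self 2 h1
  have h3 := Nat.lt_pow_succ_log_self (b := 2) (by norm_num) ⌊x⌋₊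
  have h4 := (Nat.floor_lt (by linarith)).1 h3
  push_cast at h4
  exact ⟨h2.trans (Nat.floor_le (by linarith)), by rw [← pow_succ']; exact h4.le⟩

variable {S A : Type*} [Fintype S] [Fintype A] [Nonempty S] [Nonempty A]

/-- The factor grows by `2 log i ≤ 2m`, while `ell₁ M 1 δ` is at least `3` and `m + 1 ≤ 2^m`. So
logarithmic factors never outgrow the dyadic levels. -/
theorem ell₁_le_two_pow_mul (M : MDP S A) {δ : ℝ} (hδ : δ ∈ Set.Ioc (0 : ℝ) 1) {i m : ℕ}
    (hi : 1 ≤ i) (him : i ≤ m + 1) : ell₁ M i δ ≤ 2 ^ m * ell₁ M 1 δ := by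
  have hB := baseFactor_ge_32 M hδ
  have h3 := ell₁_ge M hδ le_rfl
  have hi0 : (0 : ℝ) < i := by exact_mod_cast hi
  have e : ell₁ M i δ = ell₁ M 1 δ + 2 * Real.log i := by
    rw [ell₁_eq, ell₁_eq, Real.log_mul (by positivity) (by positivity), Real.log_pow]
    simp
  have hlog : Real.log i ≤ m := by
    have h1 := Real.log_le_sub_one_of_pos hi0
    have h2 : (i : ℝ) ≤ m + 1 := by exact_mod_cast him
    linarith
  have hm : (m : ℝ) + 1 ≤ 2 ^ m := by exact_mod_cast Nat.lt_two_pow_self (n := m)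
  have hm0 : (0 : ℝ) ≤ m := by positivity
  nlinarith

/-- From the first index at which `c₁` reaches the threshold, with value `a`, the dyadic level
satisfies `a 2^m ≤ c₁ ≤ 2 a 2^m`. With `λ = 2ℓ₁/(a 2^m)` the term `ℓ₁/λ` is half of `a 2^m` and
`4ℓ₁/λ` equals `2 a 2^m`; the threshold makes the remaining term at most the other half and ensures
`λ Vα ≤ 1`. Counting attained levels, rather than using the level itself, keeps `ι k ≤ k` even if
`c₁` jumps. -/
theorem exists_isAuxiliary [DecidableEq S] (M : MDP S A) (σ : ℕ → S → A → ℝ) {Vα : ℝ}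
    (hVα : 0 ≤ Vα) {c₁ : ℕ → ℝ}
    (hc₁ : ∀ k ≥ 1, 0 < c₁ k) (hmono : MonotoneOn c₁ (Set.Ici 1)) {δ : ℝ}
    (hδ : δ ∈ Set.Ioc (0 : ℝ) 1) :
    ∃ (lam : ℕ → ℝ) (ι : ℕ → ℕ), IsAuxiliary M σ Vα δ c₁ lam ι ∧
      ∀ k ≥ 1, ι k ≤ k ∧ (ι k : ℝ) ≤ 3 + Real.logb 2 (c₁ k / c₁ 1) := by
  classical
  obtain ⟨W, w, hW⟩ := M.exists_maxProxy σ
  have hWd := hW.WdiffStar_nonneg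
  have hlogb : ∀ k ≥ 1, 0 ≤ Real.logb 2 (c₁ k / c₁ 1) := fun k hk =>
    Real.logb_nonneg (by norm_num) ((one_le_div (hc₁ 1 le_rfl)).2
      (hmono (Set.mem_Ici.2 le_rfl) (Set.mem_Ici.2 hk) hk))
  have hdefault : 0 < 1 / (Vα + 1) ∧ 1 / (Vα + 1) * Vα ≤ 1 := by
    refine ⟨by positivity, ?_⟩
    rw [div_mul_eq_mul_div, div_le_one (by positivity)]
    linarith
  by_cases hex : ∃ k, 1 ≤ k ∧ threshold₁ M σ Vα δ ≤ c₁ k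
  swap
  · push Not at hex
    refine ⟨fun _ => 1 / (Vα + 1), fun _ => 1, ⟨fun _ _ => hdefault.1, fun _ _ => hdefault.2,
      fun _ _ => le_rfl, fun k hk h => absurd h (not_le.2 (hex k hk)),
      fun k hk h => absurd h (not_le.2 (hex k hk)), fun _ _ _ => rfl⟩, fun k hk => ⟨hk, ?_⟩⟩
    have := hlogb k hk
    push_cast
    linarith
  set k₀ := Nat.find hex with hk₀
  obtain ⟨h₀, hθ⟩ : 1 ≤ k₀ ∧ threshold₁ M σ Vα δ ≤ c₁ k₀ := Nat.find_spec hex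
  have hge : ∀ k ≥ 1, threshold₁ M σ Vα δ ≤ c₁ k → k₀ ≤ k := fun k hk h =>
    Nat.find_min' hex ⟨hk, h⟩
  have hlt : ∀ k ≥ 1, c₁ k < threshold₁ M σ Vα δ → k < k₀ := by
    intro k hk h
    by_contra hcon
    have := hmono (Set.mem_Ici.2 h₀) (Set.mem_Ici.2 hk) (not_lt.1 hcon)
    linarith
  set a := c₁ k₀ with ha
  have ha0 : 0 < a := hc₁ k₀ h₀
  set m : ℕ → ℕ := fun k => Nat.log 2 ⌊c₁ k / a⌋₊ with hm
  have hmle : ∀ i j, k₀ ≤ i → i ≤ j → m i ≤ m j := fun i j hi hij =>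
    Nat.log_mono_right (Nat.floor_mono (div_le_div_of_nonneg_right
      (hmono (Set.mem_Ici.2 (h₀.trans hi)) (Set.mem_Ici.2 (h₀.trans (hi.trans hij))) hij) ha0.le))
  have hlevel : ∀ k, k₀ ≤ k → a * 2 ^ m k ≤ c₁ k ∧ c₁ k ≤ 2 * (a * 2 ^ m k) := by
    intro k hk
    have h1 : 1 ≤ c₁ k / a := (one_le_div ha0).2
      (hmono (Set.mem_Ici.2 h₀) (Set.mem_Ici.2 (h₀.trans hk)) hk)
    obtain ⟨e1, e2⟩ := exists_dyadic_level h1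
    rw [le_div_iff₀ ha0] at e1
    rw [div_le_iff₀ ha0] at e2
    exact ⟨by linarith, by linarith⟩
  set ι := levelCount m k₀ with hι
  set L := ell₁ M 1 δ with hL
  have hL3 : 3 ≤ L := ell₁_ge M hδ le_rfl
  have hθ1 : 2 * √(13 * M.WdiffStar σ) * L ≤ a := le_trans
    (mul_le_mul_of_nonneg_right (le_max_left _ _) (by linarith)) hθ
  have hθ2 : 2 * Vα * L ≤ a := le_trans
    (mul_le_mul_of_nonneg_right (le_max_right _ _) (by linarith)) hθ
  have hsq : 52 * M.WdiffStar σ * L ^ 2 ≤ a ^ 2 := by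
    have h1 := pow_le_pow_left₀ (by positivity) hθ1 2
    rw [mul_pow, mul_pow, Real.sq_sqrt (by positivity)] at h1
    linarith
  -- Any index with the given count may be chosen, since the count determines the level. Unused
  -- indices get a default that is admissible also for `Vα = 0`.
  set lam : ℕ → ℝ := fun i => if h : ∃ k, k₀ ≤ k ∧ ι k = i then
    2 * ell₁ M i δ / (a * 2 ^ m h.choose) else 1 / (Vα + 1) with hlam
  have hlam_eq : ∀ k, k₀ ≤ k → lam (ι k) = 2 * ell₁ M (ι k) δ / (a * 2 ^ m k) := by
    intro k hk
    have hx : ∃ l, k₀ ≤ l ∧ ι l = ι k := ⟨k, hk, rfl⟩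
    simp only [hlam, dif_pos hx]
    rw [eq_of_levelCount_eq hmle hx.choose_spec.1 hk hx.choose_spec.2]
  have hell : ∀ k, 3 ≤ ell₁ M (ι k) δ ∧ ell₁ M (ι k) δ ≤ 2 ^ m k * L := fun k =>
    ⟨ell₁_ge M hδ (one_le_levelCount k),
      ell₁_le_two_pow_mul M hδ (one_le_levelCount k) (levelCount_le_succ hmle k)⟩
  refine ⟨lam, ι, ⟨fun i _ => ?_, fun i _ => ?_, fun k _ => one_le_levelCount k,
    fun k hk h => ?_, fun k hk h => ?_, fun k hk h => levelCount_of_lt (hlt k hk h)⟩,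
    fun k hk => ⟨levelCount_le_self h₀ hk, ?_⟩⟩
  · by_cases h : ∃ k, k₀ ≤ k ∧ ι k = i
    · obtain ⟨k, hk, rfl⟩ := h
      rw [hlam_eq k hk]
      have := (hell k).1
      positivity
    · simp only [hlam, dif_neg h]
      exact hdefault.1
  · by_cases h : ∃ k, k₀ ≤ k ∧ ι k = i
    · obtain ⟨k, hk, rfl⟩ := h
      rw [hlam_eq k hk, div_mul_eq_mul_div, div_le_one (by positivity)]
      calc 2 * ell₁ M (ι k) δ * Vα ≤ 2 * (2 ^ m k * L) * Vα := by gcongr; exact (hell k).2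
        _ = 2 * Vα * L * 2 ^ m k := by ring
        _ ≤ a * 2 ^ m k := by gcongr
    · simp only [hlam, dif_neg h]
      exact hdefault.2
  · have hk' := hge k hk h
    obtain ⟨e1, e2⟩ := hell k
    rw [hlam_eq k hk']
    refine le_trans ?_ (hlevel k hk').1
    set l := ell₁ M (ι k) δ
    set p : ℝ := 2 ^ m k with hp
    have hp1 : 1 ≤ p := one_le_pow₀ (by norm_num)
    have hl : l / (2 * l / (a * p)) = a * p / 2 := by field_simp
    rw [hl]
    have : 13 * (2 * l / (a * p)) * M.WdiffStar σ * L ≤ a * p / 2 := by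
      have e : 13 * (2 * l / (a * p)) * M.WdiffStar σ * L
          = 26 * l * M.WdiffStar σ * L / (a * p) := by ring
      rw [e, div_le_iff₀ (by positivity)]
      -- The part `2√(13 W_diff)` of the threshold enters through its square, `52 W_diff L² ≤ a²`.
      calc 26 * l * M.WdiffStar σ * L ≤ 26 * (p * L) * M.WdiffStar σ * L := by gcongr
        _ = 52 * M.WdiffStar σ * L ^ 2 * (p / 2) := by ring
        _ ≤ a ^ 2 * (p / 2) := by gcongr
        _ ≤ a ^ 2 * (p / 2) * p := le_mul_of_one_le_right (by positivity) hp1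
        _ = _ := by ring
    linarith
  · have hk' := hge k hk h
    obtain ⟨e1, -⟩ := hell k
    rw [hlam_eq k hk']
    refine (hlevel k hk').2.trans (le_of_eq ?_)
    field_simp
    ring
  · rcases Nat.lt_or_ge k k₀ with h | h
    · rw [hι, levelCount_of_lt h]
      have := hlogb k hk
      push_cast
      linarith
    · have h1 : (ι k : ℝ) ≤ m k + 1 := by exact_mod_cast levelCount_le_succ hmle k
      have hc1 := hc₁ 1 le_rfl
      have h2 : (m k : ℝ) ≤ Real.logb 2 (c₁ k / c₁ 1) := by
        rw [Real.le_logb_iff_rpow_le (by norm_num) (div_pos (hc₁ k hk) hc1), Real.rpow_natCast,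
          le_div_iff₀ hc1]
        refine le_trans ?_ (hlevel k h).1
        rw [mul_comm]
        gcongr
        exact hmono (Set.mem_Ici.2 le_rfl) (Set.mem_Ici.2 h₀) h₀
      linarith

end EQO

/-! ### Assembly of the regret bound -/

namespace EQO

variable {S A Ω : Type*} [Fintype S] [DecidableEq S]

section Kappa

variable [Fintype A] {M : MDP S A} {σ : ℕ → S → A → ℝ} {Vα Vmax δ : ℝ} {c₁ : ℕ → ℝ}
  {c₂ : ℕ → ℝ≥0∞} {ι : ℕ → ℕ}
  {K : ℕ}

theorem kappaMin_le : kappaMin M σ Vα Vmax δ c₁ c₂ ι K ≤ K := by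
  have h : min (kappa M σ Vα Vmax δ c₁ c₂ ι) (K : ℕ∞) ≤ (K : ℕ∞) := min_le_right _ _
  exact ENat.toNat_le_of_le_natCast h

/-- Any `k` violating a threshold is at most `κ`, and an index `k ≤ K` beyond `κ ∧ K` is beyond `κ`.
-/
theorem above_of_kappaMin_lt {k : ℕ} (hk : kappaMin M σ Vα Vmax δ c₁ c₂ ι K < k) (hkK : k ≤ K) :
    threshold₁ M σ Vα δ ≤ c₁ k ∧ ENNReal.ofReal ((M.sigmaMax σ Vα Vmax
      + 6 * M.WdiffStar σ * ell₁ M (ι k) δ / c₁ k) * √(ell₂ M k δ)) ≤ c₂ k := by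
  rw [← not_lt, ← not_lt, ← not_or]
  intro h
  have h1 : (k : ℕ∞) ≤ kappa M σ Vα Vmax δ c₁ c₂ ι := le_sSup ⟨k, ⟨by omega, h⟩, rfl⟩
  have h2 : (k : ℕ∞) ≤ min (kappa M σ Vα Vmax δ c₁ c₂ ι) (K : ℕ∞) :=
    le_min h1 (by exact_mod_cast hkK)
  have h3 : k ≤ kappaMin M σ Vα Vmax δ c₁ c₂ ι K := by
    have h4 : min (kappa M σ Vα Vmax δ c₁ c₂ ι) (K : ℕ∞) ≠ ⊤ :=
      ne_top_of_le_ne_top (ENat.natCast_ne_top K) (min_le_right _ _)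
    have := ENat.toNat_le_toNat h2 h4
    simpa [kappaMin] using this
  omega

end Kappa

variable {M : MDP S A} {D : Run S A Ω}

theorem regret_le_of_episode_bounds [Fintype A] [Nonempty A] {Vmax : ℝ} (hVmax : 0 ≤ Vmax)
    (hV : M.ValueBounded Vmax)
    {n K : ℕ} (hn : n ≤ K) {ω : Ω} {t : ℕ → ℝ}
    (h : ∀ k ∈ Finset.Icc (n + 1) K,
      M.Vstar 1 (D.s k 1 ω) - M.V (D.π k ω) 1 (D.s k 1 ω) ≤ t k) :
    D.regret M K ω ≤ Vmax * n + ∑ k ∈ Finset.Icc (n + 1) K, t k := by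
  have hH := M.one_le_H
  have e : Finset.Icc 1 K = Finset.Icc 1 n ∪ Finset.Icc (n + 1) K := by
    ext i; simp only [Finset.mem_union, Finset.mem_Icc]; omega
  have hdisj : Disjoint (Finset.Icc 1 n) (Finset.Icc (n + 1) K) := by
    rw [Finset.disjoint_left]
    intro i hi hi'
    rw [Finset.mem_Icc] at hi hi'
    omega
  rw [Run.regret, e, Finset.sum_union hdisj]
  refine add_le_add ?_ (Finset.sum_le_sum h)
  calc _ ≤ ∑ _k ∈ Finset.Icc 1 n, Vmax := Finset.sum_le_sum fun k _ => by
        have h1 := M.Vstar_mem hVmax hV le_rfl (by omega) (D.s k 1 ω)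
        have h2 := M.V_mem hVmax hV (D.π k ω) le_rfl (by omega) (D.s k 1 ω)
        linarith [h1.2, h2.1]
    _ = Vmax * n := by simp [mul_comm]

theorem distRegret_le_of_failsLE [MeasurableSpace Ω] {μ : Measure Ω} {K : ℕ} {δ B : ℝ}
    (h : FailsLE μ δ fun ω => D.regret M K ω ≤ B) :
    D.distRegret M μ K δ ≤ (B : EReal) := by
  refine sInf_le ⟨B, ?_, rfl⟩
  simpa only [FailsLE, not_le, Set.mem_ofPred_eq] using h

variable [Fintype A] [DecidableEq A]

open Classical in
/-- Summation of the bonuses along the trajectories. -/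
theorem sum_bonus_le {c₁ : ℕ → ℝ} (hc₁ : ∀ k ≥ 1, 0 < c₁ k) (hc₁_mono : MonotoneOn c₁ (Set.Ici 1))
    {c₂ : ℕ → ℝ≥0∞} (hc₂_mono : MonotoneOn c₂ (Set.Ici 1)) {K : ℕ} (hK : 1 ≤ K) (ω : Ω) :
    8 * ∑ k ∈ Finset.Icc 1 K, ∑ h ∈ Finset.Icc 1 M.H, (if D.Doubling M.H k h ω then 0
        else D.bonus c₁ c₂ M.H k ω (D.s k h ω) (D.a k h ω))
      ≤ minMul (16 * c₁ K * Fintype.card S * Fintype.card A * Real.log (K * M.H))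
        (c₂ K) (16 * √2 * √(M.H * Fintype.card S * Fintype.card A * K)) := by
  have hsum : ∀ (C : ℝ) (f : ℕ → ℝ), (∀ k ∈ Finset.Icc 1 K, ∀ s a,
      D.bonus c₁ c₂ M.H k ω s a ≤ C * f (D.N M.H k ω s a)) →
      8 * ∑ k ∈ Finset.Icc 1 K, ∑ h ∈ Finset.Icc 1 M.H, (if D.Doubling M.H k h ω then 0
        else D.bonus c₁ c₂ M.H k ω (D.s k h ω) (D.a k h ω))
      ≤ 8 * (C * ∑ k ∈ Finset.Icc 1 K, ∑ h ∈ Finset.Icc 1 M.H, (if D.Doubling M.H k h ω then 0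
        else f (D.N M.H k ω (D.s k h ω) (D.a k h ω)))) := by
    intro C f hf
    refine mul_le_mul_of_nonneg_left ?_ (by norm_num)
    simp_rw [Finset.mul_sum]
    refine Finset.sum_le_sum fun k hk => Finset.sum_le_sum fun h _ => ?_
    split_ifs
    · simp
    · exact hf k hk _ _
  refine le_minMul ?_ fun hfin => ?_
  · refine (hsum (c₁ K) (fun n => 1 / (n : ℝ)) fun k hk s a => ?_).trans ?_
    · refine (minMul_le_left _ _ _).trans ?_
      rw [Finset.mem_Icc] at hk
      rw [mul_one_div]
      exact div_le_div_of_nonneg_right (hc₁_mono (Set.mem_Ici.2 hk.1) (Set.mem_Ici.2 hK) hk.2)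
        (by positivity)
    · have h1 := D.sum_inv_N_le M.H K hK M.one_le_H ω
      have h2 := mul_le_mul_of_nonneg_left h1 (hc₁ K hK).le
      linarith
  · refine (hsum (c₂ K).toReal (fun n => 1 / √(n : ℝ)) fun k hk s a => ?_).trans ?_
    · rw [Finset.mem_Icc] at hk
      have hle := hc₂_mono (Set.mem_Ici.2 hk.1) (Set.mem_Ici.2 hK) hk.2
      refine (minMul_le_right (ne_top_of_le_ne_top hfin hle) _).trans ?_
      exact mul_le_mul_of_nonneg_right (ENNReal.toReal_mono hfin hle) (by positivity)
    · have h1 := D.sum_inv_sqrt_N_le M.H K ω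
      have h2 := mul_le_mul_of_nonneg_left h1 (ENNReal.toReal_nonneg (a := c₂ K))
      linarith

/-- The cost of a step: its bonus and the error of the transition estimates, in units of
`4 Vmax`. -/
def visitCost (D : Run S A Ω) (M : MDP S A) (c₁ : ℕ → ℝ) (c₂ : ℕ → ℝ≥0∞) (Vmax δ : ℝ) (k : ℕ)
    (ω : Ω) (s : S) (a : A) : ℝ :=
  (4 * D.bonus c₁ c₂ M.H k ω s a
    + 2 * (15 / 2 * Fintype.card S * Vmax * ell₂ M k δ / D.N M.H k ω s a)) / (4 * Vmax)

theorem measurable_visitCost (D : Run S A Ω) (M : MDP S A) (c₁ : ℕ → ℝ) (c₂ : ℕ → ℝ≥0∞)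
    (Vmax δ : ℝ) (k : ℕ) (s : S) (a : A) :
    Measurable[D.past M.H k] fun ω => visitCost D M c₁ c₂ Vmax δ k ω s a :=
  (((D.measurable_bonus c₁ c₂ M.H k s a).const_mul 4).add
    ((measurable_from_nat (f := fun n : ℕ => 15 / 2 * Fintype.card S * Vmax * ell₂ M k δ
      / (n : ℝ))).comp (D.measurable_N M.H k s a) |>.const_mul 2)).div_const _

variable [Nonempty S] [Nonempty A]

theorem visitCost_nonneg {c₁ : ℕ → ℝ} {c₂ : ℕ → ℝ≥0∞} {Vmax δ : ℝ} (hVmax : 0 ≤ Vmax)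
    (hδ : δ ∈ Set.Ioc (0 : ℝ) 1) {k : ℕ} (hk : 1 ≤ k) (hc₁ : 0 < c₁ k) (ω : Ω) (s : S) (a : A) :
    0 ≤ visitCost D M c₁ c₂ Vmax δ k ω s a := by
  have h1 := D.bonus_nonneg c₂ M.H hc₁.le ω s a
  have h2 := ell₂_ge M hδ hk
  unfold visitCost
  positivity

open Classical in
/-- The total cost along the trajectories. -/
theorem sum_stepCost_visitCost_le {c₁ : ℕ → ℝ} (hc₁ : ∀ k ≥ 1, 0 < c₁ k)
    (hc₁_mono : MonotoneOn c₁ (Set.Ici 1)) {c₂ : ℕ → ℝ≥0∞} (hc₂_mono : MonotoneOn c₂ (Set.Ici 1))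
    {Vmax δ : ℝ} (hVmax : 0 < Vmax) (hδ : δ ∈ Set.Ioc (0 : ℝ) 1) {K : ℕ} (hK : 1 ≤ K) (ω : Ω) :
    4 * Vmax * (2 * ∑ k ∈ Finset.Icc 1 K, ∑ h ∈ Finset.Icc 1 M.H,
        D.stepCost M.H (visitCost D M c₁ c₂ Vmax δ) k h ω + Real.log (32 / δ))
      ≤ minMul (16 * c₁ K * Fintype.card S * Fintype.card A * Real.log (K * M.H))
          (c₂ K) (16 * √2 * √(M.H * Fintype.card S * Fintype.card A * K))
        + 72 * Vmax * (Fintype.card S : ℝ) ^ 2 * Fintype.card A * ell₂ M K δ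
          * Real.log (2 * K * M.H) := by
  obtain ⟨hH1, hS1, hA1⟩ := card_factor_ge_one M
  have hK1 : (1 : ℝ) ≤ K := by exact_mod_cast hK
  have hL := ell₂_ge M hδ hK
  set s : ℝ := (Fintype.card S : ℝ) with hs
  set a : ℝ := (Fintype.card A : ℝ) with ha
  set L := ell₂ M K δ with hLdef
  set X := ∑ k ∈ Finset.Icc 1 K, ∑ h ∈ Finset.Icc 1 M.H, (if D.Doubling M.H k h ω then 0
        else D.bonus c₁ c₂ M.H k ω (D.s k h ω) (D.a k h ω)) with hX
  set Y := ∑ k ∈ Finset.Icc 1 K, ∑ h ∈ Finset.Icc 1 M.H, (if D.Doubling M.H k h ω then 0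
        else 1 / (D.N M.H k ω (D.s k h ω) (D.a k h ω) : ℝ)) with hY
  set Z := ∑ k ∈ Finset.Icc 1 K, ∑ h ∈ Finset.Icc 1 M.H,
        (if ¬ D.Stopped M.H k h ω ∧ D.Doubling M.H k h ω then (1 : ℝ) else 0) with hZ
  have hXb := sum_bonus_le (D := D) (M := M) hc₁ hc₁_mono hc₂_mono hK ω
  have hYb : Y ≤ 2 * (s * a * Real.log (K * M.H)) :=
    D.sum_inv_N_le M.H K hK M.one_le_H ω
  have hZb : Real.log 2 * Z ≤ s * a * Real.log (2 * K * M.H) :=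
    D.sum_first_doubling_le M.H K hK M.one_le_H ω
  have hstep : 4 * Vmax * ∑ k ∈ Finset.Icc 1 K, ∑ h ∈ Finset.Icc 1 M.H,
      D.stepCost M.H (visitCost D M c₁ c₂ Vmax δ) k h ω
      ≤ 4 * X + 15 * s * Vmax * L * Y + 2 * Vmax * Z := by
    rw [hX, hY, hZ]
    simp_rw [Finset.mul_sum, ← Finset.sum_add_distrib]
    refine Finset.sum_le_sum fun k hk => Finset.sum_le_sum fun h _ => ?_
    rw [Finset.mem_Icc] at hk
    have h1 := mul_le_mul_of_nonneg_left (D.stepCost_le (H := M.H) (h := h)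
      (visitCost_nonneg (D := D) (M := M) (c₂ := c₂) hVmax.le hδ hk.1 (hc₁ k hk.1) ω
        (D.s k h ω) (D.a k h ω))) (show 0 ≤ 4 * Vmax by positivity)
    refine h1.trans ?_
    have hmono := ell₂_mono M hδ hk.1 hk.2
    by_cases hd : D.Doubling M.H k h ω
    · by_cases hst : D.Stopped M.H k h ω <;> simp [hd, hst]
      linarith
    · simp only [hd, if_false, and_false, mul_zero, add_zero]
      rw [visitCost, mul_div_cancel₀ _ (by positivity)]
      set n : ℝ := (D.N M.H k ω (D.s k h ω) (D.a k h ω) : ℝ)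
      have hn : 0 ≤ 1 / n := by positivity
      have e : 2 * (15 / 2 * s * Vmax * ell₂ M k δ / n) = 15 * s * Vmax * ell₂ M k δ * (1 / n) := by
        ring
      rw [e]
      gcongr
  have hlog2 := Real.log_two_gt_d9
  have hKH : (1 : ℝ) ≤ K * M.H := one_le_mul_of_one_le_of_one_le hK1 hH1
  have hlogle : Real.log (K * M.H) ≤ Real.log (2 * K * M.H) :=
    Real.log_le_log (by positivity) (by linarith)
  have hlog2le : Real.log 2 ≤ Real.log (2 * K * M.H) :=
    Real.log_le_log (by norm_num) (by linarith)
  set T := Real.log (2 * K * M.H) with hT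
  have hT0 : 0 < T := by linarith
  have hδL : Real.log (32 / δ) ≤ L := by
    rw [hLdef, ell₂]
    have hδ0 := hδ.1
    refine Real.log_le_log (by positivity) (div_le_div_of_nonneg_right ?_ hδ0.le)
    have h2 := two_le_log M hK
    have h4 : (1 : ℝ) ≤ Real.log (Real.exp 2 * K * M.H) ^ 2 := one_le_pow₀ (by linarith)
    have := one_le_HSA M
    have h5 := one_le_mul_of_one_le_of_one_le this h4
    rw [← hs, ← ha] at h5
    linarith
  have hsa : s * a ≤ s ^ 2 * a :=
    mul_le_mul_of_nonneg_right (le_self_pow₀ hS1 (by norm_num)) (by linarith)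
  have hsa1 : 1 ≤ s ^ 2 * a := (one_le_mul_of_one_le_of_one_le hS1 hA1).trans hsa
  have hQ : 0 < Vmax * (s ^ 2 * a) * T := by positivity
  -- In units of `Vmax S² A L log(2KH)` the transition errors contribute `60`, the doubling steps
  -- `2` (as `L ≥ 3`) and the logarithm of the failure probability `6`, together less than `72`.
  have b1 : 30 * s * Vmax * L * Y ≤ 60 * (Vmax * (s ^ 2 * a) * L * T) := by
    calc 30 * s * Vmax * L * Y ≤ 30 * s * Vmax * L * (2 * (s * a * T)) := by
          gcongr
          exact hYb.trans (by gcongr)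
      _ = _ := by ring
  have b2 : 4 * Vmax * Z ≤ 6 * (Vmax * (s ^ 2 * a) * T) := by
    have h1 : Z * (2 / 3) ≤ s ^ 2 * a * T := by
      have hZ0 : 0 ≤ Z := Finset.sum_nonneg fun _ _ => Finset.sum_nonneg fun _ _ => by
        split_ifs <;> norm_num
      calc Z * (2 / 3) ≤ Z * Real.log 2 := by gcongr; linarith
        _ ≤ s * a * T := by linarith
        _ ≤ _ := by gcongr
    nlinarith
  have b3 : 4 * Vmax * Real.log (32 / δ) ≤ 6 * (Vmax * (s ^ 2 * a) * L * T) := by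
    have h1 : 1 ≤ s ^ 2 * a * (3 / 2 * T) := one_le_mul_of_one_le_of_one_le hsa1 (by linarith)
    calc 4 * Vmax * Real.log (32 / δ) ≤ 4 * Vmax * L := by gcongr
      _ ≤ 4 * Vmax * L * (s ^ 2 * a * (3 / 2 * T)) := le_mul_of_one_le_right (by positivity) h1
      _ = _ := by ring
  have b4 : 6 * (Vmax * (s ^ 2 * a) * T) ≤ 2 * (Vmax * (s ^ 2 * a) * L * T) := by nlinarith
  have hXb' : 8 * X ≤ minMul (16 * c₁ K * s * a * Real.log (K * M.H))
          (c₂ K) (16 * √2 * √(M.H * s * a * K)) := hXb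
  have b5 : 0 < Vmax * (s ^ 2 * a) * L * T := by positivity
  linarith

variable [MeasurableSpace Ω] {μ : Measure Ω} [IsProbabilityMeasure μ]

/-- With high probability the suboptimality of every episode after `κ` is bounded by its truncated
cost, up to the price of quasi-optimism. -/
theorem Run.IsRunOf.failsLE_suboptimality (hD : D.IsRunOf M μ) {Vmax : ℝ} (hVmax : 0 < Vmax)
    (hV : M.ValueBounded Vmax) {σ : ℕ → S → A → ℝ} (hσ : ∀ h s a, 0 ≤ σ h s a) {Vα : ℝ}
    (hVα : 0 ≤ Vα) (hsub : SubExponentialReturns D M μ σ Vα) {c₁ : ℕ → ℝ}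
    (hc₁ : ∀ k ≥ 1, 0 < c₁ k) {c₂ : ℕ → ℝ≥0∞} (halg : D.FollowsEQOPlus M.H c₁ c₂ Vmax) (K : ℕ)
    {δ : ℝ} (hδ : δ ∈ Set.Ioc (0 : ℝ) 1) {lam : ℕ → ℝ} {ι : ℕ → ℕ}
    (haux : IsAuxiliary M σ Vα δ c₁ lam ι) :
    FailsLE μ (17 / 32 * δ) fun ω =>
      ∀ k ∈ Finset.Icc (kappaMin M σ Vα Vmax δ c₁ c₂ ι K + 1) K,
      M.Vstar 1 (D.s k 1 ω) - M.V (D.π k ω) 1 (D.s k 1 ω)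
        ≤ 4 * Vmax * D.truncatedCost M (visitCost D M c₁ c₂ Vmax δ) k ω M.H (D.s k 1 ω)
          + 18 * M.Wstar σ * ell₁ M (ι k) δ / c₁ k := by
  obtain ⟨W, w, hW⟩ := M.exists_maxProxy σ
  have hδ0 := hδ.1
  -- Only the parameters used up to episode `K` are needed. The five events together fail with
  -- probability at most `4 · δ/8 + δ/32`.
  set n := (Finset.Icc 1 K).sup ι with hn
  refine (((((hD.failsLE_dev_linear hsub hδ haux.lam_pos haux.lam_le n K).and
    (hD.failsLE_dev_sqrt hσ hVα hVmax.le hsub hδ K) (by positivity) (by positivity)).and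
    (hD.failsLE_devP_linear hW hδ K) (by positivity) (by positivity)).and
    (hD.failsLE_devP_sqrt hW hδ K) (by positivity) (by positivity)).and
    (hD.failsLE_devP_all hδ hVmax K) (by positivity) (by positivity)).mono (by linarith) ?_
  rintro ω ⟨⟨⟨⟨g1, g2⟩, g3⟩, g4⟩, g5⟩ k hk
  rw [Finset.mem_Icc] at hk
  have hk1 : 1 ≤ k := by omega
  have hkK : k ∈ Finset.Icc 1 K := by rw [Finset.mem_Icc]; omega
  have hH := M.one_le_H
  have hι := haux.one_le k hk1
  have hck := hc₁ k hk1
  have hl3 := ell₁_ge M hδ hι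
  have hlam := haux.lam_pos (ι k) hι
  obtain ⟨hab₁, hab₂⟩ := above_of_kappaMin_lt (Nat.lt_of_succ_le hk.1) hk.2
  have hlow := haux.lower k hk1 hab₁
  have hup := haux.upper k hk1 hab₁
  have hy0 := fun s a => visitCost_nonneg (D := D) (M := M) (c₂ := c₂) hVmax.le hδ hk1 hck ω s a
  have hz0 := Run.truncatedCost_nonneg (D := D) (M := M) hy0 M.H (D.s k 1 ω)
  -- If the price of quasi-optimism is at least `Vmax`, the claim is trivial; otherwise the slack is
  -- below `Vmax/4`, as the potential argument requires.
  rcases le_or_gt Vmax (18 * M.Wstar σ * ell₁ M (ι k) δ / c₁ k) with htriv | hlt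
  · have h1 := M.Vstar_mem hVmax.le hV le_rfl (by omega) (D.s k 1 ω)
    have h2 := M.V_mem hVmax.le hV (D.π k ω) le_rfl (by omega) (D.s k 1 ω)
    have : 0 ≤ 4 * Vmax
        * D.truncatedCost M (visitCost D M c₁ c₂ Vmax δ) k ω M.H (D.s k 1 ω) := by positivity
    linarith [h1.2, h2.1]
  have hslack := isSlack_slackShape (D := D) (Vmax := Vmax) (ω := ω) hW hck hlam
    (by linarith) hlow hup hab₂
    (fun j hj s a hN => g1 (ι k) (by rw [Finset.mem_Icc]; exact ⟨hι, Finset.le_sup (f := ι) hkK⟩)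
      j hj s a k hkK hN)
    (fun j hj s a hN => g2 j hj s a k hkK hN) (fun j hj s a hN => g3 j hj s a k hkK hN)
    (fun j hj s a hN => g4 j hj s a k hkK hN)
  have hplan := halg.isPlan hk1 hck ω
  have hWs := hW.Wstar_nonneg
  have hφ : ∀ h, 1 ≤ h → h ≤ M.H + 1 → ∀ s, lam (ι k) * slackShape (M.WdiffStar σ) W w h s
      ≤ 18 * M.Wstar σ * ell₁ M (ι k) δ / c₁ k / 4 := by
    intro h h1 h2 s
    -- With the slack shape at most `9/8 W*`, this gives `φ ≤ 9/2 W* ℓ₁/c₁`; regret pays four times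
    -- `φ`, hence the constant `18`.
    have hle : lam (ι k) ≤ 4 * ell₁ M (ι k) δ / c₁ k := by
      rw [le_div_iff₀ hck]
      rw [le_div_iff₀ hlam] at hup
      linarith
    calc lam (ι k) * slackShape (M.WdiffStar σ) W w h s
        ≤ lam (ι k) * (9 / 8 * M.Wstar σ) :=
          mul_le_mul_of_nonneg_left (slackShape_le hW h1 h2 s) hlam.le
      _ ≤ 4 * ell₁ M (ι k) δ / c₁ k * (9 / 8 * M.Wstar σ) := by gcongr
      _ = _ := by ring
  have hpot := potential_le_truncatedCost (y := visitCost D M c₁ c₂ Vmax δ) hplan hslack hVmax hV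
    (fun h h1 h2 s => (hφ h h1 h2 s).trans (by linarith))
    (l := fun s a => 15 / 2 * Fintype.card S * Vmax * ell₂ M k δ / D.N M.H k ω s a)
    (fun s a => by have := ell₂_ge M hδ hk1; positivity)
    (fun s a hN => g5 s a k hkK hN) (fun s a => rfl) 1 le_rfl (by omega) (D.s k 1 ω)
  have hreg := le_potential_add hplan hslack hVmax hV le_rfl (by omega) (D.s k 1 ω)
  have := hφ 1 le_rfl (by omega) (D.s k 1 ω)
  rw [Nat.add_sub_cancel] at hpot
  linarith

/-- Up to `κ` each episode costs at most `Vmax`; afterwards the suboptimality splits into the slack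
and a truncated expected cost. The cost event adds failure probability `δ/32`. -/
theorem Run.IsRunOf.failsLE_regret (hD : D.IsRunOf M μ) {Vmax : ℝ} (hVmax : 0 ≤ Vmax)
    (hV : M.ValueBounded Vmax) {σ : ℕ → S → A → ℝ} (hσ : ∀ h s a, 0 ≤ σ h s a) {Vα : ℝ}
    (hVα : 0 ≤ Vα) (hsub : SubExponentialReturns D M μ σ Vα) {c₁ : ℕ → ℝ}
    (hc₁ : ∀ k ≥ 1, 0 < c₁ k) (hc₁_mono : MonotoneOn c₁ (Set.Ici 1)) {c₂ : ℕ → ℝ≥0∞}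
    (hc₂_mono : MonotoneOn c₂ (Set.Ici 1)) (halg : D.FollowsEQOPlus M.H c₁ c₂ Vmax) {K : ℕ}
    (hK : 1 ≤ K) {δ : ℝ} (hδ : δ ∈ Set.Ioc (0 : ℝ) 1) {lam : ℕ → ℝ} {ι : ℕ → ℕ}
    (haux : IsAuxiliary M σ Vα δ c₁ lam ι) :
    FailsLE μ δ fun ω => D.regret M K ω ≤ regretBound M σ Vα Vmax δ c₁ c₂ ι K := by
  obtain ⟨W, w, hW⟩ := M.exists_maxProxy σ
  have hH := M.one_le_H
  have hδ0 := hδ.1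
  have hWs := hW.Wstar_nonneg
  set n := kappaMin M σ Vα Vmax δ c₁ c₂ ι K with hn
  have hnK : n ≤ K := kappaMin_le
  -- Costs are measured in units of `4 Vmax`. If `Vmax = 0`, all values vanish and so does the
  -- regret.
  rcases hVmax.eq_or_lt with h0 | hpos
  · refine FailsLE.of_ae (Filter.Eventually.of_forall fun ω => ?_)
    have hreg := regret_le_of_episode_bounds (D := D) hVmax hV hnK (ω := ω)
      (t := fun k => 18 * M.Wstar σ * ell₁ M (ι k) δ / c₁ k) fun k hk => by
        have hk1 : 1 ≤ k := by rw [Finset.mem_Icc] at hk; omega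
        have h1 := M.Vstar_mem hVmax hV le_rfl (by omega) (D.s k 1 ω)
        have h2 := M.V_mem hVmax hV (D.π k ω) le_rfl (by omega) (D.s k 1 ω)
        have h3 := hc₁ k hk1
        have h4 := ell₁_ge M hδ (haux.one_le k hk1)
        have : 0 ≤ 18 * M.Wstar σ * ell₁ M (ι k) δ / c₁ k := by positivity
        linarith [h1.2, h2.1]
    have hKH : (1 : ℝ) ≤ K * M.H := by exact_mod_cast Nat.mul_pos hK hH
    have hlog := Real.log_nonneg hKH
    have h3 := hc₁ K hK
    have hmin : 0 ≤ minMul (16 * c₁ K * Fintype.card S * Fintype.card A * Real.log (K * M.H))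
        (c₂ K) (16 * √2 * √(M.H * Fintype.card S * Fintype.card A * K)) :=
      minMul_nonneg (by positivity) (by positivity)
    rw [regretBound, ← hn, ← h0]
    rw [← h0] at hreg
    simp only [mul_zero, zero_mul, zero_add, add_zero] at hreg ⊢
    linarith
  · have hprob : Real.exp (-Real.log (32 / δ)) = δ / 32 := by
      rw [Real.exp_neg, Real.exp_log (by positivity), inv_div]
    have hcost := hD.failsLE_sum_truncatedCost (y := visitCost D M c₁ c₂ Vmax δ)
      (fun k _ => measurable_visitCost D M c₁ c₂ Vmax δ k)
      (fun k hk => visitCost_nonneg hpos.le hδ hk (hc₁ k hk)) (Real.log (32 / δ)) K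
    rw [hprob] at hcost
    refine ((hD.failsLE_suboptimality hpos hV hσ hVα hsub hc₁ halg K hδ haux).and hcost
      (by positivity) (by positivity)).mono (by linarith) ?_
    rintro ω ⟨hsubopt, hc⟩
    have hreg := regret_le_of_episode_bounds (D := D) hVmax hV hnK hsubopt
    rw [Finset.sum_add_distrib, ← Finset.mul_sum] at hreg
    -- The cost event concerns all episodes and does not involve `κ`; adding the nonnegative costs
    -- of the early episodes is harmless.
    have hle : ∑ k ∈ Finset.Icc (n + 1) K,
        D.truncatedCost M (visitCost D M c₁ c₂ Vmax δ) k ω M.H (D.s k 1 ω)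
        ≤ ∑ k ∈ Finset.Icc 1 K,
          D.truncatedCost M (visitCost D M c₁ c₂ Vmax δ) k ω M.H (D.s k 1 ω) :=
      Finset.sum_le_sum_of_subset_of_nonneg (Finset.Icc_subset_Icc_left (by omega))
        fun k hk _ => Run.truncatedCost_nonneg (visitCost_nonneg hpos.le hδ (Finset.mem_Icc.1 hk).1
          (hc₁ k (Finset.mem_Icc.1 hk).1) ω) _ _
    have hfin := sum_stepCost_visitCost_le (D := D) (M := M) hc₁ hc₁_mono hc₂_mono hpos hδ hK ω
    have := mul_le_mul_of_nonneg_left (hle.trans hc) (show 0 ≤ 4 * Vmax by positivity)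
    rw [regretBound, ← hn]
    linarith

end EQO

end

theorem theorem3 {S A Ω : Type*} [Fintype S] [DecidableEq S] [Nonempty S]
    [Fintype A] [DecidableEq A] [Nonempty A]
    [MeasurableSpace Ω] (μ : MeasureTheory.Measure Ω) [MeasureTheory.IsProbabilityMeasure μ]
    (M : EQO.MDP S A) (D : EQO.Run S A Ω) (hD : D.IsRunOf M μ)
    (Vmax : ℝ) (hVmax : 0 ≤ Vmax) (hV : M.ValueBounded Vmax)
    (σ : ℕ → S → A → ℝ) (hσ : ∀ h s a, 0 ≤ σ h s a) (Vα : ℝ) (hVα : 0 ≤ Vα)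
    (hsub : EQO.SubExponentialReturns D M μ σ Vα)
    (c₁ : ℕ → ℝ) (hc₁ : ∀ k ≥ 1, 0 < c₁ k) (hc₁_mono : MonotoneOn c₁ (Set.Ici 1))
    (c₂ : ℕ → ENNReal) (hc₂ : ∀ k ≥ 1, 0 < c₂ k) (hc₂_mono : MonotoneOn c₂ (Set.Ici 1))
    (halg : D.FollowsEQOPlus M.H c₁ c₂ Vmax)
    (K : ℕ) (hK : 1 ≤ K) (δ : ℝ) (hδ : δ ∈ Set.Ioc (0 : ℝ) 1) :
    (∃ (lam : ℕ → ℝ) (ι : ℕ → ℕ), EQO.IsAuxiliary M σ Vα δ c₁ lam ι ∧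
      ∀ k ≥ 1, ι k ≤ k ∧ (ι k : ℝ) ≤ 3 + Real.logb 2 (c₁ k / c₁ 1)) ∧
    ∀ (lam : ℕ → ℝ) (ι : ℕ → ℕ), EQO.IsAuxiliary M σ Vα δ c₁ lam ι →
      D.distRegret M μ K δ ≤ (EQO.regretBound M σ Vα Vmax δ c₁ c₂ ι K : EReal) := by
  refine ⟨EQO.exists_isAuxiliary M σ hVα hc₁ hc₁_mono hδ, fun lam ι haux => ?_⟩
  exact EQO.distRegret_le_of_failsLE
    (hD.failsLE_regret hVmax hV hσ hVα hsub hc₁ hc₁_mono hc₂_mono halg hK hδ haux)
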